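/- Let $\mathcal X,\mathcal Y$ be finite alphabets ($\mathcal X$ nonempty), $P_{Y|X}$ a channel from $\mathcal X$ to $\mathcal Y$, $Q_Y$ a distribution on $\mathcal Y$, $R>0$, and let $M_n\ge 1$ be integers with $\frac1n\log M_n\to R$ (for instance $M_n=\lceil e^{nR}\rceil$, or $M_n=e^{nR}$ when this is an integer). A random code of length $n$ consists of a random variable $U_n$ with a finite alphabet and a map $f_u:\{1,\dots,M_n\}\to\mathcal X^n$ for each value $u$ of $U_n$; it induces $$P_{Y^n|U_n}(y^n|u)=\frac1{M_n}\sum_{m=1}^{M_n}\prod_{i=1}^nP_{Y|X}\bigl(y_i\,|\,f_{u,i}(m)\bigr).$$ The code is a conventional random code if $U_n=\{X^n(m)\}_m$ with $X^n(1),\dots,X^n(M_n)$ independent with a common law $P_{X^n}$ and $f_{U_n}(m)=X^n(m)$. Let $Q_{Y^n}=Q_Y^n$. For $\alpha\ge0$, $\alpha\ne1$, let $D_\alpha(P\|Q)=\frac1{\alpha-1}\log\sum_{x:P(x)>0}P(x)^\alpha Q(x)^{1-\alpha}\in[0,\infty]$ (so $D_0(P\|Q)=-\log Q(\{P>0\})$),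 let $D_1=D$ be the relative entropy, and let $D(V\|W|\widetilde P_X)=\sum_x\widetilde P_X(x)D(V(\cdot|x)\|W(\cdot|x))$ with $0\cdot\infty=0$. Write $$\mathcal D_n^{(\alpha)}=\frac1n\inf_{f_{U_n}}D_\alpha(P_{Y^nU_n}\|Q_{Y^n}P_{U_n}),$$ the infimum being over all random codes of length $n$. Below, $\widetilde P_X$ ranges over distributions on $\mathcal X$, $\widetilde P_{Y|X},\widehat P_{Y|X}$ over channels, and $\widetilde P_Y=\widetilde P_{Y|X}\circ\widetilde P_X$ is the output distribution, $\widetilde P_Y(y)=\sum_x\widetilde P_{Y|X}(y|x)\widetilde P_X(x)$. (a) Suppose $P_{Y|X=x}\ll Q_Y$ for all $x$. For every $s\in[0,1]$, $$\lim_{n\to\infty}\mathcal D_n^{(1+s)}=\min_{\widetilde P_X}\max\Bigl\{\sum_x\widetilde P_X(x)D_{1+s}(P_{Y|X}(\cdot|x)\|Q_Y)-R,\ \max_{\widetilde P_{Y|X}}\eta_{1+s}(P_{Y|X},Q_Y,\widetilde P_X,\widetilde P_{Y|X})\Bigr\},$$ where $\eta_{1+s}=\bigl(-\frac1s-1\bigr)D(\widetilde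 P_{Y|X}\|P_{Y|X}|\widetilde P_X)+D(\widetilde P_Y\|Q_Y)$, with value $-\infty$ if $D(\widetilde P_{Y|X}\|P_{Y|X}|\widetilde P_X)=\infty$; for $s=0$ this is read as $D(\widetilde P_Y\|Q_Y)$ if $D(\widetilde P_{Y|X}\|P_{Y|X}|\widetilde P_X)=0$ and as $-\infty$ otherwise. The minimum and the maximum over $\widetilde P_{Y|X}$ are attained, and the same limit is reached by a sequence of conventional random codes. (b) For every $s\in(0,1)$, $$\Gamma^{\mathsf{LB}}_{1-s}\le\liminf_{n\to\infty}\mathcal D_n^{(1-s)}\le\limsup_{n\to\infty}\mathcal D_n^{(1-s)}\le\Gamma^{\mathsf{UB}}_{1-s},$$ where, with $A=\bigl(\frac1s-1\bigr)D(\widetilde P_{Y|X}\|P_{Y|X}|\widetilde P_X)+D(\widetilde P_{Y|X}\|Q_Y|\widetilde P_X)-R$, $$\Gamma^{\mathsf{LB}}_{1-s}=\min_{\widetilde P_X,\widetilde P_{Y|X}}\max\Bigl\{A,\ \bigl(\tfrac1s-1\bigr)D(\widetilde P_{Y|X}\|P_{Y|X}|\widetilde P_X)+D(\widetilde P_Y\|Q_Y)\Bigr\},$$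 $$\Gamma^{\mathsf{UB}}_{1-s}=\min_{\widetilde P_X,\widetilde P_{Y|X}}\max\Bigl\{A,\ \tfrac1sD(\widetilde P_{Y|X}\|P_{Y|X}|\widetilde P_X)+D(\widetilde P_Y\|Q_Y)-\min_{\widehat P_{Y|X}:\,\widehat P_{Y|X}\circ\widetilde P_X=\widetilde P_Y}D(\widehat P_{Y|X}\|P_{Y|X}|\widetilde P_X)\Bigr\},$$ the second maximum being $\infty$ when $A=\infty$. All these minima are attained (values in $(-\infty,\infty]$), and the upper bound $\Gamma^{\mathsf{UB}}_{1-s}$ on the limsup is achieved by a sequence of conventional random codes. (c) If some $x_0\in\mathcal X$ satisfies $Q_Y\ll P_{Y|X=x_0}$ (for instance, if $P_{Y|X}(y|x)>0$ for all $x,y$), then $\lim_{n\to\infty}\mathcal D_n^{(0)}=0$. -/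

import Mathlib

open Filter Topology

noncomputable section

/-- Probability distributions on a finite alphabet, as real vectors. -/
abbrev ProbDist (A : Type*) [Fintype A] : Type _ := stdSimplex ℝ A

/-- Absolute continuity `P ≪ Q` on a finite alphabet. -/
def AbsCont {A : Type*} (P Q : A → ℝ) : Prop := ∀ x, Q x = 0 → P x = 0

open Classical in
/-- Relative entropy `D(P‖Q) = ∑ P log (P / Q)`, equal to `⊤` unless `P ≪ Q`. -/
def relEntropy {A : Type*} [Fintype A] (P Q : A → ℝ) : EReal :=
  if AbsCont P Q then ((∑ x, P x * Real.log (P x / Q x) : ℝ) : EReal) else ⊤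

open Classical in
/-- Rényi divergence of order `α ≥ 0`: for `α ≠ 1` it is
`(α - 1)⁻¹ log ∑_{x : P x > 0} P(x)^α Q(x)^(1-α)`, with `log 0 = ⊥`, `log ⊤ = ⊤` and
`0 ^ (negative) = ⊤`, and for `α = 1` it is the relative entropy.
In particular `D_0(P‖Q) = - log Q {x | P x > 0}`. -/
def renyiDiv {A : Type*} [Fintype A] (α : ℝ) (P Q : A → ℝ) : EReal :=
  if α = 1 then relEntropy P Q
  else ((α - 1)⁻¹ : ℝ) * ENNReal.log (∑ x with 0 < P x,
    ENNReal.ofReal (P x) ^ α * ENNReal.ofReal (Q x) ^ (1 - α))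

/-! ### The resolvability problem -/

section Codes

variable {X Y : Type*} [Fintype X] [Fintype Y]

/-- The product distribution `Q^n`. -/
def prodDist (Q : Y → ℝ) (n : ℕ) (y : Fin n → Y) : ℝ := ∏ i, Q (y i)

/-- The output distribution of `n` uses of the memoryless channel `W` when the input is a uniformly
chosen codeword of the codebook `c`, i.e. `P(y) = M⁻¹ ∑ₘ ∏ᵢ W(yᵢ | cᵢ(m))`. -/
def outputDist (W : X → ProbDist Y) {M n : ℕ} (c : Fin M → Fin n → X) (y : Fin n → Y) : ℝ :=
  (M : ℝ)⁻¹ * ∑ m, ∏ i, W (c m i) (y i)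

/-- `D_α(P_{Y^n U} ‖ Q^n × P_U)` for common randomness `U` with law `pU` and the random mapping
`u ↦ f u` from messages to input words. -/
def codeDiv (α : ℝ) (W : X → ProbDist Y) (Q : ProbDist Y) {M n : ℕ} {U : Type*} [Fintype U]
    (pU : U → ℝ) (f : U → Fin M → Fin n → X) : EReal :=
  renyiDiv α (fun z : (Fin n → Y) × U => pU z.2 * outputDist W (f z.2) z.1)
    (fun z => prodDist Q n z.1 * pU z.2)

/-- The infimum of `D_α(P_{Y^n U} ‖ Q^n × P_U)` over all finite common randomness and all random
mappings with `M` messages and block length `n`. -/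
def resolvability (α : ℝ) (W : X → ProbDist Y) (Q : ProbDist Y) (M n : ℕ) : EReal :=
  ⨅ (k : ℕ) (pU : ProbDist (Fin k)) (f : Fin k → Fin M → Fin n → X), codeDiv α W Q pU f

/-- The same divergence for the conventional random code, whose `M` codewords are independent with
common law `pX` on `X^n` and are revealed as common randomness. -/
def conventionalDiv (α : ℝ) (W : X → ProbDist Y) (Q : ProbDist Y) (M n : ℕ) (pX : ProbDist (Fin n → X)) :
    EReal :=
  codeDiv α W Q (fun c : Fin M → Fin n → X => ∏ m, pX (c m)) id

end Codes

/-! ### The single-letter quantities -/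

section SingleLetter

variable {X Y : Type*} [Fintype X] [Fintype Y]

/-- The output distribution `V ∘ a`, i.e. `y ↦ ∑ₓ V(y|x) a(x)`. -/
def outMarginal (V : X → ProbDist Y) (a : ProbDist X) (y : Y) : ℝ := ∑ x, V x y * a x

/-- Conditional relative entropy `D(V ‖ W | a) = ∑ₓ a(x) D(V(·|x) ‖ W(·|x))`, with `0 * ⊤ = 0`. -/
def condRelEntropy (V W : X → ProbDist Y) (a : ProbDist X) : EReal :=
  ∑ x, ((a x : ℝ) : EReal) * relEntropy (V x) (W x)

open Classical in
/-- `η_{1+s} = (-1/s - 1) D(V ‖ W | a) + D(V ∘ a ‖ Q)`; at `s = 0` the coefficient is its limit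
`-∞`, so that the value is `D(V ∘ a ‖ Q)` if `D(V ‖ W | a) = 0` and `-∞` otherwise. It is also `-∞`
whenever `D(V ‖ W | a) = ∞`. -/
def eta (s : ℝ) (W : X → ProbDist Y) (Q : ProbDist Y) (a : ProbDist X) (V : X → ProbDist Y) : EReal :=
  (if s = 0 then ⊥ else ((-1 / s - 1 : ℝ) : EReal)) * condRelEntropy V W a
    + relEntropy (outMarginal V a) Q

/-- The function of the input distribution that is minimized for the orders `1 + s`. -/
def plusObjective (s : ℝ) (W : X → ProbDist Y) (Q : ProbDist Y) (R : ℝ) (a : ProbDist X) : EReal :=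
  max ((∑ x, ((a x : ℝ) : EReal) * renyiDiv (1 + s) (W x) Q) - (R : EReal))
    (⨆ V : X → ProbDist Y, eta s W Q a V)

/-- The single-letter expression for the orders `1 + s`. -/
def gammaPlus (s : ℝ) (W : X → ProbDist Y) (Q : ProbDist Y) (R : ℝ) : EReal :=
  ⨅ a : ProbDist X, plusObjective s W Q R a

/-- The first term of the maxima in both bounds for the orders `1 - s`. -/
def rateTerm (s : ℝ) (W : X → ProbDist Y) (Q : ProbDist Y) (R : ℝ) (a : ProbDist X) (V : X → ProbDist Y) :
    EReal :=
  ((1 / s - 1 : ℝ) : EReal) * condRelEntropy V W a + condRelEntropy V (fun _ => Q) a - (R : EReal)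

/-- The function that is minimized in the lower bound for the orders `1 - s`. -/
def lbObjective (s : ℝ) (W : X → ProbDist Y) (Q : ProbDist Y) (R : ℝ) (a : ProbDist X) (V : X → ProbDist Y) :
    EReal :=
  max (rateTerm s W Q R a V)
    (((1 / s - 1 : ℝ) : EReal) * condRelEntropy V W a + relEntropy (outMarginal V a) Q)

/-- The lower bound `Γ^LB_{1-s}`. -/
def gammaLB (s : ℝ) (W : X → ProbDist Y) (Q : ProbDist Y) (R : ℝ) : EReal :=
  ⨅ (a : ProbDist X) (V : X → ProbDist Y), lbObjective s W Q R a V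

/-- The least `D(V' ‖ W | a)` over the `V'` with the same output distribution as `V` under `a`. -/
def minCondRelEntropy (W : X → ProbDist Y) (a : ProbDist X) (V : X → ProbDist Y) : EReal :=
  ⨅ (V' : X → ProbDist Y) (_ : outMarginal V' a = outMarginal V a), condRelEntropy V' W a

/-- The function that is minimized in the upper bound for the orders `1 - s`.
If `minCondRelEntropy W a V = ⊤` then `condRelEntropy V W a = ⊤`, so for `0 < s < 1` the first
term of the maximum is `⊤` and the value of the difference `⊤ - ⊤` does not matter. -/
def ubObjective (s : ℝ) (W : X → ProbDist Y) (Q : ProbDist Y) (R : ℝ) (a : ProbDist X) (V : X → ProbDist Y) :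
    EReal :=
  max (rateTerm s W Q R a V)
    (((1 / s : ℝ) : EReal) * condRelEntropy V W a + relEntropy (outMarginal V a) Q
      - minCondRelEntropy W a V)

/-- The upper bound `Γ^UB_{1-s}`. -/
def gammaUB (s : ℝ) (W : X → ProbDist Y) (Q : ProbDist Y) (R : ℝ) : EReal :=
  ⨅ (a : ProbDist X) (V : X → ProbDist Y), ubObjective s W Q R a V

end SingleLetter

end

set_option linter.unusedSectionVars false

/-! The common randomness multiplies both arguments of the divergence, so it enters the power sum
with total exponent one: the power sum of a random code is the average of the power sums of its
codebooks (`powSum_mixture`). A bound for every codebook is thus a bound for every random code, and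
a bound on the average over independent codewords is a bound for a conventional code.

Converse, orders `1 + s`. Let `a` be the letter distribution averaged over all codewords and
positions. Keeping a single codeword in the output mixture gives the rate term
(`rate_le_log_powSum`). Sending the same codebook through a test channel `V` and inserting its
output law in the variational formula gives the exponent `η`: the log-sum inequality keeps the price
of `V` below `n D(V‖W|a)`, and a relative entropy to a product law is at least `n` times that of the
averaged marginal (`eta_le_log_powSum`). Both bounds hold at the same `a`, whence a maximum followed
by a minimum over `a`.

Converse, orders `1 - s`. The tilted law proportional to `P^(1-s) (Q^n)^s` attains equality in the
variational formula. Attaching the posterior law of the message gives a joint law of codeword and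
output, and its averaged joint letter distribution satisfies both single-letter inequalities
(`exists_jointDist_le_neg_log_powSum`).

Achievability. The codewords are independent uniform rearrangements of one word whose type is nearly
optimal. Given one codeword, the mean of the output mixture is at most `M⁻¹ w + E w`; a tangent
line, by concavity of `u^s` or convexity of `u^(-s)`, puts this value in place of the mixture
(`sum_prod_mul_rpow_le`, `le_sum_prod_mul_rpow`). Everything is then invariant under permutations,
and the method of types evaluates it up to polynomial factors. The codeword's own contribution gives
the rate term; the averaged output law gives the other exponent, in which the minimum over couplings
is the exponent of the probability of an output orbit (`exists_permOutput_le`).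

Compactness and continuity connect types with arbitrary distributions. For the upper bound at orders
`1 - s`, upper semicontinuity of the inner minimum makes the outer minimum attained, and its lower
semicontinuity serves the coding bound. Order `1` follows from the orders `1 + t` by monotonicity
and `t → 0`. At order `0` a constant code has divergence exactly zero. -/

/-! ### Elementary entropy inequalities -/

section Entropy

variable {A : Type*} [Fintype A]

/-- Jensen's inequality for the logarithm. -/
theorem sum_mul_log_le_log_sum {p t : A → ℝ} (hp : ∀ i, 0 ≤ p i) (hp1 : ∑ i, p i = 1)
    (ht : ∀ i, 0 < p i → 0 < t i) : ∑ i, p i * Real.log (t i) ≤ Real.log (∑ i, p i * t i) := by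
  have hnn : ∀ i, 0 ≤ p i * t i := fun i => by
    rcases (hp i).eq_or_lt with h | h
    · simp [← h]
    · exact (mul_pos h (ht i h)).le
  obtain ⟨j, hj⟩ : ∃ j, 0 < p j := by
    by_contra! h
    have : ∑ i, p i = 0 := Finset.sum_eq_zero fun i _ => le_antisymm (h i) (hp i)
    linarith
  have hT : 0 < ∑ i, p i * t i :=
    Finset.sum_pos' (fun i _ => hnn i) ⟨j, Finset.mem_univ j, mul_pos hj (ht j hj)⟩
  set T := ∑ i, p i * t i with hTdef
  have key : ∀ i, p i * Real.log (t i) ≤ p i * t i / T - p i + p i * Real.log T := fun i => by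
    rcases (hp i).eq_or_lt with h | h
    · simp [← h]
    · have h1 := Real.log_le_sub_one_of_pos (div_pos (ht i h) hT)
      rw [Real.log_div (ht i h).ne' hT.ne'] at h1
      have := mul_le_mul_of_nonneg_left h1 h.le
      have e : p i * t i / T = p i * (t i / T) := by ring
      rw [e]
      linarith
  calc ∑ i, p i * Real.log (t i) ≤ ∑ i, (p i * t i / T - p i + p i * Real.log T) :=
        Finset.sum_le_sum fun i _ => key i
    _ = Real.log T := by
        rw [Finset.sum_add_distrib, Finset.sum_sub_distrib, ← Finset.sum_div, ← Finset.sum_mul,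
          hp1, ← hTdef, div_self hT.ne']
        ring

/-- Gibbs' inequality. -/
theorem sum_mul_log_le_sum_mul_log_self {p r : A → ℝ} (hp : ∀ i, 0 ≤ p i) (hr : ∀ i, 0 ≤ r i)
    (hpr : ∀ i, 0 < p i → 0 < r i) (hs : ∑ i, r i ≤ ∑ i, p i) :
    ∑ i, p i * Real.log (r i) ≤ ∑ i, p i * Real.log (p i) := by
  have key : ∀ i, p i * Real.log (r i) ≤ p i * Real.log (p i) + (r i - p i) := fun i => by
    rcases (hp i).eq_or_lt with h | h
    · simp [← h, hr i]
    · have h1 := Real.log_le_sub_one_of_pos (div_pos (hpr i h) h)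
      rw [Real.log_div (hpr i h).ne' h.ne'] at h1
      have := mul_le_mul_of_nonneg_left h1 h.le
      have e : p i * (r i / p i - 1) = r i - p i := by field_simp
      linarith
  calc ∑ i, p i * Real.log (r i) ≤ ∑ i, (p i * Real.log (p i) + (r i - p i)) :=
        Finset.sum_le_sum fun i _ => key i
    _ ≤ _ := by
        rw [Finset.sum_add_distrib, Finset.sum_sub_distrib]
        linarith

/-- The log-sum inequality. -/
theorem log_sum_inequality {v w : A → ℝ} (hv : ∀ i, 0 ≤ v i) (hw : ∀ i, 0 ≤ w i)
    (hvw : ∀ i, 0 < v i → 0 < w i) :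
    (∑ i, v i) * (Real.log (∑ i, v i) - Real.log (∑ i, w i)) ≤
      ∑ i, v i * (Real.log (v i) - Real.log (w i)) := by
  rcases (Finset.sum_nonneg fun i _ => hv i : 0 ≤ ∑ i, v i).eq_or_lt with h | h
  · have : ∀ i, v i = 0 := fun i =>
      (Finset.sum_eq_zero_iff_of_nonneg fun i _ => hv i).1 h.symm i (Finset.mem_univ i)
    simp [this]
  · set S := ∑ i, v i with hS
    have hwpos : 0 < ∑ i, w i := by
      obtain ⟨j, hj⟩ : ∃ j, 0 < v j := by
        by_contra! h'
        exact h.ne' (Finset.sum_eq_zero fun i _ => le_antisymm (h' i) (hv i))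
      exact Finset.sum_pos' (fun i _ => hw i) ⟨j, Finset.mem_univ j, hvw j hj⟩
    set T := ∑ i, w i with hT
    -- Gibbs' inequality against `w` rescaled to the total mass of `v`.
    have hG := sum_mul_log_le_sum_mul_log_self (p := v) (r := fun i => S / T * w i) hv
      (fun i => mul_nonneg (by positivity) (hw i)) (fun i hi => mul_pos (by positivity) (hvw i hi))
      (by rw [← Finset.mul_sum, ← hT, div_mul_cancel₀ _ hwpos.ne'])
    have e : ∑ i, v i * Real.log (S / T * w i) =
        S * (Real.log S - Real.log T) + ∑ i, v i * Real.log (w i) := by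
      rw [hS, Finset.sum_mul, ← Finset.sum_add_distrib]
      refine Finset.sum_congr rfl fun i _ => ?_
      rcases (hv i).eq_or_lt with h0 | h0
      · simp [← h0]
      · rw [Real.log_mul (by positivity) (hvw i h0).ne', Real.log_div h.ne' hwpos.ne']
        ring
    simp only [mul_sub, Finset.sum_sub_distrib] at *
    linarith

end Entropy

/-! ### Rényi divergences as real numbers -/

section Renyi

variable {A : Type*} [Fintype A]

/-- The sum `∑ P^α Q^(1-α)` inside the Rényi divergence. -/
noncomputable def powSum (α : ℝ) (P Q : A → ℝ) : ℝ := ∑ x, P x ^ α * Q x ^ (1 - α)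

theorem powSum_nonneg {α : ℝ} {P Q : A → ℝ} (hP : ∀ x, 0 ≤ P x) (hQ : ∀ x, 0 ≤ Q x) :
    0 ≤ powSum α P Q :=
  Finset.sum_nonneg fun x _ => mul_nonneg (Real.rpow_nonneg (hP x) _) (Real.rpow_nonneg (hQ x) _)

/-- Extended and real powers differ only at zero with a negative exponent, where the former is `⊤`
and the latter `0`. This needs `α > 1` and `Q x = 0 < P x`, which the last hypothesis excludes. -/
theorem sum_ofReal_rpow_eq {α : ℝ} {P Q : A → ℝ} (hα : 0 < α) (hP : ∀ x, 0 ≤ P x)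
    (hQ : ∀ x, 0 ≤ Q x) (h : α ≤ 1 ∨ AbsCont P Q) :
    ∑ x with 0 < P x, ENNReal.ofReal (P x) ^ α * ENNReal.ofReal (Q x) ^ (1 - α) =
      ENNReal.ofReal (powSum α P Q) := by
  rw [powSum, ENNReal.ofReal_sum_of_nonneg
    fun x _ => mul_nonneg (Real.rpow_nonneg (hP x) _) (Real.rpow_nonneg (hQ x) _),
    Finset.sum_filter]
  refine Finset.sum_congr rfl fun x _ => ?_
  split_ifs with hx
  · rw [ENNReal.ofReal_mul (Real.rpow_nonneg (hP x) _), ENNReal.ofReal_rpow_of_pos hx]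
    congr 1
    rcases h with h | h
    · exact ENNReal.ofReal_rpow_of_nonneg (hQ x) (by linarith)
    · exact ENNReal.ofReal_rpow_of_pos ((hQ x).lt_of_ne fun h0 => hx.ne' (h x h0.symm))
  · have : P x = 0 := le_antisymm (not_lt.1 hx) (hP x)
    simp [this, Real.zero_rpow hα.ne']

theorem renyiDiv_eq_coe {α : ℝ} {P Q : A → ℝ} (hα : 0 < α) (hα1 : α ≠ 1) (hP : ∀ x, 0 ≤ P x)
    (hQ : ∀ x, 0 ≤ Q x) (h : α ≤ 1 ∨ AbsCont P Q) (hS : 0 < powSum α P Q) :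
    renyiDiv α P Q = (((α - 1)⁻¹ * Real.log (powSum α P Q) : ℝ) : EReal) := by
  rw [renyiDiv, if_neg hα1, sum_ofReal_rpow_eq hα hP hQ h, ENNReal.log_ofReal_of_pos hS,
    EReal.coe_mul]

theorem renyiDiv_eq_top {α : ℝ} {P Q : A → ℝ} (hα : 0 < α) (hα1 : α < 1) (hP : ∀ x, 0 ≤ P x)
    (hQ : ∀ x, 0 ≤ Q x) (hS : powSum α P Q = 0) : renyiDiv α P Q = ⊤ := by
  rw [renyiDiv, if_neg hα1.ne, sum_ofReal_rpow_eq hα hP hQ (Or.inl hα1.le), hS]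
  simp only [ENNReal.ofReal_zero, ENNReal.log_zero]
  exact EReal.coe_mul_bot_of_neg (inv_lt_zero.2 (by linarith))

theorem relEntropy_comp_equiv {B : Type*} [Fintype B] (e : B ≃ A) (P Q : A → ℝ) :
    relEntropy (P ∘ e) (Q ∘ e) = relEntropy P Q := by
  have h : AbsCont (P ∘ e) (Q ∘ e) ↔ AbsCont P Q := by
    refine ⟨fun h x hx => ?_, fun h x => h (e x)⟩
    simpa using h (e.symm x) (by simpa using hx)
  by_cases hc : AbsCont P Q
  · rw [relEntropy, relEntropy, if_pos (h.2 hc), if_pos hc]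
    congr 1
    exact e.sum_comp fun x => P x * Real.log (P x / Q x)
  · rw [relEntropy, relEntropy, if_neg (mt h.1 hc), if_neg hc]

theorem renyiDiv_comp_equiv {B : Type*} [Fintype B] (α : ℝ) (e : B ≃ A) (P Q : A → ℝ) :
    renyiDiv α (P ∘ e) (Q ∘ e) = renyiDiv α P Q := by
  simp only [renyiDiv, relEntropy_comp_equiv, Finset.sum_filter]
  congr 3
  exact e.sum_comp fun x =>
    if 0 < P x then ENNReal.ofReal (P x) ^ α * ENNReal.ofReal (Q x) ^ (1 - α) else 0

end Renyi

/-! ### Divergences of codes -/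

section Codes

variable {X Y : Type*} [Fintype X] [Fintype Y]

theorem ProbDist.nonneg (P : ProbDist X) (x : X) : 0 ≤ P x := P.2.1 x

theorem ProbDist.sum_eq_one (P : ProbDist X) : ∑ x, P x = 1 := P.2.2

theorem prodDist_nonneg {n : ℕ} {Q : Y → ℝ} (hQ : ∀ y, 0 ≤ Q y) (y : Fin n → Y) :
    0 ≤ prodDist Q n y := Finset.prod_nonneg fun i _ => hQ (y i)

theorem sum_prod_apply {n : ℕ} (V : Fin n → Y → ℝ) :
    ∑ y : Fin n → Y, ∏ i, V i (y i) = ∏ i, ∑ b, V i b := by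
  classical
  rw [Finset.prod_univ_sum]
  simp

theorem sum_prodDist {n : ℕ} {Q : Y → ℝ} (hQ : ∑ y, Q y = 1) : ∑ y, prodDist Q n y = 1 := by
  simp [prodDist, sum_prod_apply (fun _ : Fin n => Q), hQ]

theorem outputDist_nonneg (W : X → ProbDist Y) {M n : ℕ} (c : Fin M → Fin n → X) (y : Fin n → Y) :
    0 ≤ outputDist W c y :=
  mul_nonneg (by positivity) (Finset.sum_nonneg fun m _ => Finset.prod_nonneg fun i _ =>
    (W (c m i)).nonneg _)

theorem sum_outputDist (W : X → ProbDist Y) {M n : ℕ} (hM : 0 < M) (c : Fin M → Fin n → X) :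
    ∑ y, outputDist W c y = 1 := by
  simp only [outputDist]
  rw [← Finset.mul_sum, Finset.sum_comm]
  have : ∀ m, ∑ y : Fin n → Y, ∏ i, W (c m i) (y i) = 1 := fun m => by
    rw [sum_prod_apply (fun i => (W (c m i) : Y → ℝ))]
    simp
  simp only [this]
  simp [hM.ne']

theorem absCont_outputDist {W : X → ProbDist Y} {Q : ProbDist Y} (h : ∀ x, AbsCont (W x) Q)
    {M n : ℕ} (c : Fin M → Fin n → X) : AbsCont (outputDist W c) (prodDist Q n) := by
  intro y hy
  obtain ⟨i, -, hi⟩ := Finset.prod_eq_zero_iff.1 hy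
  rw [outputDist, Finset.sum_eq_zero, mul_zero]
  exact fun m _ => Finset.prod_eq_zero (Finset.mem_univ i) (h _ _ hi)

/-! ### Averaging over the common randomness. -/

section Mixture

variable {U A : Type*} [Fintype U] [Fintype A]

/-- The weight of `u` occurs with exponents `α` and `1 - α`, whose sum is one. This linearity
reduces random codes to single codebooks. -/
theorem powSum_mixture {α : ℝ} (hα : α ≠ 0) {pU : U → ℝ} (hU : ∀ u, 0 ≤ pU u) {P : U → A → ℝ}
    (hP : ∀ u y, 0 ≤ P u y) {Q : A → ℝ} (hQ : ∀ y, 0 ≤ Q y) :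
    powSum α (fun z : A × U => pU z.2 * P z.2 z.1) (fun z => Q z.1 * pU z.2) =
      ∑ u, pU u * powSum α (P u) Q := by
  simp only [powSum, Finset.mul_sum]
  rw [Finset.sum_comm, Fintype.sum_prod_type]
  refine Finset.sum_congr rfl fun y _ => Finset.sum_congr rfl fun u _ => ?_
  rcases (hU u).eq_or_lt with h | h
  · simp [← h, Real.zero_rpow hα]
  · rw [Real.mul_rpow h.le (hP u y), Real.mul_rpow (hQ y) h.le]
    have : pU u ^ α * pU u ^ (1 - α) = pU u := by
      rw [← Real.rpow_add h]
      simp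
    linear_combination (P u y ^ α * Q y ^ (1 - α)) * this

theorem absCont_mixture {pU : U → ℝ} {P : U → A → ℝ} {Q : A → ℝ} (h : ∀ u, AbsCont (P u) Q) :
    AbsCont (fun z : A × U => pU z.2 * P z.2 z.1) (fun z => Q z.1 * pU z.2) := by
  rintro ⟨y, u⟩ hz
  rcases mul_eq_zero.1 hz with h0 | h0
  · simp [h u y h0]
  · simp [show pU u = 0 from h0]

theorem relEntropy_mixture {pU : U → ℝ} {P : U → A → ℝ} {Q : A → ℝ}
    (h : ∀ u, AbsCont (P u) Q) :
    relEntropy (fun z : A × U => pU z.2 * P z.2 z.1) (fun z => Q z.1 * pU z.2) =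
      ((∑ u, pU u * ∑ y, P u y * Real.log (P u y / Q y) : ℝ) : EReal) := by
  rw [relEntropy, if_pos (absCont_mixture h)]
  congr 1
  simp only [Finset.mul_sum]
  rw [Finset.sum_comm, Fintype.sum_prod_type]
  refine Finset.sum_congr rfl fun y _ => Finset.sum_congr rfl fun u _ => ?_
  by_cases h0 : pU u = 0
  · simp [h0]
  · rw [mul_comm (Q y), mul_div_mul_left _ _ h0]
    ring

end Mixture

theorem codeDiv_eq_coe {α : ℝ} {W : X → ProbDist Y} {Q : ProbDist Y} {M n : ℕ} {U : Type*}
    [Fintype U] (hα : 0 < α) (hα1 : α ≠ 1) (h : α ≤ 1 ∨ ∀ x, AbsCont (W x) Q) {pU : U → ℝ}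
    (hU : ∀ u, 0 ≤ pU u) (f : U → Fin M → Fin n → X)
    (hS : 0 < ∑ u, pU u * powSum α (outputDist W (f u)) (prodDist Q n)) :
    codeDiv α W Q pU f =
      (((α - 1)⁻¹ * Real.log (∑ u, pU u * powSum α (outputDist W (f u)) (prodDist Q n)) : ℝ) :
        EReal) := by
  have e := powSum_mixture hα.ne' hU (P := fun u => outputDist W (f u))
    (fun u => outputDist_nonneg W (f u)) (Q := prodDist Q n) (prodDist_nonneg Q.nonneg)
  rw [codeDiv, renyiDiv_eq_coe hα hα1 (fun z => mul_nonneg (hU _) (outputDist_nonneg W _ _))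
    (fun z => mul_nonneg (prodDist_nonneg Q.nonneg _) (hU _))
    (h.imp_right fun h => absCont_mixture fun u => absCont_outputDist h _) (by rwa [e]), e]

theorem codeDiv_eq_top {α : ℝ} {W : X → ProbDist Y} {Q : ProbDist Y} {M n : ℕ} {U : Type*}
    [Fintype U] (hα : 0 < α) (hα1 : α < 1) {pU : U → ℝ}
    (hU : ∀ u, 0 ≤ pU u) (f : U → Fin M → Fin n → X)
    (hS : ∑ u, pU u * powSum α (outputDist W (f u)) (prodDist Q n) = 0) :
    codeDiv α W Q pU f = ⊤ := by
  have e := powSum_mixture hα.ne' hU (P := fun u => outputDist W (f u))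
    (fun u => outputDist_nonneg W (f u)) (Q := prodDist Q n) (prodDist_nonneg Q.nonneg)
  exact renyiDiv_eq_top hα hα1 (fun z => mul_nonneg (hU _) (outputDist_nonneg W _ _))
    (fun z => mul_nonneg (prodDist_nonneg Q.nonneg _) (hU _)) (by rw [e, hS])

theorem codeDiv_one_eq_coe {W : X → ProbDist Y} {Q : ProbDist Y} {M n : ℕ} {U : Type*}
    [Fintype U] (h : ∀ x, AbsCont (W x) Q) (pU : U → ℝ) (f : U → Fin M → Fin n → X) :
    codeDiv 1 W Q pU f =
      ((∑ u, pU u * ∑ y, outputDist W (f u) y *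
        Real.log (outputDist W (f u) y / prodDist Q n y) : ℝ) : EReal) := by
  rw [codeDiv, renyiDiv, if_pos rfl, relEntropy_mixture fun u => absCont_outputDist h (f u)]

/-- The randomness of a conventional code is a codebook, whereas `resolvability` ranges over `Fin
k`; relabelling costs nothing. -/
theorem codeDiv_comp_equiv (α : ℝ) (W : X → ProbDist Y) (Q : ProbDist Y) {M n : ℕ} {U U' : Type*}
    [Fintype U] [Fintype U'] (e : U' ≃ U) (pU : U → ℝ) (f : U → Fin M → Fin n → X) :
    codeDiv α W Q (pU ∘ e) (f ∘ e) = codeDiv α W Q pU f :=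
  renyiDiv_comp_equiv α ((Equiv.refl _).prodCongr e)
    (fun z : (Fin n → Y) × U => pU z.2 * outputDist W (f z.2) z.1)
    (fun z => prodDist Q n z.1 * pU z.2)

theorem sum_prod_codebook {M n : ℕ} (pX : ProbDist (Fin n → X)) :
    ∑ c : Fin M → Fin n → X, ∏ m, pX (c m) = 1 := by
  have := sum_prod_apply (fun _ : Fin M => (pX : (Fin n → X) → ℝ))
  simpa [ProbDist.sum_eq_one] using this

/-- The best random code is at least as good as every conventional random code. -/
theorem resolvability_le_conventionalDiv (α : ℝ) (W : X → ProbDist Y) (Q : ProbDist Y) (M n : ℕ)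
    (pX : ProbDist (Fin n → X)) :
    resolvability α W Q M n ≤ conventionalDiv α W Q M n pX := by
  classical
  let e := (Fintype.equivFin (Fin M → Fin n → X)).symm
  rw [conventionalDiv, ← codeDiv_comp_equiv α W Q e]
  refine iInf_le_of_le _ (iInf_le_of_le ⟨(fun c : Fin M → Fin n → X => ∏ m, pX (c m)) ∘ e,
    fun i => Finset.prod_nonneg fun m _ => pX.nonneg _, ?_⟩ (iInf_le _ _))
  exact (e.sum_comp fun c : Fin M → Fin n → X => ∏ m, pX (c m)).trans (sum_prod_codebook pX)

end Codes

/-! ### Empirical distributions -/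

section Empirical

variable {A B : Type*} [Fintype A] [Fintype B]

open Classical in
/-- The number of occurrences of a letter in a word. -/
noncomputable def letterCount {n : ℕ} (z : Fin n → A) (a : A) : ℕ := Fintype.card {i // z i = a}

/-- The empirical distribution of a word. -/
noncomputable def emp {n : ℕ} (z : Fin n → A) (a : A) : ℝ := letterCount z a / n

open Classical in
theorem letterCount_eq_sum {n : ℕ} (z : Fin n → A) (a : A) :
    (letterCount z a : ℝ) = ∑ i, if z i = a then 1 else 0 := by
  rw [letterCount, Fintype.card_subtype]
  simp

theorem emp_nonneg {n : ℕ} (z : Fin n → A) (a : A) : 0 ≤ emp z a := by unfold emp; positivity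

theorem sum_letterCount {n : ℕ} (z : Fin n → A) (φ : A → ℝ) :
    ∑ a, (letterCount z a : ℝ) * φ a = ∑ i, φ (z i) := by
  classical
  simp only [letterCount_eq_sum, Finset.sum_mul]
  rw [Finset.sum_comm]
  simp

theorem sum_letterCount_eq {n : ℕ} (z : Fin n → A) : ∑ a, letterCount z a = n := by
  have := sum_letterCount z fun _ => 1
  simp only [mul_one] at this
  simp only [Finset.sum_const, Finset.card_univ, Fintype.card_fin, nsmul_eq_mul, mul_one] at this
  exact_mod_cast this

theorem letterCount_le {n : ℕ} (z : Fin n → A) (a : A) : letterCount z a ≤ n := by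
  classical
  exact (Fintype.card_subtype_le _).trans_eq (Fintype.card_fin n)

theorem letterCount_pos {n : ℕ} (z : Fin n → A) (i : Fin n) : 0 < letterCount z (z i) := by
  classical exact Fintype.card_pos_iff.2 ⟨⟨i, rfl⟩⟩

theorem natCast_mul_emp {n : ℕ} (z : Fin n → A) (a : A) : n * emp z a = letterCount z a := by
  rcases n.eq_zero_or_pos with rfl | h
  · have := letterCount_le z a
    simp [Nat.le_zero.1 this]
  · unfold emp
    field_simp

theorem sum_apply_eq_emp {n : ℕ} (z : Fin n → A) (φ : A → ℝ) :
    ∑ i, φ (z i) = n * ∑ a, emp z a * φ a := by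
  rw [Finset.mul_sum, ← sum_letterCount]
  exact Finset.sum_congr rfl fun a _ => by rw [← mul_assoc, natCast_mul_emp]

theorem sum_emp {n : ℕ} (hn : 0 < n) (z : Fin n → A) : ∑ a, emp z a = 1 := by
  simp only [emp]
  rw [← Finset.sum_div, ← Nat.cast_sum, sum_letterCount_eq, div_self (by positivity)]

theorem emp_pos {n : ℕ} (z : Fin n → A) (i : Fin n) : 0 < emp z (z i) :=
  div_pos (by exact_mod_cast letterCount_pos z i) (by exact_mod_cast i.pos)

theorem exists_apply_of_emp_ne_zero {n : ℕ} {z : Fin n → A} {a : A} (h : emp z a ≠ 0) :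
    ∃ i, z i = a := by
  by_contra! h'
  refine h ?_
  have : letterCount z a = 0 := by
    classical
    rw [letterCount, Fintype.card_eq_zero_iff]
    exact ⟨fun i => h' _ i.2⟩
  simp [emp, this]

theorem prod_apply_eq_exp {n : ℕ} (z : Fin n → A) {φ : A → ℝ} (h : ∀ i, 0 < φ (z i)) :
    ∏ i, φ (z i) = Real.exp (n * ∑ a, emp z a * Real.log (φ a)) := by
  rw [← sum_apply_eq_emp, Real.exp_sum]
  exact Finset.prod_congr rfl fun i _ => (Real.exp_log (h i)).symm

open Classical in
theorem letterCount_comp {n : ℕ} (g : A → B) (z : Fin n → A) (b : B) :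
    (letterCount (g ∘ z) b : ℝ) = ∑ a, if g a = b then (letterCount z a : ℝ) else 0 := by
  have := sum_letterCount z fun a => if g a = b then (1 : ℝ) else 0
  rw [letterCount_eq_sum]
  simp only [mul_ite, mul_one, mul_zero] at this
  exact this.symm

open Classical in
theorem emp_comp {n : ℕ} (g : A → B) (z : Fin n → A) (b : B) :
    emp (g ∘ z) b = ∑ a, if g a = b then emp z a else 0 := by
  simp only [emp, letterCount_comp]
  rw [Finset.sum_div]
  exact Finset.sum_congr rfl fun a _ => by split_ifs <;> simp

theorem emp_comp_perm {n : ℕ} (z : Fin n → A) (σ : Equiv.Perm (Fin n)) : emp (z ∘ σ) = emp z := by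
  classical
  ext a
  simp only [emp, letterCount_eq_sum]
  congr 1
  exact Equiv.sum_comp σ fun i => if z i = a then (1 : ℝ) else 0

/-- The Shannon entropy. -/
noncomputable def entropy (p : A → ℝ) : ℝ := -∑ a, p a * Real.log (p a)

theorem continuous_entropy : Continuous (entropy : (A → ℝ) → ℝ) :=
  (continuous_finsetSum _ fun a _ =>
    Real.continuous_mul_log.comp (continuous_apply a)).neg

/-- The probability of a word under its own type depends on the entropy alone; this is the basis of
all orbit counts below. -/
theorem prod_emp_eq_exp {n : ℕ} (z : Fin n → A) :
    ∏ i, emp z (z i) = Real.exp (-(n * entropy (emp z))) := by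
  rw [prod_apply_eq_exp z (emp_pos z), entropy]
  ring_nf

/-- The mixture of the empirical distributions of words `z i` with weights `P' i`. -/
noncomputable def avgEmp {I : Type*} [Fintype I] {n : ℕ} (P' : I → ℝ) (z : I → Fin n → A) (a : A) : ℝ :=
  ∑ i, P' i * emp (z i) a

section AvgEmp

variable {I : Type*} [Fintype I] {n : ℕ} {P' : I → ℝ}

theorem avgEmp_nonneg (h : ∀ i, 0 ≤ P' i) (z : I → Fin n → A) (a : A) : 0 ≤ avgEmp P' z a :=
  Finset.sum_nonneg fun i _ => mul_nonneg (h i) (emp_nonneg _ _)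

theorem sum_avgEmp_mul (P' : I → ℝ) (z : I → Fin n → A) (φ : A → ℝ) :
    ∑ i, P' i * ∑ j, φ (z i j) = n * ∑ a, avgEmp P' z a * φ a := by
  simp only [sum_apply_eq_emp, avgEmp, Finset.mul_sum, Finset.sum_mul]
  rw [Finset.sum_comm]
  exact Finset.sum_congr rfl fun a _ => Finset.sum_congr rfl fun i _ => by ring

theorem sum_avgEmp (hn : 0 < n) (h1 : ∑ i, P' i = 1) (z : I → Fin n → A) :
    ∑ a, avgEmp P' z a = 1 := by
  simp only [avgEmp]
  rw [Finset.sum_comm]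
  simp only [← Finset.mul_sum, sum_emp hn, mul_one, h1]

open Classical in
theorem avgEmp_comp (P' : I → ℝ) (g : A → B) (z : I → Fin n → A) (b : B) :
    avgEmp P' (fun i => g ∘ z i) b = ∑ a, if g a = b then avgEmp P' z a else 0 := by
  simp only [avgEmp, emp_comp, Finset.mul_sum]
  rw [Finset.sum_comm]
  refine Finset.sum_congr rfl fun a _ => ?_
  split_ifs <;> simp

theorem avgEmp_pos (h : ∀ i, 0 ≤ P' i) (z : I → Fin n → A) {i : I} (hi : 0 < P' i) (j : Fin n) :
    0 < avgEmp P' z (z i j) :=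
  Finset.sum_pos' (fun i _ => mul_nonneg (h i) (emp_nonneg _ _))
    ⟨i, Finset.mem_univ i, mul_pos hi (emp_pos _ _)⟩

theorem avgEmp_eq_zero {z : I → Fin n → A} {a : A} (h : ∀ i, P' i ≠ 0 → ∀ j, z i j ≠ a) :
    avgEmp P' z a = 0 := by
  refine Finset.sum_eq_zero fun i _ => ?_
  by_cases hi : P' i = 0
  · simp [hi]
  · rw [mul_eq_zero]
    right
    by_contra h0
    obtain ⟨j, hj⟩ := exists_apply_of_emp_ne_zero h0
    exact h i hi j hj

theorem avgEmp_const (h1 : ∑ i, P' i = 1) {z : I → Fin n → A} {q : A → ℝ}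
    (h : ∀ i, P' i ≠ 0 → emp (z i) = q) : avgEmp P' z = q := by
  ext a
  rw [avgEmp, ← one_mul (q a), ← h1, Finset.sum_mul]
  refine Finset.sum_congr rfl fun i _ => ?_
  by_cases hi : P' i = 0
  · simp [hi]
  · rw [h i hi]

end AvgEmp

/-! ### Permutation orbits of words -/

section Orbit

variable {n : ℕ}

/-- The number of permutations that fix a word. -/
noncomputable def stabCard (z : Fin n → A) : ℕ := ∏ a, (letterCount z a).factorial

theorem stabCard_pos (z : Fin n → A) : 0 < stabCard z :=
  Finset.prod_pos fun _ _ => Nat.factorial_pos _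

open Classical in
/-- The set of rearrangements of a word. -/
noncomputable def rearrangements (z : Fin n → A) : Finset (Fin n → A) :=
  Finset.univ.image fun σ : Equiv.Perm (Fin n) => z ∘ σ

theorem mem_rearrangements {z y : Fin n → A} :
    y ∈ rearrangements z ↔ ∃ σ : Equiv.Perm (Fin n), z ∘ σ = y := by
  simp [rearrangements]

open Classical in
theorem card_filter_comp_eq {z y : Fin n → A} (hy : y ∈ rearrangements z) :
    (Finset.univ.filter fun σ : Equiv.Perm (Fin n) => z ∘ σ = y).card = stabCard z := by
  obtain ⟨τ, rfl⟩ := mem_rearrangements.1 hy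
  have h := DomMulAct.stabilizer_card z
  rw [stabCard]
  have e : ∀ a, letterCount z a = Fintype.card {i // z i = a} := fun a => by
    rw [letterCount]
  simp only [e]
  convert h using 1
  rw [Fintype.card_subtype]
  -- The permutations that carry `z` to `z ∘ τ` form the coset of the stabilizer of `z` translated
  -- by `τ`.
  refine Finset.card_bij (fun σ _ => σ * τ⁻¹) ?_ ?_ ?_
  · intro σ hσ
    simp only [Finset.mem_filter, Finset.mem_univ, true_and] at hσ ⊢
    rw [Equiv.Perm.coe_mul, ← Function.comp_assoc, hσ, Function.comp_assoc, ← Equiv.Perm.coe_mul]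
    simp
  · intro σ _ σ' _ h
    exact mul_right_cancel h
  · intro ρ hρ
    simp only [Finset.mem_filter, Finset.mem_univ, true_and] at hρ
    refine ⟨ρ * τ, ?_, by simp⟩
    simp only [Finset.mem_filter, Finset.mem_univ, true_and]
    rw [Equiv.Perm.coe_mul, ← Function.comp_assoc, hρ]

/-- Orbit and stabilizer: every rearrangement is produced by the same number of permutations. -/
theorem sum_perm_eq (z : Fin n → A) (f : (Fin n → A) → ℝ) :
    ∑ σ : Equiv.Perm (Fin n), f (z ∘ σ) = stabCard z * ∑ y ∈ rearrangements z, f y := by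
  classical
  rw [Finset.mul_sum]
  have := Finset.sum_fiberwise_of_maps_to (s := (Finset.univ : Finset (Equiv.Perm (Fin n))))
    (t := rearrangements z) (g := fun σ => z ∘ σ)
    (fun σ _ => mem_rearrangements.2 ⟨σ, rfl⟩) (fun σ => f (z ∘ σ))
  rw [← this]
  refine Finset.sum_congr rfl fun y hy => ?_
  rw [← card_filter_comp_eq hy, ← nsmul_eq_mul]
  refine Finset.sum_eq_card_nsmul fun σ hσ => ?_
  rw [(Finset.mem_filter.1 hσ).2]

theorem factorial_eq_stabCard_mul_card (z : Fin n → A) :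
    (n.factorial : ℝ) = stabCard z * (rearrangements z).card := by
  have := sum_perm_eq z fun _ => 1
  simpa [Fintype.card_perm] using this

theorem emp_of_mem_rearrangements {z y : Fin n → A} (h : y ∈ rearrangements z) :
    emp y = emp z := by
  obtain ⟨σ, rfl⟩ := mem_rearrangements.1 h
  exact emp_comp_perm z σ

/-- The number of rearrangements is at most `exp (n H)`. -/
theorem factorial_div_stabCard_le (hn : 0 < n) (z : Fin n → A) :
    (n.factorial : ℝ) / stabCard z ≤ Real.exp (n * entropy (emp z)) := by
  have hs : (0 : ℝ) < stabCard z := by exact_mod_cast stabCard_pos z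
  -- All rearrangements are equally likely under the product of the type of `z`, so their number is
  -- at most the inverse of that probability.
  have h1 : ∑ y ∈ rearrangements z, ∏ i, emp z (y i) ≤ 1 := by
    calc _ ≤ ∑ y : Fin n → A, ∏ i, emp z (y i) :=
          Finset.sum_le_sum_of_subset_of_nonneg (Finset.subset_univ _) fun y _ _ =>
            Finset.prod_nonneg fun i _ => emp_nonneg _ _
      _ = 1 := by simp [sum_prod_apply fun _ : Fin n => emp z, sum_emp hn]
  have h2 : ∑ y ∈ rearrangements z, ∏ i, emp z (y i) =
      (rearrangements z).card * Real.exp (-(n * entropy (emp z))) := by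
    rw [← nsmul_eq_mul]
    refine Finset.sum_eq_card_nsmul fun y hy => ?_
    rw [← emp_of_mem_rearrangements hy, prod_emp_eq_exp]
  rw [h2, Real.exp_neg, ← div_eq_mul_inv, div_le_one (Real.exp_pos _)] at h1
  rwa [factorial_eq_stabCard_mul_card z, mul_div_cancel_left₀ _ hs.ne']

/-- A Stirling upper bound with logarithmic error. The error is increasing down to `k = 0`, so for
letter counts it can be replaced by the one with `n` in place of `k`. -/
theorem log_factorial_le (k : ℕ) :
    Real.log k.factorial ≤ k * Real.log k - k + (1 + Real.log (k + 1)) := by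
  rcases k.eq_zero_or_pos with rfl | hk
  · simp
  -- For positive integers the sharper error `1 + log k` is what the induction reproduces.
  have key : ∀ k : ℕ, Real.log (k + 1).factorial ≤
      (k + 1 : ℕ) * Real.log (k + 1 : ℕ) - (k + 1 : ℕ) + (1 + Real.log (k + 1 : ℕ)) := by
    intro k
    induction k with
    | zero => simp
    | succ k ih =>
      rw [Nat.factorial_succ, Nat.cast_mul, Real.log_mul (by positivity) (by positivity)]
      have h1 : Real.log ((k + 1 : ℕ) / (k + 1 + 1 : ℕ)) ≤ (k + 1 : ℕ) / (k + 1 + 1 : ℕ) - 1 :=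
        Real.log_le_sub_one_of_pos (by positivity)
      rw [Real.log_div (by positivity) (by positivity)] at h1
      have h2 : ((k + 1 : ℕ) : ℝ) / (k + 1 + 1 : ℕ) - 1 = -1 / (k + 2) := by
        push_cast
        field_simp
        ring
      rw [h2] at h1
      have h3 := mul_le_mul_of_nonneg_left h1 (by positivity : (0 : ℝ) ≤ k + 2)
      have h4 : ((k : ℝ) + 2) * (-1 / (k + 2)) = -1 := by field_simp
      rw [h4] at h3
      push_cast at *
      nlinarith
  obtain ⟨j, rfl⟩ : ∃ j, k = j + 1 := ⟨k - 1, by omega⟩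
  refine (key j).trans ?_
  have : Real.log (j + 1 : ℕ) ≤ Real.log ((j + 1 : ℕ) + 1) :=
    Real.log_le_log (by positivity) (by linarith)
  linarith

theorem le_log_factorial (n : ℕ) : n * Real.log n - n ≤ Real.log n.factorial := by
  rcases n.eq_zero_or_pos with rfl | hn
  · simp
  have h := Stirling.le_log_factorial_stirling hn.ne'
  have h1 : 0 ≤ Real.log n := Real.log_natCast_nonneg n
  have h2 : 0 ≤ Real.log (2 * Real.pi) := Real.log_nonneg (by linarith [Real.pi_gt_three])
  linarith

/-- The number of rearrangements is at least `exp (n H)` up to a polynomial factor. -/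
theorem stabCard_div_factorial_le (hn : 0 < n) (z : Fin n → A) :
    (stabCard z : ℝ) / n.factorial ≤
      Real.exp (-(n * entropy (emp z)) + Fintype.card A * (1 + Real.log (n + 1))) := by
  have hs : (0 : ℝ) < stabCard z := by exact_mod_cast stabCard_pos z
  have hf : (0 : ℝ) < n.factorial := by positivity
  have hn' : (0 : ℝ) < n := by exact_mod_cast hn
  rw [← Real.log_le_iff_le_exp (by positivity), Real.log_div hs.ne' hf.ne']
  have h1 : Real.log (stabCard z) ≤
      ∑ a, (letterCount z a * Real.log (letterCount z a) - letterCount z a +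
        (1 + Real.log (n + 1))) := by
    rw [stabCard, Nat.cast_prod, Real.log_prod (fun a _ => by positivity)]
    refine Finset.sum_le_sum fun a _ => (log_factorial_le _).trans ?_
    have : Real.log (letterCount z a + 1) ≤ Real.log (n + 1) :=
      Real.log_le_log (by positivity) (by gcongr; exact letterCount_le z a)
    linarith
  have h2 := le_log_factorial n
  have h3 : ∑ a, (letterCount z a : ℝ) = n := by exact_mod_cast sum_letterCount_eq z
  have h4 : ∑ a, (letterCount z a : ℝ) * Real.log (letterCount z a) =
      n * Real.log n - n * entropy (emp z) := by
    have e : n * Real.log n = ∑ a, (letterCount z a : ℝ) * Real.log n := by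
      rw [← Finset.sum_mul, h3]
    rw [entropy, mul_neg, sub_neg_eq_add, Finset.mul_sum, e, ← Finset.sum_add_distrib]
    refine Finset.sum_congr rfl fun a _ => ?_
    rw [← mul_assoc, natCast_mul_emp, emp]
    rcases (letterCount z a).eq_zero_or_pos with h | h
    · simp [h]
    · rw [Real.log_div (by positivity) hn'.ne']
      ring
  rw [Finset.sum_add_distrib, Finset.sum_sub_distrib, h3, h4] at h1
  simp only [Finset.sum_const, Finset.card_univ, nsmul_eq_mul] at h1
  linarith

/-- The sum of `exp (-n H)` over all words grows at most polynomially. -/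
theorem sum_exp_neg_entropy_le :
    ∑ y : Fin n → A, Real.exp (-(n * entropy (emp y))) ≤ (n + 1 : ℝ) ^ Fintype.card A := by
  classical
  simp only [← prod_emp_eq_exp]
  rcases n.eq_zero_or_pos with rfl | hn
  · simp
  -- Each summand is the probability of a word under its own type. Replacing it by the sum over all
  -- types makes every type contribute total mass one, so the bound is the number of types.
  let K : Finset (A → Fin (n + 1)) := Finset.univ.filter fun k => ∑ a, (k a : ℕ) = n
  have h1 : ∀ y : Fin n → A, ∏ i, emp y (y i) ≤ ∑ k ∈ K, ∏ i, ((k (y i) : ℕ) / n : ℝ) := by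
    intro y
    refine Finset.single_le_sum (f := fun k : A → Fin (n + 1) => ∏ i, ((k (y i) : ℕ) / n : ℝ))
      (fun k _ => Finset.prod_nonneg fun i _ => by positivity)
      (a := fun a => ⟨letterCount y a, Nat.lt_succ_of_le (letterCount_le y a)⟩) ?_
    simp [K, sum_letterCount_eq]
  calc _ ≤ ∑ y : Fin n → A, ∑ k ∈ K, ∏ i, ((k (y i) : ℕ) / n : ℝ) :=
        Finset.sum_le_sum fun y _ => h1 y
    _ = ∑ k ∈ K, (1 : ℝ) := by
        rw [Finset.sum_comm]
        refine Finset.sum_congr rfl fun k hk => ?_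
        rw [sum_prod_apply fun _ : Fin n => fun a => ((k a : ℕ) / n : ℝ)]
        have : ∑ a, ((k a : ℕ) / n : ℝ) = 1 := by
          rw [← Finset.sum_div, ← Nat.cast_sum, (Finset.mem_filter.1 hk).2,
            div_self (by positivity)]
        simp [this]
    _ ≤ (n + 1 : ℝ) ^ Fintype.card A := by
        rw [Finset.sum_const, nsmul_eq_mul, mul_one]
        have : K.card ≤ (n + 1) ^ Fintype.card A :=
          (Finset.card_filter_le _ _).trans_eq (by simp)
        exact_mod_cast this

end Orbit

end Empirical

/-! ### Joint distributions and single-letter divergences -/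

section Joint

variable {X Y : Type*} [Fintype X] [Fintype Y]

/-- The first marginal. -/
noncomputable def fstMarginal (p : X × Y → ℝ) (x : X) : ℝ := ∑ y, p (x, y)

/-- The second marginal. -/
noncomputable def sndMarginal (p : X × Y → ℝ) (y : Y) : ℝ := ∑ x, p (x, y)

/-- `D(b‖q)` as a function that is continuous in `b`. -/
noncomputable def klReal (q b : Y → ℝ) : ℝ := -entropy b - ∑ y, b y * Real.log (q y)

/-- `D(V‖w|a)` as a function that is continuous in the joint distribution `p = a V`. -/
noncomputable def condKL (w : X → Y → ℝ) (p : X × Y → ℝ) : ℝ :=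
  -entropy p + entropy (fstMarginal p) - ∑ z, p z * Real.log (w z.1 z.2)

theorem continuous_fstMarginal : Continuous (fstMarginal : (X × Y → ℝ) → X → ℝ) :=
  continuous_pi fun _ => continuous_finsetSum _ fun _ _ => continuous_apply _

theorem continuous_sndMarginal : Continuous (sndMarginal : (X × Y → ℝ) → Y → ℝ) :=
  continuous_pi fun _ => continuous_finsetSum _ fun _ _ => continuous_apply _

theorem continuous_klReal (q : Y → ℝ) : Continuous (klReal q) :=
  continuous_entropy.neg.sub
    (continuous_finsetSum _ fun _ _ => (continuous_apply _).mul continuous_const)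

theorem continuous_condKL (w : X → Y → ℝ) : Continuous (condKL w) :=
  (continuous_entropy.neg.add (continuous_entropy.comp continuous_fstMarginal)).sub
    (continuous_finsetSum _ fun _ _ => (continuous_apply _).mul continuous_const)

theorem sum_fstMarginal_mul (p : X × Y → ℝ) (φ : X → ℝ) :
    ∑ x, fstMarginal p x * φ x = ∑ z, p z * φ z.1 := by
  simp only [fstMarginal, Finset.sum_mul, Fintype.sum_prod_type]

theorem sum_sndMarginal_mul (p : X × Y → ℝ) (φ : Y → ℝ) :
    ∑ y, sndMarginal p y * φ y = ∑ z, p z * φ z.2 := by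
  simp only [sndMarginal, Finset.sum_mul, Fintype.sum_prod_type]
  rw [Finset.sum_comm]

open Classical in
theorem fstMarginal_eq_sum_ite (p : X × Y → ℝ) (x : X) :
    fstMarginal p x = ∑ z, if z.1 = x then p z else 0 := by
  have := sum_fstMarginal_mul p fun x' => if x' = x then 1 else 0
  simpa using this

open Classical in
theorem sndMarginal_eq_sum_ite (p : X × Y → ℝ) (y : Y) :
    sndMarginal p y = ∑ z, if z.2 = y then p z else 0 := by
  have := sum_sndMarginal_mul p fun y' => if y' = y then 1 else 0
  simpa using this

theorem le_fstMarginal {p : X × Y → ℝ} (hp : ∀ z, 0 ≤ p z) (z : X × Y) : p z ≤ fstMarginal p z.1 :=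
  Finset.single_le_sum (f := fun y => p (z.1, y)) (fun _ _ => hp _) (Finset.mem_univ z.2)

theorem fstMarginal_nonneg {p : X × Y → ℝ} (hp : ∀ z, 0 ≤ p z) (x : X) : 0 ≤ fstMarginal p x :=
  Finset.sum_nonneg fun _ _ => hp _

theorem condKL_eq_sum {w : X → Y → ℝ} {p : X × Y → ℝ} :
    condKL w p =
      ∑ z, p z * (Real.log (p z) - Real.log (fstMarginal p z.1) - Real.log (w z.1 z.2)) := by
  simp only [condKL, entropy, mul_sub, Finset.sum_sub_distrib, sum_fstMarginal_mul]
  ring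

theorem klReal_eq_sum {q b : Y → ℝ} :
    klReal q b = ∑ y, b y * (Real.log (b y) - Real.log (q y)) := by
  simp only [klReal, entropy, mul_sub, Finset.sum_sub_distrib]
  ring

/-- The joint distribution `a(x) V(y|x)`. -/
noncomputable def jointDist (a : ProbDist X) (V : X → ProbDist Y) (z : X × Y) : ℝ := a z.1 * V z.1 z.2

theorem continuous_jointDist :
    Continuous fun aV : ProbDist X × (X → ProbDist Y) => jointDist aV.1 aV.2 := by
  refine continuous_pi fun z => Continuous.mul ?_ ?_
  · exact (continuous_apply z.1).comp (continuous_subtype_val.comp continuous_fst)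
  · exact (continuous_apply z.2).comp (continuous_subtype_val.comp
      ((continuous_apply z.1).comp continuous_snd))

theorem fstMarginal_jointDist (a : ProbDist X) (V : X → ProbDist Y) :
    fstMarginal (jointDist a V) = a := by
  ext x
  simp [fstMarginal, jointDist, ← Finset.mul_sum]

theorem sndMarginal_jointDist (a : ProbDist X) (V : X → ProbDist Y) :
    sndMarginal (jointDist a V) = outMarginal V a := by
  ext y
  simp [sndMarginal, jointDist, outMarginal, mul_comm]

theorem jointDist_mem (a : ProbDist X) (V : X → ProbDist Y) :
    jointDist a V ∈ stdSimplex ℝ (X × Y) := by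
  refine ⟨fun z => mul_nonneg (a.nonneg _) ((V _).nonneg _), ?_⟩
  rw [Fintype.sum_prod_type]
  simp [jointDist, ← Finset.mul_sum]

/-- The joint distributions supported where the channel `w` is positive. -/
def jointSet (w : X → Y → ℝ) : Set (X × Y → ℝ) :=
  {p | p ∈ stdSimplex ℝ (X × Y) ∧ ∀ x y, w x y = 0 → p (x, y) = 0}

theorem isCompact_jointSet (w : X → Y → ℝ) : IsCompact (jointSet w) := by
  refine (isCompact_stdSimplex ℝ (X × Y)).inter_right
    (t := {p : X × Y → ℝ | ∀ x y, w x y = 0 → p (x, y) = 0}) ?_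
  simp only [Set.ofPred_forall]
  exact isClosed_iInter fun x => isClosed_iInter fun y => isClosed_iInter fun _ =>
    isClosed_eq (continuous_apply _) continuous_const

/-- Disintegration. At inputs of mass zero the channel is arbitrary; choosing `W` there makes
absolute continuity hold at every input and not only on the support of `a`. -/
theorem exists_jointDist_eq (W : X → ProbDist Y) {p : X × Y → ℝ} (hp : p ∈ stdSimplex ℝ (X × Y)) :
    ∃ (a : ProbDist X) (V : X → ProbDist Y), jointDist a V = p ∧ ∀ x, a x = 0 → V x = W x := by
  classical
  have h0 := fstMarginal_nonneg hp.1
  have h1 : ∑ x, fstMarginal p x = 1 := by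
    have := sum_fstMarginal_mul p fun _ => 1
    simp only [mul_one] at this
    rw [this, hp.2]
  refine ⟨⟨fstMarginal p, h0, h1⟩, fun x => if h : fstMarginal p x = 0 then W x else
    ⟨fun y => p (x, y) / fstMarginal p x, fun y => div_nonneg (hp.1 _) (h0 x), ?_⟩, ?_, ?_⟩
  · rw [← Finset.sum_div]
    exact div_self h
  · ext ⟨x, y⟩
    change fstMarginal p x * _ = _
    dsimp only
    split_ifs with h
    · rw [h, zero_mul]
      have := le_fstMarginal hp.1 (x, y)
      exact le_antisymm (hp.1 _) (this.trans_eq h)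
    · exact mul_div_cancel₀ _ h
  · intro x hx
    exact dif_pos hx

theorem absCont_of_jointDist_mem {W V : X → ProbDist Y} {a : ProbDist X}
    (h : jointDist a V ∈ jointSet fun x => W x) (h' : ∀ x, a x = 0 → V x = W x) (x : X) :
    AbsCont (V x) (W x) := by
  intro y hy
  by_cases hx : a x = 0
  · rw [h' x hx, hy]
  · exact (mul_eq_zero.1 (h.2 x y hy)).resolve_left hx

theorem jointDist_mem_of_absCont {W V : X → ProbDist Y} (a : ProbDist X)
    (h : ∀ x, AbsCont (V x) (W x)) : jointDist a V ∈ jointSet fun x => W x :=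
  ⟨jointDist_mem a V, fun x y hy => by simp [jointDist, h x y hy]⟩

/-- `klReal` is finite everywhere because `log 0 = 0`; it is the divergence only under absolute
continuity. -/
theorem relEntropy_eq_coe {b q : Y → ℝ} (h : AbsCont b q) :
    relEntropy b q = (klReal q b : EReal) := by
  rw [relEntropy, if_pos h, klReal_eq_sum]
  congr 1
  refine Finset.sum_congr rfl fun y _ => ?_
  by_cases hb : b y = 0
  · simp [hb]
  · rw [Real.log_div hb (mt (h y) hb)]

theorem EReal.coe_sum' {ι : Type*} (s : Finset ι) (f : ι → ℝ) :
    ((∑ i ∈ s, f i : ℝ) : EReal) = ∑ i ∈ s, (f i : EReal) :=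
  map_sum (⟨⟨Real.toEReal, rfl⟩, fun x y => EReal.coe_add x y⟩ : ℝ →+ EReal) f s

/-- The support condition is placed on the joint distribution since inputs of mass zero contribute
`0 * ⊤ = 0`. -/
theorem condRelEntropy_eq_coe {V W : X → ProbDist Y} {a : ProbDist X}
    (h : jointDist a V ∈ jointSet fun x => W x) :
    condRelEntropy V W a = (condKL (fun x => W x) (jointDist a V) : EReal) := by
  have : ∀ x, ((a x : ℝ) : EReal) * relEntropy (V x) (W x) =
      ((∑ y, jointDist a V (x, y) * (Real.log (jointDist a V (x, y)) - Real.log (a x) -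
        Real.log (W x y)) : ℝ) : EReal) := by
    intro x
    by_cases hx : a x = 0
    · simp [jointDist, hx]
    · have hc : AbsCont (V x) (W x) := fun y hy => (mul_eq_zero.1 (h.2 x y hy)).resolve_left hx
      rw [relEntropy_eq_coe hc, ← EReal.coe_mul, klReal_eq_sum, Finset.mul_sum]
      congr 1
      refine Finset.sum_congr rfl fun y _ => ?_
      by_cases hy : V x y = 0
      · simp [jointDist, hy]
      · simp only [jointDist]
        rw [Real.log_mul hx hy]
        ring
  rw [condRelEntropy, Finset.sum_congr rfl fun x _ => this x, ← EReal.coe_sum', condKL_eq_sum,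
    fstMarginal_jointDist, Fintype.sum_prod_type]

theorem condRelEntropy_eq_top {V W : X → ProbDist Y} {a : ProbDist X}
    (h : jointDist a V ∉ jointSet fun x => W x) : condRelEntropy V W a = ⊤ := by
  classical
  obtain ⟨x, y, hy, hp⟩ : ∃ x y, W x y = 0 ∧ jointDist a V (x, y) ≠ 0 := by
    by_contra! h'
    exact h ⟨jointDist_mem a V, h'⟩
  have ha : a x ≠ 0 := left_ne_zero_of_mul hp
  have hV : V x y ≠ 0 := right_ne_zero_of_mul hp
  -- No term may be `⊥`, since in `EReal` a single `⊥` would absorb the infinite term found below.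
  have hnb : ∀ x, ((a x : ℝ) : EReal) * relEntropy (V x) (W x) ≠ ⊥ := by
    intro x
    unfold relEntropy
    split_ifs
    · rw [← EReal.coe_mul]
      exact EReal.coe_ne_bot _
    · rcases (a.nonneg x).eq_or_lt with h0 | h0
      · simp [← h0]
      · rw [EReal.coe_mul_top_of_pos h0]
        simp
  have htop : ((a x : ℝ) : EReal) * relEntropy (V x) (W x) = ⊤ := by
    rw [relEntropy, if_neg fun hc => hV (hc y hy)]
    exact EReal.coe_mul_top_of_pos ((a.nonneg x).lt_of_ne' ha)
  have hsum : ∀ s : Finset X, ∑ x ∈ s, ((a x : ℝ) : EReal) * relEntropy (V x) (W x) ≠ ⊥ := by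
    intro s
    induction s using Finset.induction_on with
    | empty => simp
    | insert x s hx ih =>
      rw [Finset.sum_insert hx]
      exact EReal.add_ne_bot_iff.2 ⟨hnb x, ih⟩
  rw [condRelEntropy, ← Finset.add_sum_erase _ _ (Finset.mem_univ x), htop]
  exact EReal.top_add_of_ne_bot (hsum _)

theorem absCont_outMarginal {V : X → ProbDist Y} {a : ProbDist X} {Q : ProbDist Y}
    (h : jointDist a V ∈ jointSet fun _ => Q) : AbsCont (outMarginal V a) Q := by
  intro y hy
  rw [← sndMarginal_jointDist]
  exact Finset.sum_eq_zero fun x _ => h.2 x y hy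

theorem relEntropy_outMarginal_eq_coe {V : X → ProbDist Y} {a : ProbDist X} {Q : ProbDist Y}
    (h : jointDist a V ∈ jointSet fun _ => Q) :
    relEntropy (outMarginal V a) Q = (klReal Q (sndMarginal (jointDist a V)) : EReal) := by
  rw [sndMarginal_jointDist, relEntropy_eq_coe (absCont_outMarginal h)]

/-! ### Single-letterization -/

/-- The conditional distribution of a joint distribution (zero where it is undefined). -/
noncomputable def condProb (p : X × Y → ℝ) (x : X) (y : Y) : ℝ := p (x, y) / fstMarginal p x

theorem condProb_nonneg {p : X × Y → ℝ} (hp : ∀ z, 0 ≤ p z) (x : X) (y : Y) : 0 ≤ condProb p x y :=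
  div_nonneg (hp _) (fstMarginal_nonneg hp _)

/-- The sum is zero, not one, at inputs of mass zero. A subprobability is enough for Gibbs'
inequality. -/
theorem sum_condProb_le (p : X × Y → ℝ) (x : X) : ∑ y, condProb p x y ≤ 1 := by
  simp only [condProb]
  rw [← Finset.sum_div]
  exact div_self_le_one _

theorem sum_prod_condProb_le {p : X × Y → ℝ} (hp : ∀ z, 0 ≤ p z) {n : ℕ} (x : Fin n → X) :
    ∑ y : Fin n → Y, ∏ i, condProb p (x i) (y i) ≤ 1 := by
  rw [sum_prod_apply fun i => condProb p (x i)]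
  exact Finset.prod_le_one (fun i _ => Finset.sum_nonneg fun y _ => condProb_nonneg hp _ _)
    fun i _ => sum_condProb_le p _

/-- The average joint empirical distribution of `M` input words and an output word. -/
noncomputable def jointEmp {M n : ℕ} (P' : Fin M × (Fin n → Y) → ℝ) (c : Fin M → Fin n → X) :
    X × Y → ℝ :=
  avgEmp P' fun u i => (c u.1 i, u.2 i)

variable {M n : ℕ} {P' : Fin M × (Fin n → Y) → ℝ} {c : Fin M → Fin n → X}

theorem jointEmp_mem (hn : 0 < n) (hP : ∀ u, 0 ≤ P' u) (hP1 : ∑ u, P' u = 1) :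
    jointEmp P' c ∈ stdSimplex ℝ (X × Y) :=
  ⟨avgEmp_nonneg hP _, sum_avgEmp hn hP1 _⟩

theorem fstMarginal_jointEmp : fstMarginal (jointEmp P' c) = avgEmp P' fun u => c u.1 := by
  classical
  ext x
  rw [fstMarginal_eq_sum_ite]
  exact (avgEmp_comp P' Prod.fst (fun u i => (c u.1 i, u.2 i)) x).symm

theorem sndMarginal_jointEmp : sndMarginal (jointEmp P' c) = avgEmp P' fun u => u.2 := by
  classical
  ext x
  rw [sndMarginal_eq_sum_ite]
  exact (avgEmp_comp P' Prod.snd (fun u i => (c u.1 i, u.2 i)) x).symm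

theorem jointEmp_mem_jointSet (hn : 0 < n) (hP : ∀ u, 0 ≤ P' u) (hP1 : ∑ u, P' u = 1)
    {w : X → Y → ℝ} (hw : ∀ u, P' u ≠ 0 → ∀ i, w (c u.1 i) (u.2 i) ≠ 0) :
    jointEmp P' c ∈ jointSet w := by
  refine ⟨jointEmp_mem hn hP hP1, fun x y hxy => avgEmp_eq_zero fun u hu i h => hw u hu i ?_⟩
  rw [Prod.mk.injEq] at h
  rw [h.1, h.2, hxy]

/-- Relative entropies of words dominate `n` times the single-letter conditional divergence. -/
theorem natCast_mul_condKL_le (hP : ∀ u, 0 ≤ P' u) (hP1 : ∑ u, P' u = 1)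
    {w : X → Y → ℝ} (hw : ∀ u, P' u ≠ 0 → ∀ i, w (c u.1 i) (u.2 i) ≠ 0)
    {ρ : Fin M × (Fin n → Y) → ℝ} (hρ : ∀ u, 0 ≤ ρ u) (hρP : ∀ u, 0 < P' u → 0 < ρ u)
    (hsum : ∑ u, ρ u * ∏ i, condProb (jointEmp P' c) (c u.1 i) (u.2 i) ≤ 1) :
    n * condKL w (jointEmp P' c) ≤
      ∑ u, P' u * (Real.log (P' u) - Real.log (ρ u) - Real.log (∏ i, w (c u.1 i) (u.2 i))) := by
  set p := jointEmp P' c with hp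
  have hp0 : ∀ z, 0 ≤ p z := avgEmp_nonneg hP _
  have hpos : ∀ u, 0 < P' u → ∀ i, 0 < p (c u.1 i, u.2 i) := fun u hu i =>
    avgEmp_pos hP (fun u i => (c u.1 i, u.2 i)) hu i
  have hfst : ∀ u, 0 < P' u → ∀ i, 0 < fstMarginal p (c u.1 i) := fun u hu i =>
    (hpos u hu i).trans_le (le_fstMarginal hp0 (c u.1 i, u.2 i))
  have hc : ∀ u, 0 < P' u → ∀ i, 0 < condProb p (c u.1 i) (u.2 i) := fun u hu i =>
    div_pos (hpos u hu i) (hfst u hu i)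
  -- Gibbs' inequality against `ρ` times the memoryless extension of the conditional law of `p`
  -- itself. The logarithm of this extension is a sum over positions, and `p` is the averaged letter
  -- distribution, so the expectation is `n` times a single-letter quantity.
  have hG := sum_mul_log_le_sum_mul_log_self hP
    (r := fun u => ρ u * ∏ i, condProb p (c u.1 i) (u.2 i))
    (fun u => mul_nonneg (hρ u) (Finset.prod_nonneg fun i _ => condProb_nonneg hp0 _ _))
    (fun u hu => mul_pos (hρP u hu) (Finset.prod_pos fun i _ => hc u hu i)) (by rwa [hP1])
  have h1 := sum_avgEmp_mul P' (fun u i => (c u.1 i, u.2 i)) fun z : X × Y =>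
    Real.log (p z) - Real.log (fstMarginal p z.1) - Real.log (w z.1 z.2)
  change _ = n * ∑ z, p z * _ at h1
  rw [← condKL_eq_sum] at h1
  rw [← h1]
  have h2 : ∀ u, P' u * ∑ j, (Real.log (p (c u.1 j, u.2 j)) - Real.log (fstMarginal p (c u.1 j)) -
        Real.log (w (c u.1 j) (u.2 j))) =
      P' u * Real.log (ρ u * ∏ i, condProb p (c u.1 i) (u.2 i)) - P' u * Real.log (ρ u) -
        P' u * Real.log (∏ i, w (c u.1 i) (u.2 i)) := by
    intro u
    rcases (hP u).eq_or_lt with h | h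
    · simp [← h]
    · rw [Real.log_mul (hρP u h).ne' (Finset.prod_pos fun i _ => hc u h i).ne',
        Real.log_prod (fun i _ => (hc u h i).ne'), Real.log_prod (fun i _ => hw u h.ne' i),
        Finset.sum_sub_distrib]
      have : ∀ i, Real.log (condProb p (c u.1 i) (u.2 i)) =
          Real.log (p (c u.1 i, u.2 i)) - Real.log (fstMarginal p (c u.1 i)) := fun i =>
        Real.log_div (hpos u h i).ne' (hfst u h i).ne'
      simp only [this]
      ring
  rw [Finset.sum_congr rfl fun u _ => h2 u]
  simp only [mul_sub, Finset.sum_sub_distrib]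
  linarith

/-- A relative entropy with respect to a product distribution dominates the divergence of the average
marginal. -/
theorem natCast_mul_klReal_le {P : (Fin n → Y) → ℝ} (hn : 0 < n) (hP : ∀ y, 0 ≤ P y)
    (hP1 : ∑ y, P y = 1) {q : Y → ℝ} (hq : ∀ y, P y ≠ 0 → ∀ i, q (y i) ≠ 0) :
    n * klReal q (avgEmp P fun y : Fin n → Y => y) ≤ ∑ y, P y * (Real.log (P y) - Real.log (prodDist q n y)) := by
  obtain ⟨b, hb⟩ : ∃ b, b = avgEmp P fun y : Fin n → Y => y := ⟨_, rfl⟩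
  have hb0 : ∀ a, 0 ≤ b a := fun a => hb ▸ avgEmp_nonneg hP _ a
  have hb1 : ∑ a, b a = 1 := hb ▸ sum_avgEmp hn hP1 _
  have hpos : ∀ y, 0 < P y → ∀ i, 0 < b (y i) := fun y hy i => by
    rw [hb]
    exact avgEmp_pos hP (fun y : Fin n → Y => y) hy i
  have hsum : ∑ y : Fin n → Y, ∏ i, b (y i) = ∑ y, P y := by
    rw [sum_prod_apply fun _ : Fin n => b, hP1]
    simp only [hb1, Finset.prod_const_one]
  -- The comparison law is the product of the averaged marginal `b`.
  have hG := sum_mul_log_le_sum_mul_log_self hP (r := fun y => ∏ i, b (y i))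
    (fun y => Finset.prod_nonneg fun i _ => hb0 _)
    (fun y hy => Finset.prod_pos fun i _ => hpos y hy i)
    hsum.le
  have h1 := sum_avgEmp_mul P (fun y : Fin n → Y => y) fun y => Real.log (b y) - Real.log (q y)
  rw [← hb, ← klReal_eq_sum] at h1
  rw [← hb, ← h1]
  have h2 : ∀ y : Fin n → Y, P y * ∑ j, (Real.log (b (y j)) - Real.log (q (y j))) =
      P y * Real.log (∏ i, b (y i)) - P y * Real.log (prodDist q n y) := by
    intro y
    rcases (hP y).eq_or_lt with h | h
    · simp [← h]
    · rw [prodDist, Real.log_prod (fun i _ => (hpos y h i).ne'),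
        Real.log_prod (fun i _ => hq y h.ne' i), Finset.sum_sub_distrib]
      ring
  rw [Finset.sum_congr rfl fun y _ => h2 y]
  simp only [mul_sub, Finset.sum_sub_distrib]
  linarith

end Joint

/-! ### Lower bounds for every codebook -/

section Product

variable {Y : Type*} [Fintype Y] {n : ℕ}

theorem powSum_prod (α : ℝ) {w : Fin n → Y → ℝ} (hw : ∀ i y, 0 ≤ w i y) {q : Y → ℝ}
    (hq : ∀ y, 0 ≤ q y) :
    powSum α (fun y : Fin n → Y => ∏ i, w i (y i)) (prodDist q n) = ∏ i, powSum α (w i) q := by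
  simp only [powSum]
  rw [← sum_prod_apply fun i y => w i y ^ α * q y ^ (1 - α)]
  refine Finset.sum_congr rfl fun y _ => ?_
  rw [Finset.prod_mul_distrib, prodDist, Real.finsetProd_rpow _ _ fun i _ => hw i _,
    Real.finsetProd_rpow _ _ fun i _ => hq _]

theorem sum_prod_mul_apply {V : Fin n → Y → ℝ} (hV : ∀ i, ∑ y, V i y = 1) (i : Fin n)
    (φ : Y → ℝ) : ∑ y : Fin n → Y, (∏ j, V j (y j)) * φ (y i) = ∑ b, V i b * φ b := by
  classical
  have h : ∀ y : Fin n → Y, (∏ j, V j (y j)) * φ (y i) =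
      ∏ j, (V j (y j) * if j = i then φ (y j) else 1) := by
    intro y
    rw [Finset.prod_mul_distrib, Finset.prod_ite_eq' Finset.univ i, if_pos (Finset.mem_univ i)]
  rw [Finset.sum_congr rfl fun y _ => h y,
    sum_prod_apply fun j b => V j b * if j = i then φ b else 1, ← Finset.prod_erase_mul _ _ (Finset.mem_univ i)]
  rw [Finset.prod_eq_one, one_mul]
  · simp
  · intro j hj
    simp [Finset.ne_of_mem_erase hj, hV]

end Product

/-! ### Variational bounds for the power sum. -/

section Variational

variable {A : Type*} [Fintype A] {P' P Q : A → ℝ} {s : ℝ}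

/-- The variational lower bound for Rényi divergences of order `1 + s`. -/
theorem variational_le_log_powSum (h' : ∀ y, 0 ≤ P' y) (h1 : ∑ y, P' y = 1) (hP : ∀ y, 0 ≤ P y)
    (hQ : ∀ y, 0 ≤ Q y) (hPP : ∀ y, 0 < P' y → 0 < P y) (hPQ : ∀ y, 0 < P' y → 0 < Q y) :
    s * ∑ y, P' y * (Real.log (P' y) - Real.log (Q y)) -
      (1 + s) * ∑ y, P' y * (Real.log (P' y) - Real.log (P y)) ≤
      Real.log (powSum (1 + s) P Q) := by
  -- Jensen's inequality under `P'`; restricting the power sum to the support of `P'` only decreases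
  -- it.
  have hJ := sum_mul_log_le_log_sum h' h1 (t := fun y => P y ^ (1 + s) * Q y ^ (1 - (1 + s)) / P' y)
    fun y hy => div_pos (mul_pos (Real.rpow_pos_of_pos (hPP y hy) _)
      (Real.rpow_pos_of_pos (hPQ y hy) _)) hy
  have hle : ∑ y, P' y * (P y ^ (1 + s) * Q y ^ (1 - (1 + s)) / P' y) ≤ powSum (1 + s) P Q := by
    refine Finset.sum_le_sum fun y _ => ?_
    rcases (h' y).eq_or_lt with h | h
    · rw [← h, zero_mul]
      exact mul_nonneg (Real.rpow_nonneg (hP y) _) (Real.rpow_nonneg (hQ y) _)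
    · rw [mul_div_cancel₀ _ h.ne']
  obtain ⟨j, hj⟩ : ∃ j, 0 < P' j := by
    by_contra! h
    have : ∑ i, P' i = 0 := Finset.sum_eq_zero fun i _ => le_antisymm (h i) (h' i)
    linarith
  have hpos : 0 < ∑ y, P' y * (P y ^ (1 + s) * Q y ^ (1 - (1 + s)) / P' y) := by
    refine Finset.sum_pos' (fun y _ => ?_) ⟨j, Finset.mem_univ j, ?_⟩
    · exact mul_nonneg (h' y) (div_nonneg (mul_nonneg (Real.rpow_nonneg (hP y) _)
        (Real.rpow_nonneg (hQ y) _)) (h' y))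
    · exact mul_pos hj (div_pos (mul_pos (Real.rpow_pos_of_pos (hPP j hj) _)
        (Real.rpow_pos_of_pos (hPQ j hj) _)) hj)
  refine le_trans (le_of_eq ?_) (hJ.trans (Real.log_le_log hpos hle))
  rw [Finset.mul_sum, Finset.mul_sum, ← Finset.sum_sub_distrib]
  refine Finset.sum_congr rfl fun y _ => ?_
  rcases (h' y).eq_or_lt with h | h
  · simp [← h]
  · rw [Real.log_div (mul_pos (Real.rpow_pos_of_pos (hPP y h) _)
      (Real.rpow_pos_of_pos (hPQ y h) _)).ne' h.ne', Real.log_mul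
      (Real.rpow_pos_of_pos (hPP y h) _).ne' (Real.rpow_pos_of_pos (hPQ y h) _).ne',
      Real.log_rpow (hPP y h), Real.log_rpow (hPQ y h)]
    ring

/-- The variational bound at `P' = P`, where the second divergence vanishes. For `s > 0` it compares
order `1` with order `1 + s`. -/
theorem mul_relEntropy_le_log_powSum (hP : ∀ y, 0 ≤ P y) (h1 : ∑ y, P y = 1)
    (hQ : ∀ y, 0 ≤ Q y) (hPQ : AbsCont P Q) :
    s * ∑ y, P y * (Real.log (P y) - Real.log (Q y)) ≤ Real.log (powSum (1 + s) P Q) := by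
  have := variational_le_log_powSum (s := s) hP h1 hP hQ (fun _ h => h)
    fun y hy => (hQ y).lt_of_ne fun h => hy.ne' (hPQ y h.symm)
  simpa using this

theorem powSum_pos (hP : ∀ y, 0 ≤ P y) (h1 : ∑ y, P y = 1)
    (hQ : ∀ y, 0 ≤ Q y) (hPQ : AbsCont P Q) (α : ℝ) : 0 < powSum α P Q := by
  obtain ⟨j, hj⟩ : ∃ j, 0 < P j := by
    by_contra! h
    have : ∑ i, P i = 0 := Finset.sum_eq_zero fun i _ => le_antisymm (h i) (hP i)
    linarith
  refine Finset.sum_pos' (fun y _ => mul_nonneg (Real.rpow_nonneg (hP y) _)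
    (Real.rpow_nonneg (hQ y) _)) ⟨j, Finset.mem_univ j, mul_pos (Real.rpow_pos_of_pos hj _)
      (Real.rpow_pos_of_pos ?_ _)⟩
  exact (hQ j).lt_of_ne fun h => hj.ne' (hPQ j h.symm)

end Variational

/-! ### Converse inequalities for a fixed codebook. -/

section Converse

variable {X Y : Type*} [Fintype X] [Fintype Y] {M n : ℕ}

theorem sum_const_inv (hM : 0 < M) : ∑ _m : Fin M, (M : ℝ)⁻¹ = 1 := by
  simp [hM.ne']

/-- The average letter distribution of a codebook. -/
noncomputable def codeType (hM : 0 < M) (hn : 0 < n) (c : Fin M → Fin n → X) : ProbDist X :=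
  ⟨avgEmp (fun _ => (M : ℝ)⁻¹) c, avgEmp_nonneg (fun _ => by positivity) c,
    sum_avgEmp hn (sum_const_inv hM) c⟩

theorem sum_codeType_mul (hM : 0 < M) (hn : 0 < n) (c : Fin M → Fin n → X) (φ : X → ℝ) :
    ∑ m, (M : ℝ)⁻¹ * ∑ i, φ (c m i) = n * ∑ x, codeType hM hn c x * φ x :=
  sum_avgEmp_mul (fun _ => (M : ℝ)⁻¹) c φ

theorem sum_outputDist_mul (hM : 0 < M) (hn : 0 < n) (c : Fin M → Fin n → X) (V : X → ProbDist Y)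
    (φ : X → Y → ℝ) :
    ∑ m, ∑ y : Fin n → Y, (M : ℝ)⁻¹ * (∏ i, V (c m i) (y i)) * ∑ i, φ (c m i) (y i) =
      n * ∑ z, jointDist (codeType hM hn c) V z * φ z.1 z.2 := by
  have h : ∀ m, ∑ y : Fin n → Y, (M : ℝ)⁻¹ * (∏ i, V (c m i) (y i)) * ∑ i, φ (c m i) (y i) =
      (M : ℝ)⁻¹ * ∑ i, ∑ b, V (c m i) b * φ (c m i) b := by
    intro m
    simp only [mul_assoc]
    rw [← Finset.mul_sum]
    congr 1
    simp only [Finset.mul_sum]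
    rw [Finset.sum_comm]
    exact Finset.sum_congr rfl fun i _ => sum_prod_mul_apply
      (V := fun i => V (c m i)) (fun i => (V _).sum_eq_one) i (φ (c m i))
  rw [Finset.sum_congr rfl fun m _ => h m,
    sum_codeType_mul hM hn c fun x => ∑ b, V x b * φ x b, Fintype.sum_prod_type]
  simp only [Finset.mul_sum, jointDist, mul_assoc]

/-- The averaged output letter depends on the codebook only through its letter distribution, as
testing with indicators of letters shows. Hence one `a` serves both converse bounds. -/
theorem avgEmp_outputDist (hM : 0 < M) (hn : 0 < n) (c : Fin M → Fin n → X) (V : X → ProbDist Y) :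
    avgEmp (outputDist V c) (fun y => y) = sndMarginal (jointDist (codeType hM hn c) V) := by
  classical
  ext b
  have h1 := sum_avgEmp_mul (outputDist V c) (fun y => y) fun b' => if b' = b then (1 : ℝ) else 0
  have h2 := sum_outputDist_mul hM hn c V fun _ b' => if b' = b then (1 : ℝ) else 0
  rw [Finset.sum_comm] at h2
  simp only [← Finset.sum_mul, ← Finset.mul_sum] at h2
  simp only [outputDist] at h1
  rw [h2, ← sum_sndMarginal_mul _ fun b' => if b' = b then (1 : ℝ) else 0] at h1
  have hn' : (n : ℝ) ≠ 0 := by positivity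
  have h3 := mul_left_cancel₀ hn' h1
  simp only [mul_ite, mul_one, mul_zero, Finset.sum_ite_eq', Finset.mem_univ, if_true] at h3
  exact h3.symm

theorem le_outputDist (W : X → ProbDist Y) (c : Fin M → Fin n → X) (m : Fin M) (y : Fin n → Y) :
    (M : ℝ)⁻¹ * ∏ i, W (c m i) (y i) ≤ outputDist W c y :=
  mul_le_mul_of_nonneg_left (Finset.single_le_sum (f := fun m => ∏ i, W (c m i) (y i))
    (fun m _ => Finset.prod_nonneg fun i _ => (W _).nonneg _) (Finset.mem_univ m)) (by positivity)

variable {W : X → ProbDist Y} {Q : ProbDist Y}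

theorem prodDist_pos_of_prod_pos (hWQ : ∀ x, AbsCont (W x) Q) {x : Fin n → X} {y : Fin n → Y}
    (h : 0 < ∏ i, W (x i) (y i)) : 0 < prodDist Q n y := by
  refine Finset.prod_pos fun i _ => (Q.nonneg _).lt_of_ne fun h0 => h.ne' ?_
  exact Finset.prod_eq_zero (Finset.mem_univ i) (hWQ _ _ h0.symm)

/-- In `P^(1+s)` one factor `P` is expanded over the codewords and, in the term of codeword `m`, the
factor `P^s` is bounded below by `(M⁻¹ w_m)^s`. What remains is an average of products over
positions, and Jensen's inequality brings it to the letter distribution of the codebook. -/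
theorem rate_le_log_powSum (hM : 0 < M) (hn : 0 < n) (hWQ : ∀ x, AbsCont (W x) Q)
    (c : Fin M → Fin n → X) {s : ℝ} (hs : 0 < s) :
    n * ∑ x, codeType hM hn c x * Real.log (powSum (1 + s) (W x) Q) - s * Real.log M ≤
      Real.log (powSum (1 + s) (outputDist W c) (prodDist Q n)) := by
  have hM' : (0 : ℝ) < M := by exact_mod_cast hM
  have hZ : ∀ x, 0 < powSum (1 + s) (W x) Q := fun x =>
    powSum_pos (W x).nonneg (W x).sum_eq_one Q.nonneg (hWQ x) _
  have h1 : (M : ℝ) ^ (-s) * ∑ m, (M : ℝ)⁻¹ * ∏ i, powSum (1 + s) (W (c m i)) Q ≤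
      powSum (1 + s) (outputDist W c) (prodDist Q n) := by
    have e : ∀ m, ∏ i, powSum (1 + s) (W (c m i)) Q = ∑ y : Fin n → Y,
        (∏ i, W (c m i) (y i)) ^ (1 + s) * prodDist Q n y ^ (1 - (1 + s)) := fun m =>
      (powSum_prod (1 + s) (fun i y => (W (c m i)).nonneg y) Q.nonneg).symm
    simp only [e, Finset.mul_sum]
    rw [Finset.sum_comm, powSum]
    refine Finset.sum_le_sum fun y _ => ?_
    have hPy := outputDist_nonneg W c y
    rw [Real.rpow_add' hPy (by linarith), Real.rpow_one]
    nth_rw 1 [outputDist]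
    rw [Finset.mul_sum, Finset.sum_mul, Finset.sum_mul]
    refine Finset.sum_le_sum fun m _ => ?_
    have hw : 0 ≤ ∏ i, W (c m i) (y i) := Finset.prod_nonneg fun i _ => (W _).nonneg _
    rw [Real.rpow_add' hw (by linarith), Real.rpow_one]
    have h2 : ((M : ℝ)⁻¹ * ∏ i, W (c m i) (y i)) ^ s ≤ outputDist W c y ^ s :=
      Real.rpow_le_rpow (by positivity) (le_outputDist W c m y) hs.le
    rw [Real.mul_rpow (by positivity) hw, Real.inv_rpow hM'.le, ← Real.rpow_neg hM'.le] at h2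
    have hq : 0 ≤ prodDist Q n y ^ (1 - (1 + s)) := Real.rpow_nonneg (prodDist_nonneg Q.nonneg y) _
    calc _ = ((M : ℝ)⁻¹ * (∏ i, W (c m i) (y i)) * prodDist Q n y ^ (1 - (1 + s))) *
          ((M : ℝ) ^ (-s) * (∏ i, W (c m i) (y i)) ^ s) := by ring
      _ ≤ ((M : ℝ)⁻¹ * (∏ i, W (c m i) (y i)) * prodDist Q n y ^ (1 - (1 + s))) *
          outputDist W c y ^ s := mul_le_mul_of_nonneg_left h2 (by positivity)
      _ = _ := by ring
  have h2 := sum_mul_log_le_log_sum (p := fun _ : Fin M => (M : ℝ)⁻¹)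
    (t := fun m => ∏ i, powSum (1 + s) (W (c m i)) Q) (fun _ => by positivity) (sum_const_inv hM)
    fun m _ => Finset.prod_pos fun i _ => hZ _
  have hpos : 0 < ∑ m, (M : ℝ)⁻¹ * ∏ i, powSum (1 + s) (W (c m i)) Q :=
    Finset.sum_pos (fun m _ => mul_pos (by positivity) (Finset.prod_pos fun i _ => hZ _))
      ⟨⟨0, hM⟩, Finset.mem_univ _⟩
  have h3 := Real.log_le_log (by positivity) h1
  rw [Real.log_mul (by positivity) hpos.ne', Real.log_rpow hM'] at h3
  have h4 : ∀ m, Real.log (∏ i, powSum (1 + s) (W (c m i)) Q) =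
      ∑ i, Real.log (powSum (1 + s) (W (c m i)) Q) := fun m =>
    Real.log_prod fun i _ => (hZ _).ne'
  simp only [h4] at h2
  rw [sum_codeType_mul hM hn c fun x => Real.log (powSum (1 + s) (W x) Q)] at h2
  linarith

/-- Merging the codewords by the log-sum inequality loses divergence; before the merge it is a sum
over positions. -/
theorem sum_outputDist_log_le (hM : 0 < M) (hn : 0 < n) (c : Fin M → Fin n → X) {V : X → ProbDist Y}
    (hV : ∀ x, AbsCont (V x) (W x)) :
    ∑ y, outputDist V c y * (Real.log (outputDist V c y) - Real.log (outputDist W c y)) ≤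
      n * condKL (fun x => W x) (jointDist (codeType hM hn c) V) := by
  have hM' : (0 : ℝ) < M := by exact_mod_cast hM
  have hpos : ∀ m (y : Fin n → Y), 0 < (M : ℝ)⁻¹ * ∏ i, V (c m i) (y i) →
      ∀ i, 0 < V (c m i) (y i) := by
    intro m y h i
    refine ((V _).nonneg _).lt_of_ne fun h0 => h.ne' ?_
    rw [Finset.prod_eq_zero (Finset.mem_univ i) h0.symm, mul_zero]
  have hWpos : ∀ x y, 0 < V x y → 0 < W x y := fun x y h =>
    ((W _).nonneg _).lt_of_ne fun h0 => h.ne' (hV x y h0.symm)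
  have h1 : ∀ y, outputDist V c y * (Real.log (outputDist V c y) - Real.log (outputDist W c y)) ≤
      ∑ m, (M : ℝ)⁻¹ * (∏ i, V (c m i) (y i)) *
        ∑ i, (Real.log (V (c m i) (y i)) - Real.log (W (c m i) (y i))) := by
    intro y
    have := log_sum_inequality (v := fun m => (M : ℝ)⁻¹ * ∏ i, V (c m i) (y i))
      (w := fun m => (M : ℝ)⁻¹ * ∏ i, W (c m i) (y i))
      (fun m => mul_nonneg (by positivity) (Finset.prod_nonneg fun i _ => (V _).nonneg _))
      (fun m => mul_nonneg (by positivity) (Finset.prod_nonneg fun i _ => (W _).nonneg _))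
      (fun m h => mul_pos (by positivity) (Finset.prod_pos fun i _ => hWpos _ _ (hpos m y h i)))
    rw [← Finset.mul_sum, ← Finset.mul_sum] at this
    refine this.trans_eq (Finset.sum_congr rfl fun m _ => ?_)
    by_cases h : 0 < (M : ℝ)⁻¹ * ∏ i, V (c m i) (y i)
    · have hv := hpos m y h
      have hw := fun i => hWpos _ _ (hv i)
      rw [Real.log_mul (by positivity) (Finset.prod_pos fun i _ => hv i).ne',
        Real.log_mul (by positivity) (Finset.prod_pos fun i _ => hw i).ne',
        Real.log_prod fun i _ => (hv i).ne', Real.log_prod fun i _ => (hw i).ne',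
        Finset.sum_sub_distrib]
      ring
    · have h0 : (M : ℝ)⁻¹ * ∏ i, V (c m i) (y i) = 0 := le_antisymm (not_lt.1 h)
        (mul_nonneg (by positivity) (Finset.prod_nonneg fun i _ => (V _).nonneg _))
      simp [h0]
  refine (Finset.sum_le_sum fun y _ => h1 y).trans_eq ?_
  rw [Finset.sum_comm, sum_outputDist_mul hM hn c V fun x y => Real.log (V x y) - Real.log (W x y),
    condKL_eq_sum, fstMarginal_jointDist]
  congr 1
  refine Finset.sum_congr rfl fun z _ => ?_
  by_cases h : jointDist (codeType hM hn c) V z = 0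
  · simp [h]
  · conv_rhs => rw [jointDist, Real.log_mul (left_ne_zero_of_mul h) (right_ne_zero_of_mul h)]
    rw [jointDist]
    ring

theorem outputDist_ne_zero_apply {V : X → ProbDist Y} (hV : ∀ x, AbsCont (V x) Q)
    (c : Fin M → Fin n → X) (y : Fin n → Y) (hy : outputDist V c y ≠ 0) (i : Fin n) :
    Q (y i) ≠ 0 := fun h0 =>
  hy (absCont_outputDist hV c y (Finset.prod_eq_zero (Finset.mem_univ i) h0))

theorem natCast_mul_klReal_outputDist_le (hM : 0 < M) (hn : 0 < n) (c : Fin M → Fin n → X)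
    {V : X → ProbDist Y} (hV : ∀ x, AbsCont (V x) Q) :
    n * klReal Q (sndMarginal (jointDist (codeType hM hn c) V)) ≤
      ∑ y, outputDist V c y * (Real.log (outputDist V c y) - Real.log (prodDist Q n y)) := by
  rw [← avgEmp_outputDist]
  exact natCast_mul_klReal_le hn (outputDist_nonneg V c) (sum_outputDist V hM c)
    (outputDist_ne_zero_apply hV c)

/-- The trial law in the variational bound is the output of the same codebook through the test
channel `V`. -/
theorem eta_le_log_powSum (hM : 0 < M) (hn : 0 < n) (hWQ : ∀ x, AbsCont (W x) Q)
    (c : Fin M → Fin n → X) {s : ℝ} (hs : 0 < s) {V : X → ProbDist Y}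
    (hV : ∀ x, AbsCont (V x) (W x)) :
    n * (s * klReal Q (sndMarginal (jointDist (codeType hM hn c) V)) -
        (1 + s) * condKL (fun x => W x) (jointDist (codeType hM hn c) V)) ≤
      Real.log (powSum (1 + s) (outputDist W c) (prodDist Q n)) := by
  have hVQ : ∀ x, AbsCont (V x) Q := fun x y h => hV x y (hWQ x y h)
  have h1 := natCast_mul_klReal_outputDist_le hM hn c hVQ
  have h2 := sum_outputDist_log_le hM hn c hV
  have h3 := variational_le_log_powSum (s := s) (outputDist_nonneg V c) (sum_outputDist V hM c)
    (outputDist_nonneg W c) (prodDist_nonneg Q.nonneg) (fun y hy =>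
      (outputDist_nonneg W c y).lt_of_ne fun h0 => hy.ne' ?_) (fun y hy =>
      (prodDist_nonneg Q.nonneg y).lt_of_ne fun h0 => hy.ne' (absCont_outputDist hVQ c y h0.symm))
  · have h4 := mul_le_mul_of_nonneg_left h1 hs.le
    have h5 := mul_le_mul_of_nonneg_left h2 (by linarith : 0 ≤ 1 + s)
    linarith
  · have hall : ∀ m, ∏ i, W (c m i) (y i) = 0 := by
      intro m
      have := le_outputDist W c m y
      rw [← h0] at this
      have hM' : (0 : ℝ) < (M : ℝ)⁻¹ := by positivity
      exact le_antisymm (nonpos_of_mul_nonpos_right this hM')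
        (Finset.prod_nonneg fun i _ => (W _).nonneg _)
    rw [outputDist, Finset.sum_eq_zero, mul_zero]
    intro m _
    obtain ⟨i, -, hi⟩ := Finset.prod_eq_zero_iff.1 (hall m)
    exact Finset.prod_eq_zero (Finset.mem_univ i) (hV _ _ hi)

/-- The case of order `1`: in the term of codeword `m`, the logarithm of the mixture is at least
`log w_m - log M`. -/
theorem rate_le_relEntropy (hM : 0 < M) (hn : 0 < n) (hWQ : ∀ x, AbsCont (W x) Q)
    (c : Fin M → Fin n → X) :
    n * ∑ x, codeType hM hn c x * klReal Q (W x) - Real.log M ≤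
      ∑ y, outputDist W c y * (Real.log (outputDist W c y) - Real.log (prodDist Q n y)) := by
  have hM' : (0 : ℝ) < M := by exact_mod_cast hM
  have h1 : ∀ y, ∑ m, (M : ℝ)⁻¹ * (∏ i, W (c m i) (y i)) *
        (-Real.log M + ∑ i, (Real.log (W (c m i) (y i)) - Real.log (Q (y i)))) ≤
      outputDist W c y * (Real.log (outputDist W c y) - Real.log (prodDist Q n y)) := by
    intro y
    nth_rw 1 [outputDist]
    rw [Finset.mul_sum, Finset.sum_mul]
    refine Finset.sum_le_sum fun m _ => ?_
    rcases (Finset.prod_nonneg fun i _ => (W (c m i)).nonneg (y i) :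
      0 ≤ ∏ i, W (c m i) (y i)).eq_or_lt with h | h
    · simp [← h]
    · have hq := prodDist_pos_of_prod_pos hWQ h
      refine mul_le_mul_of_nonneg_left ?_ (by positivity)
      rw [Finset.sum_sub_distrib, ← Real.log_prod fun i _ => Finset.prod_ne_zero_iff.1 h.ne' i
        (Finset.mem_univ i), ← Real.log_prod fun i _ => Finset.prod_ne_zero_iff.1 hq.ne' i
        (Finset.mem_univ i)]
      have := Real.log_le_log (by positivity) (le_outputDist W c m y)
      rw [Real.log_mul (by positivity) h.ne', Real.log_inv] at this
      change _ ≤ _ - Real.log (∏ i, Q (y i))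
      linarith
  refine le_trans (le_of_eq ?_) (Finset.sum_le_sum fun y _ => h1 y)
  rw [Finset.sum_comm]
  simp only [mul_add, Finset.sum_add_distrib]
  rw [sum_outputDist_mul hM hn c W fun x y => Real.log (W x y) - Real.log (Q y)]
  have h2 : ∑ m, ∑ y : Fin n → Y, (M : ℝ)⁻¹ * (∏ i, W (c m i) (y i)) * -Real.log M =
      -Real.log M := by
    rw [Finset.sum_comm]
    simp only [← Finset.sum_mul, ← Finset.mul_sum]
    have := sum_outputDist W hM c
    simp only [outputDist, ← Finset.mul_sum] at this
    rw [this, one_mul]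
  rw [h2, Fintype.sum_prod_type]
  simp only [klReal_eq_sum, jointDist, Finset.mul_sum, mul_assoc]
  ring

/-- Lower bound of a codebook for the orders `1 - s`. -/
theorem exists_jointDist_le_neg_log_powSum (hM : 0 < M) (hn : 0 < n) (c : Fin M → Fin n → X) {s : ℝ}
    (hs : 0 < s) (hs1 : s < 1) (hS : 0 < powSum (1 - s) (outputDist W c) (prodDist Q n)) :
    ∃ p ∈ jointSet (fun x => W x), p ∈ jointSet (fun _ : X => Q) ∧
      n * ((1 / s - 1) * condKL (fun x => W x) p + condKL (fun _ : X => Q) p) - Real.log M ≤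
        -(1 / s) * Real.log (powSum (1 - s) (outputDist W c) (prodDist Q n)) ∧
      n * ((1 / s - 1) * condKL (fun x => W x) p + klReal Q (sndMarginal p)) ≤
        -(1 / s) * Real.log (powSum (1 - s) (outputDist W c) (prodDist Q n)) := by
  have hM' : (0 : ℝ) < M := by exact_mod_cast hM
  set S := powSum (1 - s) (outputDist W c) (prodDist Q n) with hSdef
  set P := outputDist W c with hPdef
  have hP0 : ∀ y, 0 ≤ P y := outputDist_nonneg W c
  have hq0 : ∀ y : Fin n → Y, 0 ≤ prodDist Q n y := prodDist_nonneg Q.nonneg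
  -- The tilted law, the optimizer of the variational formula.
  obtain ⟨T, hT⟩ : ∃ T : (Fin n → Y) → ℝ,
      ∀ y, T y = P y ^ (1 - s) * prodDist Q n y ^ (1 - (1 - s)) / S := ⟨_, fun _ => rfl⟩
  have hT0 : ∀ y, 0 ≤ T y := fun y => by
    rw [hT]
    exact div_nonneg (mul_nonneg (Real.rpow_nonneg (hP0 y) _) (Real.rpow_nonneg (hq0 y) _)) hS.le
  have hT1 : ∑ y, T y = 1 := by
    simp only [hT]
    rw [← Finset.sum_div]
    exact div_self hS.ne'
  have hTP : ∀ y, T y ≠ 0 → 0 < P y := fun y h => (hP0 y).lt_of_ne fun h0 => h <| by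
    rw [hT, ← h0, Real.zero_rpow (by linarith)]
    simp
  have hTQ : ∀ y, T y ≠ 0 → 0 < prodDist Q n y := fun y h => (hq0 y).lt_of_ne fun h0 => h <| by
    rw [hT, ← h0, Real.zero_rpow (by linarith)]
    simp
  have hlogT : ∀ y, T y ≠ 0 → Real.log (T y) =
      (1 - s) * Real.log (P y) + s * Real.log (prodDist Q n y) - Real.log S := fun y h => by
    have h1 := Real.rpow_pos_of_pos (hTP y h) (1 - s)
    have h2 := Real.rpow_pos_of_pos (hTQ y h) (1 - (1 - s))
    rw [hT, Real.log_div (mul_pos h1 h2).ne' hS.ne', Real.log_mul h1.ne' h2.ne',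
      Real.log_rpow (hTP y h), Real.log_rpow (hTQ y h)]
    ring
  obtain ⟨w, hw⟩ : ∃ w : Fin M → (Fin n → Y) → ℝ, ∀ m y, w m y = ∏ i, W (c m i) (y i) :=
    ⟨_, fun _ _ => rfl⟩
  have hw0 : ∀ m y, 0 ≤ w m y := fun m y => by
    rw [hw]
    exact Finset.prod_nonneg fun i _ => (W _).nonneg _
  have hPw : ∀ y, ∑ m, (M : ℝ)⁻¹ * w m y = P y := fun y => by
    rw [← Finset.mul_sum]
    simp only [hw]
    rfl
  -- The output follows `T` and the message follows its posterior law under the code.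
  obtain ⟨P', hP'⟩ : ∃ P' : Fin M × (Fin n → Y) → ℝ,
      ∀ m y, P' (m, y) = T y * ((M : ℝ)⁻¹ * w m y / P y) := 
    ⟨fun u => T u.2 * ((M : ℝ)⁻¹ * w u.1 u.2 / P u.2), fun _ _ => rfl⟩
  have hP'0 : ∀ u, 0 ≤ P' u := fun u => by
    rw [← Prod.mk.eta (p := u), hP']
    exact mul_nonneg (hT0 _) (div_nonneg (mul_nonneg (by positivity) (hw0 _ _)) (hP0 _))
  have hmarg : ∀ y, ∑ m, P' (m, y) = T y := fun y => by
    simp only [hP']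
    rw [← Finset.mul_sum, ← Finset.sum_div, hPw]
    by_cases h : T y = 0
    · rw [h, zero_mul]
    · rw [div_self (hTP y h).ne', mul_one]
  have hsum : ∀ φ : (Fin n → Y) → ℝ, ∑ u, P' u * φ u.2 = ∑ y, T y * φ y := fun φ => by
    rw [Fintype.sum_prod_type, Finset.sum_comm]
    exact Finset.sum_congr rfl fun y _ => by rw [← hmarg, Finset.sum_mul]
  have hP'1 : ∑ u, P' u = 1 := by
    have := hsum fun _ => 1
    simpa [hT1] using this
  have hPT : ∀ m y, P' (m, y) ≠ 0 → T y ≠ 0 := fun m y h => by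
    rw [hP'] at h
    exact left_ne_zero_of_mul h
  have hPw' : ∀ m y, P' (m, y) ≠ 0 → 0 < w m y := fun m y h => (hw0 m y).lt_of_ne fun h0 => h <| by
    rw [hP', ← h0]
    simp
  have hWne : ∀ u : Fin M × (Fin n → Y), P' u ≠ 0 → ∀ i, W (c u.1 i) (u.2 i) ≠ 0 := by
    rintro ⟨m, y⟩ h i
    have := (hPw' m y h).ne'
    rw [hw] at this
    exact Finset.prod_ne_zero_iff.1 this i (Finset.mem_univ i)
  have hQne' : ∀ y, T y ≠ 0 → ∀ i, Q (y i) ≠ 0 := fun y h i =>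
    Finset.prod_ne_zero_iff.1 (hTQ y h).ne' i (Finset.mem_univ i)
  have hQne : ∀ u : Fin M × (Fin n → Y), P' u ≠ 0 → ∀ i, Q (u.2 i) ≠ 0 := fun ⟨m, y⟩ h i =>
    hQne' y (hPT m y h) i
  set p := jointEmp P' c with hp
  have hp0 : ∀ z, 0 ≤ p z := avgEmp_nonneg hP'0 _
  have hVle : ∑ u : Fin M × (Fin n → Y), (M : ℝ)⁻¹ * ∏ i, condProb p (c u.1 i) (u.2 i) ≤ 1 := by
    rw [Fintype.sum_prod_type]
    simp only [← Finset.mul_sum]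
    rw [inv_mul_le_iff₀ hM', mul_one]
    calc _ ≤ ∑ _m : Fin M, (1 : ℝ) :=
          Finset.sum_le_sum fun m _ => sum_prod_condProb_le hp0 (c m)
      _ = M := by simp
  have hlogP' : ∀ m y, P' (m, y) ≠ 0 → Real.log (P' (m, y)) =
      Real.log (T y) + Real.log (M : ℝ)⁻¹ + Real.log (w m y) - Real.log (P y) := fun m y h => by
    have h1 := hTP y (hPT m y h)
    have h2 := hPw' m y h
    have h3 := hPT m y h
    rw [hP', Real.log_mul h3 (by positivity), Real.log_div (by positivity) h1.ne',
      Real.log_mul (by positivity) h2.ne']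
    ring
  -- Both joint laws have the same posterior, so lifting leaves the divergence of `T` from `P`
  -- unchanged.
  have hA : n * condKL (fun x => W x) p ≤ ∑ y, T y * (Real.log (T y) - Real.log (P y)) := by
    have := natCast_mul_condKL_le (w := fun x => W x) (ρ := fun _ => (M : ℝ)⁻¹) hP'0 hP'1 hWne
      (fun _ => by positivity) (fun _ _ => by positivity) hVle
    refine this.trans_eq ?_
    rw [← hsum]
    refine Finset.sum_congr rfl ?_
    rintro ⟨m, y⟩ -
    by_cases h : P' (m, y) = 0
    · simp [h]
    · rw [hlogP' m y h, ← hw]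
      ring
  -- Here `ρ` is the posterior times `M⁻¹`. The posterior cancels against that in `P'` and leaves
  -- `log M`; being at most one, it keeps `ρ` below the uniform weight, for which the mass condition
  -- is `hVle`.
  have hB : n * condKL (fun _ : X => Q) p ≤
      ∑ y, T y * (Real.log (T y) - Real.log (prodDist Q n y)) + Real.log M := by
    have := natCast_mul_condKL_le (c := c) (w := fun _ : X => Q)
      (ρ := fun u => (M : ℝ)⁻¹ * ((M : ℝ)⁻¹ * w u.1 u.2 / P u.2)) hP'0 hP'1 hQne
      (fun u => mul_nonneg (by positivity)
        (div_nonneg (mul_nonneg (by positivity) (hw0 _ _)) (hP0 _)))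
      (fun ⟨m, y⟩ h => mul_pos (by positivity) (div_pos (mul_pos (by positivity)
        (hPw' m y h.ne')) (hTP y (hPT m y h.ne')))) ?_
    · refine this.trans_eq ?_
      have e : Real.log M = ∑ y, T y * Real.log M := by rw [← Finset.sum_mul, hT1, one_mul]
      rw [e, ← Finset.sum_add_distrib]
      simp only [← mul_add]
      rw [← hsum fun y => Real.log (T y) - Real.log (prodDist Q n y) + Real.log M]
      refine Finset.sum_congr rfl ?_
      rintro ⟨m, y⟩ -
      by_cases h : P' (m, y) = 0
      · simp [h]
      · have h1 := hTP y (hPT m y h)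
        have h2 := hPw' m y h
        rw [hlogP' m y h, Real.log_mul (by positivity) (by positivity),
          Real.log_div (by positivity) h1.ne', Real.log_mul (by positivity) h2.ne', Real.log_inv,
          prodDist]
        ring
    · refine le_trans (Finset.sum_le_sum fun u _ => ?_) hVle
      refine mul_le_mul_of_nonneg_right ?_ (Finset.prod_nonneg fun i _ => condProb_nonneg hp0 _ _)
      refine mul_le_of_le_one_right (by positivity) (div_le_one_of_le₀ ?_ (hP0 _))
      rw [hw]
      exact le_outputDist W c u.1 u.2
  have hC : n * klReal Q (sndMarginal p) ≤
      ∑ y, T y * (Real.log (T y) - Real.log (prodDist Q n y)) := by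
    have e : sndMarginal p = avgEmp T fun y : Fin n → Y => y := by
      rw [hp, sndMarginal_jointEmp]
      ext b
      exact hsum fun y => emp y b
    rw [e]
    exact natCast_mul_klReal_le hn hT0 hT1 hQne'
  -- For the tilted law the variational formula is an identity, so both inequalities have the same
  -- right-hand side.
  have hD : (1 / s - 1) * ∑ y, T y * (Real.log (T y) - Real.log (P y)) +
      ∑ y, T y * (Real.log (T y) - Real.log (prodDist Q n y)) = -(1 / s) * Real.log S := by
    have e : -(1 / s) * Real.log S = ∑ y, T y * (-(1 / s) * Real.log S) := by
      rw [← Finset.sum_mul, hT1, one_mul]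
    rw [e, Finset.mul_sum, ← Finset.sum_add_distrib]
    refine Finset.sum_congr rfl fun y _ => ?_
    by_cases h : T y = 0
    · simp [h]
    · rw [hlogT y h]
      field_simp
      ring
  have hs' : 0 ≤ 1 / s - 1 := by
    rw [sub_nonneg, le_div_iff₀ hs]
    linarith
  have hA' := mul_le_mul_of_nonneg_left hA hs'
  refine ⟨p, jointEmp_mem_jointSet hn hP'0 hP'1 hWne, jointEmp_mem_jointSet hn hP'0 hP'1 hQne,
    ?_, ?_⟩
  · linarith
  · linarith

end Converse

/-! ### Random coding: independent codewords -/

section IndependentCodewords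

variable {A : Type*} [Fintype A] {M : ℕ} {p w : A → ℝ}

theorem sum_prod_mul_apply_mul_apply (hp1 : ∑ x, p x = 1) {m m' : Fin M} (hm : m' ≠ m)
    (g h : A → ℝ) :
    ∑ c : Fin M → A, (∏ k, p (c k)) * (g (c m) * h (c m')) =
      (∑ x, p x * g x) * ∑ x, p x * h x := by
  classical
  have e : ∀ c : Fin M → A, (∏ k, p (c k)) * (g (c m) * h (c m')) =
      ∏ k, (p (c k) * ((if k = m then g (c k) else 1) * if k = m' then h (c k) else 1)) := by
    intro c
    rw [Finset.prod_mul_distrib, Finset.prod_mul_distrib, Finset.prod_ite_eq' Finset.univ m,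
      Finset.prod_ite_eq' Finset.univ m', if_pos (Finset.mem_univ m), if_pos (Finset.mem_univ m')]
  rw [Finset.sum_congr rfl fun c _ => e c,
    sum_prod_apply fun k b => p b * ((if k = m then g b else 1) * if k = m' then h b else 1),
    ← Finset.mul_prod_erase _ _ (Finset.mem_univ m),
    ← Finset.mul_prod_erase _ _ (Finset.mem_erase.2 ⟨hm, Finset.mem_univ m'⟩),
    Finset.prod_eq_one, mul_one]
  · simp [hm, hm.symm]
  · intro k hk
    have h1 := Finset.ne_of_mem_erase hk
    have h2 := Finset.ne_of_mem_erase (Finset.mem_of_mem_erase hk)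
    simp [h1, h2, hp1]

/-- Given codeword `m`, the average of `w` has mean `M⁻¹ w (c m)` plus `(M - 1) / M` times the mean
of `w`; the latter fraction is bounded by one. -/
theorem sum_prod_mul_avg_le (hp : ∀ x, 0 ≤ p x) (hp1 : ∑ x, p x = 1) (hw : ∀ x, 0 ≤ w x)
    (m : Fin M) {g : A → ℝ} (hg : ∀ x, 0 ≤ g x) :
    ∑ c : Fin M → A, (∏ k, p (c k)) * (g (c m) * ((M : ℝ)⁻¹ * ∑ m', w (c m'))) ≤
      ∑ x, p x * (g x * ((M : ℝ)⁻¹ * w x + ∑ x', p x' * w x')) := by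
  have hM : 0 < M := m.pos
  have hEg : 0 ≤ ∑ x, p x * g x := Finset.sum_nonneg fun x _ => mul_nonneg (hp x) (hg x)
  have hEw : 0 ≤ ∑ x, p x * w x := Finset.sum_nonneg fun x _ => mul_nonneg (hp x) (hw x)
  have e : ∑ c : Fin M → A, (∏ k, p (c k)) * (g (c m) * ((M : ℝ)⁻¹ * ∑ m', w (c m'))) =
      (M : ℝ)⁻¹ * ∑ m', ∑ c : Fin M → A, (∏ k, p (c k)) * (g (c m) * w (c m')) := by
    simp only [Finset.mul_sum]
    rw [Finset.sum_comm]
    refine Finset.sum_congr rfl fun m' _ => Finset.sum_congr rfl fun c _ => by ring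
  rw [e, ← Finset.add_sum_erase _ _ (Finset.mem_univ m),
    sum_prod_mul_apply (V := fun _ => p) (fun _ => hp1) m fun x => g x * w x,
    Finset.sum_congr rfl fun m' hm' =>
      sum_prod_mul_apply_mul_apply hp1 (Finset.ne_of_mem_erase hm') g w]
  simp only [Finset.sum_const, Finset.card_erase_of_mem (Finset.mem_univ m), Finset.card_univ,
    Fintype.card_fin, nsmul_eq_mul]
  have h1 : (M : ℝ)⁻¹ * ((M - 1 : ℕ) : ℝ) ≤ 1 := by
    rw [inv_mul_le_iff₀ (by positivity), mul_one]
    exact_mod_cast Nat.sub_le M 1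
  have h2 := mul_le_mul_of_nonneg_right h1 (mul_nonneg hEg hEw)
  have e2 : ∑ x, p x * (g x * ((M : ℝ)⁻¹ * w x + ∑ x', p x' * w x')) =
      (M : ℝ)⁻¹ * ∑ x, p x * (g x * w x) + (∑ x, p x * g x) * ∑ x', p x' * w x' := by
    rw [Finset.mul_sum, Finset.sum_mul, ← Finset.sum_add_distrib]
    exact Finset.sum_congr rfl fun x _ => by ring
  rw [e2]
  linarith

/-- The tangent of a concave power at `v`. With `v` above the conditional mean of `u`, the linear
term has nonpositive expectation. -/
theorem rpow_le_tangent {s u v : ℝ} (hs : 0 ≤ s) (hs1 : s ≤ 1) (hu : 0 ≤ u) (hv : 0 < v) :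
    u ^ s ≤ v ^ s + s * (v ^ (s - 1) * (u - v)) := by
  have h := rpow_one_add_le_one_add_mul_self (s := u / v - 1)
    (by linarith [div_nonneg hu hv.le]) hs hs1
  rw [add_sub_cancel, Real.div_rpow hu hv.le, div_le_iff₀ (Real.rpow_pos_of_pos hv _)] at h
  refine h.trans_eq ?_
  rw [Real.rpow_sub hv, Real.rpow_one]
  field_simp

/-- The tangent of a convex power. Its slope is negative, so the same upper bound on the mean of `u`
now yields a lower bound. -/
theorem tangent_le_rpow_neg {s u v : ℝ} (hs : 0 ≤ s) (hu : 0 < u) (hv : 0 < v) :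
    v ^ (-s) - s * (v ^ (-s - 1) * (u - v)) ≤ u ^ (-s) := by
  have h1 : 1 - s * (u / v - 1) ≤ (u / v) ^ (-s) := by
    rw [Real.rpow_def_of_pos (div_pos hu hv)]
    have h2 := Real.add_one_le_exp (Real.log (u / v) * -s)
    have h3 := mul_le_mul_of_nonneg_left (Real.log_le_sub_one_of_pos (div_pos hu hv)) hs
    linarith
  rw [Real.div_rpow hu.le hv.le, le_div_iff₀ (Real.rpow_pos_of_pos hv _)] at h1
  refine le_trans (le_of_eq ?_) h1
  rw [Real.rpow_sub hv, Real.rpow_one]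
  field_simp

theorem mul_sum_pos_of_pos (hM : 0 < M) (hw : ∀ x, 0 ≤ w x) {c : Fin M → A} {m : Fin M}
    (h : 0 < w (c m)) : 0 < (M : ℝ)⁻¹ * ∑ m', w (c m') :=
  mul_pos (by positivity) (Finset.sum_pos' (fun m _ => hw _) ⟨m, Finset.mem_univ m, h⟩)

/-- One factor of the power is expanded over the codewords. Given codeword `m`, the remaining power
`s` is replaced by its tangent at `v (c m)`, the bound for the conditional mean; subadditivity of
`u^s` then separates the codeword's own share from the mean. -/
theorem sum_prod_mul_rpow_le (hM : 0 < M) (hp : ∀ x, 0 ≤ p x) (hp1 : ∑ x, p x = 1)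
    (hw : ∀ x, 0 ≤ w x) {s : ℝ} (hs : 0 < s) (hs1 : s ≤ 1) :
    ∑ c : Fin M → A, (∏ k, p (c k)) * ((M : ℝ)⁻¹ * ∑ m, w (c m)) ^ (1 + s) ≤
      (M : ℝ) ^ (-s) * ∑ x, p x * w x ^ (1 + s) + (∑ x, p x * w x) ^ (1 + s) := by
  have hM' : (0 : ℝ) < M := by exact_mod_cast hM
  have hEw : 0 ≤ ∑ x, p x * w x := Finset.sum_nonneg fun x _ => mul_nonneg (hp x) (hw x)
  set E := ∑ x, p x * w x with hE
  obtain ⟨v, hv⟩ : ∃ v : A → ℝ, ∀ x, v x = (M : ℝ)⁻¹ * w x + E := ⟨_, fun _ => rfl⟩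
  have hv0 : ∀ x, 0 ≤ v x := fun x => by
    rw [hv]
    exact add_nonneg (mul_nonneg (by positivity) (hw x)) hEw
  have hvpos : ∀ x, 0 < w x → 0 < v x := fun x h => by
    rw [hv]
    exact add_pos_of_pos_of_nonneg (mul_pos (by positivity) h) hEw
  have hpr : ∀ c : Fin M → A, 0 ≤ ∏ k, p (c k) := fun c => Finset.prod_nonneg fun k _ => hp _
  have hm : ∀ m, ∑ c : Fin M → A, (∏ k, p (c k)) * (w (c m) * ((M : ℝ)⁻¹ * ∑ m', w (c m')) ^ s) ≤
      ∑ x, p x * (w x * v x ^ s) := by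
    intro m
    have h1 : ∀ c : Fin M → A, (∏ k, p (c k)) * (w (c m) * ((M : ℝ)⁻¹ * ∑ m', w (c m')) ^ s) ≤
        (∏ k, p (c k)) * (w (c m) * v (c m) ^ s) +
          s * ((∏ k, p (c k)) * (w (c m) * v (c m) ^ (s - 1) * ((M : ℝ)⁻¹ * ∑ m', w (c m'))) -
            (∏ k, p (c k)) * (w (c m) * v (c m) ^ (s - 1) * v (c m))) := by
      intro c
      rcases (hw (c m)).eq_or_lt with h | h
      · simp [← h]
      · have := rpow_le_tangent hs.le hs1 (mul_sum_pos_of_pos hM hw h).le (hvpos _ h)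
        have := mul_le_mul_of_nonneg_left this (mul_nonneg (hpr c) h.le)
        linarith
    refine (Finset.sum_le_sum fun c _ => h1 c).trans ?_
    rw [Finset.sum_add_distrib, ← Finset.mul_sum, Finset.sum_sub_distrib,
      sum_prod_mul_apply (V := fun _ => p) (fun _ => hp1) m fun x => w x * v x ^ s,
      sum_prod_mul_apply (V := fun _ => p) (fun _ => hp1) m fun x => w x * v x ^ (s - 1) * v x]
    have h2 := sum_prod_mul_avg_le hp hp1 hw m (g := fun x => w x * v x ^ (s - 1))
      fun x => mul_nonneg (hw x) (Real.rpow_nonneg (hv0 x) _)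
    simp only [← hE, ← hv] at h2
    have h3 := mul_le_mul_of_nonneg_left (sub_nonpos.2 h2) hs.le
    linarith
  have e : ∀ c : Fin M → A, (∏ k, p (c k)) * ((M : ℝ)⁻¹ * ∑ m, w (c m)) ^ (1 + s) =
      ∑ m, (M : ℝ)⁻¹ * ((∏ k, p (c k)) * (w (c m) * ((M : ℝ)⁻¹ * ∑ m', w (c m')) ^ s)) := by
    intro c
    rw [Real.rpow_add' (mul_nonneg (by positivity) (Finset.sum_nonneg fun m _ => hw _))
      (by linarith), Real.rpow_one]
    simp only [← Finset.mul_sum, ← Finset.sum_mul]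
    ring
  rw [Finset.sum_congr rfl fun c _ => e c, Finset.sum_comm]
  simp only [← Finset.mul_sum]
  have h1 : (M : ℝ)⁻¹ * ∑ m, ∑ c : Fin M → A,
      (∏ k, p (c k)) * (w (c m) * ((M : ℝ)⁻¹ * ∑ m', w (c m')) ^ s) ≤ ∑ x, p x * (w x * v x ^ s) := by
    rw [inv_mul_le_iff₀ hM']
    refine (Finset.sum_le_sum fun m _ => hm m).trans_eq ?_
    simp
  refine h1.trans ?_
  have h2 : ∀ x, p x * (w x * v x ^ s) ≤
      (M : ℝ) ^ (-s) * (p x * w x ^ (1 + s)) + p x * w x * E ^ s := by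
    intro x
    have h3 : v x ^ s ≤ (M : ℝ) ^ (-s) * w x ^ s + E ^ s := by
      rw [hv]
      refine (Real.rpow_add_le_add_rpow (mul_nonneg (by positivity) (hw x)) hEw hs.le hs1).trans_eq ?_
      rw [Real.mul_rpow (by positivity) (hw x), Real.inv_rpow hM'.le, Real.rpow_neg hM'.le]
    have h4 := mul_le_mul_of_nonneg_left h3 (mul_nonneg (hp x) (hw x))
    rw [Real.rpow_add' (hw x) (by linarith), Real.rpow_one]
    linarith
  refine (Finset.sum_le_sum fun x _ => h2 x).trans_eq ?_
  rw [Finset.sum_add_distrib, ← Finset.mul_sum, ← Finset.sum_mul, ← hE,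
    Real.rpow_add' hEw (by linarith), Real.rpow_one]

/-- The same conditioning on one codeword, with the convex power `u^(-s)`. -/
theorem le_sum_prod_mul_rpow (hM : 0 < M) (hp : ∀ x, 0 ≤ p x) (hp1 : ∑ x, p x = 1)
    (hw : ∀ x, 0 ≤ w x) {s : ℝ} (hs : 0 < s) (hs1 : s < 1) :
    ∑ x, p x * (w x * ((M : ℝ)⁻¹ * w x + ∑ x', p x' * w x') ^ (-s)) ≤
      ∑ c : Fin M → A, (∏ k, p (c k)) * ((M : ℝ)⁻¹ * ∑ m, w (c m)) ^ (1 - s) := by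
  have hM' : (0 : ℝ) < M := by exact_mod_cast hM
  have hEw : 0 ≤ ∑ x, p x * w x := Finset.sum_nonneg fun x _ => mul_nonneg (hp x) (hw x)
  set E := ∑ x, p x * w x with hE
  obtain ⟨v, hv⟩ : ∃ v : A → ℝ, ∀ x, v x = (M : ℝ)⁻¹ * w x + E := ⟨_, fun _ => rfl⟩
  have hv0 : ∀ x, 0 ≤ v x := fun x => by
    rw [hv]
    exact add_nonneg (mul_nonneg (by positivity) (hw x)) hEw
  have hvpos : ∀ x, 0 < w x → 0 < v x := fun x h => by
    rw [hv]
    exact add_pos_of_pos_of_nonneg (mul_pos (by positivity) h) hEw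
  have hpr : ∀ c : Fin M → A, 0 ≤ ∏ k, p (c k) := fun c => Finset.prod_nonneg fun k _ => hp _
  simp only [← hv]
  have hm : ∀ m, ∑ x, p x * (w x * v x ^ (-s)) ≤
      ∑ c : Fin M → A, (∏ k, p (c k)) * (w (c m) * ((M : ℝ)⁻¹ * ∑ m', w (c m')) ^ (-s)) := by
    intro m
    have h1 : ∀ c : Fin M → A, (∏ k, p (c k)) * (w (c m) * v (c m) ^ (-s)) -
          s * ((∏ k, p (c k)) * (w (c m) * v (c m) ^ (-s - 1) * ((M : ℝ)⁻¹ * ∑ m', w (c m'))) -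
            (∏ k, p (c k)) * (w (c m) * v (c m) ^ (-s - 1) * v (c m))) ≤
        (∏ k, p (c k)) * (w (c m) * ((M : ℝ)⁻¹ * ∑ m', w (c m')) ^ (-s)) := by
      intro c
      rcases (hw (c m)).eq_or_lt with h | h
      · simp [← h]
      · have := tangent_le_rpow_neg hs.le (mul_sum_pos_of_pos hM hw h) (hvpos _ h)
        have := mul_le_mul_of_nonneg_left this (mul_nonneg (hpr c) h.le)
        linarith
    refine le_trans ?_ (Finset.sum_le_sum fun c _ => h1 c)
    rw [Finset.sum_sub_distrib, ← Finset.mul_sum, Finset.sum_sub_distrib,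
      sum_prod_mul_apply (V := fun _ => p) (fun _ => hp1) m fun x => w x * v x ^ (-s),
      sum_prod_mul_apply (V := fun _ => p) (fun _ => hp1) m fun x => w x * v x ^ (-s - 1) * v x]
    have h2 := sum_prod_mul_avg_le hp hp1 hw m (g := fun x => w x * v x ^ (-s - 1))
      fun x => mul_nonneg (hw x) (Real.rpow_nonneg (hv0 x) _)
    simp only [← hE, ← hv] at h2
    have h3 := mul_le_mul_of_nonneg_left (sub_nonpos.2 h2) hs.le
    linarith
  have e : ∀ c : Fin M → A, (∏ k, p (c k)) * ((M : ℝ)⁻¹ * ∑ m, w (c m)) ^ (1 - s) =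
      ∑ m, (M : ℝ)⁻¹ * ((∏ k, p (c k)) * (w (c m) * ((M : ℝ)⁻¹ * ∑ m', w (c m')) ^ (-s))) := by
    intro c
    rw [sub_eq_add_neg, Real.rpow_add' (mul_nonneg (by positivity)
      (Finset.sum_nonneg fun m _ => hw _)) (by linarith), Real.rpow_one]
    simp only [← Finset.mul_sum, ← Finset.sum_mul]
    ring
  rw [Finset.sum_congr rfl fun c _ => e c, Finset.sum_comm]
  simp only [← Finset.mul_sum]
  rw [le_inv_mul_iff₀ hM']
  refine le_trans (le_of_eq ?_) (Finset.sum_le_sum fun m _ => hm m)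
  simp

end IndependentCodewords

/-! ### Random coding: constant composition codewords -/

section ConstantComposition

variable {X Y : Type*} [Fintype X] [Fintype Y] {M n : ℕ}

open Classical in
/-- The uniform distribution on the rearrangements of a word. -/
noncomputable def permDist (x₀ : Fin n → X) : ProbDist (Fin n → X) :=
  ⟨fun x => ∑ σ : Equiv.Perm (Fin n), if x₀ ∘ σ = x then (n.factorial : ℝ)⁻¹ else 0,
    fun x => Finset.sum_nonneg fun σ _ => by split_ifs <;> positivity, by
      rw [Finset.sum_comm]
      simp [Fintype.card_perm, Nat.factorial_ne_zero]⟩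

theorem sum_permDist_mul (x₀ : Fin n → X) (f : (Fin n → X) → ℝ) :
    ∑ x, permDist x₀ x * f x = (n.factorial : ℝ)⁻¹ * ∑ σ : Equiv.Perm (Fin n), f (x₀ ∘ σ) := by
  classical
  change ∑ x, (∑ σ : Equiv.Perm (Fin n), if x₀ ∘ σ = x then (n.factorial : ℝ)⁻¹ else 0) * f x = _
  simp only [Finset.sum_mul]
  rw [Finset.sum_comm, Finset.mul_sum]
  simp

/-- The probability of an output word for a given input word. -/
noncomputable def wordProb (W : X → ProbDist Y) (x : Fin n → X) (y : Fin n → Y) : ℝ :=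
  ∏ i, W (x i) (y i)

theorem wordProb_nonneg (W : X → ProbDist Y) (x : Fin n → X) (y : Fin n → Y) :
    0 ≤ wordProb W x y := Finset.prod_nonneg fun _ _ => (W _).nonneg _

theorem wordProb_comp_perm (W : X → ProbDist Y) (x : Fin n → X) (y : Fin n → Y)
    (σ : Equiv.Perm (Fin n)) : wordProb W (x ∘ σ) (y ∘ σ) = wordProb W x y :=
  Equiv.prod_comp σ fun i => W (x i) (y i)

/-- The output distribution for a uniformly distributed rearrangement of an input word. -/
noncomputable def permOutput (W : X → ProbDist Y) (x₀ : Fin n → X) (y : Fin n → Y) : ℝ :=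
  ∑ x, permDist x₀ x * wordProb W x y

theorem permOutput_nonneg (W : X → ProbDist Y) (x₀ : Fin n → X) (y : Fin n → Y) :
    0 ≤ permOutput W x₀ y :=
  Finset.sum_nonneg fun x _ => mul_nonneg ((permDist x₀).nonneg x) (wordProb_nonneg W x y)

/-- Rearranging the input is equivalent to rearranging the output inversely, so the mass is uniform
on each output orbit and equals the orbit's probability divided by its size. -/
theorem permOutput_eq (W : X → ProbDist Y) (x₀ : Fin n → X) (y : Fin n → Y) :
    permOutput W x₀ y =
      stabCard y / n.factorial * ∑ y' ∈ rearrangements y, wordProb W x₀ y' := by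
  rw [permOutput, sum_permDist_mul]
  have h : ∑ σ : Equiv.Perm (Fin n), wordProb W (x₀ ∘ σ) y =
      ∑ σ : Equiv.Perm (Fin n), wordProb W x₀ (y ∘ σ) := by
    rw [← Equiv.sum_comp (Equiv.inv (Equiv.Perm (Fin n)))]
    refine Finset.sum_congr rfl fun σ _ => ?_
    rw [← wordProb_comp_perm W x₀ (y ∘ σ) σ⁻¹]
    congr 1
    ext i
    simp
  rw [h, sum_perm_eq]
  ring

theorem permOutput_comp_perm (W : X → ProbDist Y) (x₀ : Fin n → X) (y : Fin n → Y)
    (τ : Equiv.Perm (Fin n)) : permOutput W x₀ (y ∘ τ) = permOutput W x₀ y := by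
  simp only [permOutput, sum_permDist_mul]
  congr 1
  rw [← Equiv.sum_comp (Equiv.mulRight τ)]
  exact Finset.sum_congr rfl fun σ _ => wordProb_comp_perm W (x₀ ∘ σ) y τ

/-- The probability of the rearrangements of an output word. -/
theorem exists_sum_wordProb_le (hn : 0 < n) (W : X → ProbDist Y) (x₀ : Fin n → X) (y₀ : Fin n → Y)
    (h : 0 < ∑ y ∈ rearrangements y₀, wordProb W x₀ y) :
    ∃ p ∈ jointSet (fun x => W x), fstMarginal p = emp x₀ ∧ sndMarginal p = emp y₀ ∧
      ∑ y ∈ rearrangements y₀, wordProb W x₀ y ≤ Real.exp (-(n * condKL (fun x => W x) p)) := by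
  classical
  set m := ∑ y ∈ rearrangements y₀, wordProb W x₀ y with hm
  -- The channel law from `x₀` conditioned on the orbit: its relative entropy to the unconditioned
  -- law is minus the logarithm of the orbit's probability. The index `Fin 1` makes `x₀` a codebook
  -- with one word.
  obtain ⟨P', hP'⟩ : ∃ P' : Fin 1 × (Fin n → Y) → ℝ,
      ∀ u, P' u = if u.2 ∈ rearrangements y₀ then wordProb W x₀ u.2 / m else 0 :=
    ⟨_, fun _ => rfl⟩
  have h0 : ∀ u, 0 ≤ P' u := fun u => by
    rw [hP']
    split_ifs
    · exact div_nonneg (wordProb_nonneg W _ _) h.le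
    · exact le_rfl
  have h1 : ∑ u, P' u = 1 := by
    rw [Fintype.sum_prod_type]
    simp only [hP', Finset.univ_unique, Finset.sum_singleton]
    rw [← Finset.sum_filter, ← Finset.sum_div, Finset.filter_univ_mem, ← hm, div_self h.ne']
  have hne : ∀ u, P' u ≠ 0 → u.2 ∈ rearrangements y₀ ∧ 0 < wordProb W x₀ u.2 := fun u hu => by
    rw [hP'] at hu
    split_ifs at hu with hmem
    · exact ⟨hmem, (wordProb_nonneg W _ _).lt_of_ne fun h0 => hu (by rw [← h0, zero_div])⟩
    · exact absurd rfl hu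
  have hW : ∀ u, P' u ≠ 0 → ∀ i, W ((fun _ : Fin 1 => x₀) u.1 i) (u.2 i) ≠ 0 := fun u hu i =>
    Finset.prod_ne_zero_iff.1 (hne u hu).2.ne' i (Finset.mem_univ i)
  have hle := natCast_mul_condKL_le (c := fun _ : Fin 1 => x₀) (w := fun x => W x)
    (ρ := fun _ => 1) h0 h1 hW (fun _ => zero_le_one) (fun _ _ => one_pos) (by
      rw [Fintype.sum_prod_type]
      simp only [Finset.univ_unique, Finset.sum_singleton, one_mul]
      exact sum_prod_condProb_le (avgEmp_nonneg h0 _) x₀)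
  refine ⟨jointEmp P' fun _ => x₀, jointEmp_mem_jointSet hn h0 h1 hW, ?_, ?_, ?_⟩
  · rw [fstMarginal_jointEmp]
    exact avgEmp_const h1 fun u _ => rfl
  · rw [sndMarginal_jointEmp]
    exact avgEmp_const h1 fun u hu => emp_of_mem_rearrangements (hne u hu).1
  · rw [← Real.log_le_iff_le_exp h]
    have e : ∑ u, P' u * (Real.log (P' u) - Real.log 1 -
        Real.log (∏ i, W ((fun _ : Fin 1 => x₀) u.1 i) (u.2 i))) = -Real.log m := by
      have e' : -Real.log m = ∑ u, P' u * -Real.log m := by rw [← Finset.sum_mul, h1, one_mul]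
      rw [e']
      refine Finset.sum_congr rfl fun u _ => ?_
      by_cases hu : P' u = 0
      · simp [hu]
      · congr 1
        rw [hP', if_pos (hne u hu).1, Real.log_div (hne u hu).2.ne' h.ne', Real.log_one, wordProb]
        ring
    rw [e] at hle
    linarith

/-- The coupling comes from the probability of the orbit of `y`, the entropy and the polynomial
factor from the size of that orbit. -/
theorem exists_permOutput_le (hn : 0 < n) (W : X → ProbDist Y) (x₀ : Fin n → X) (y : Fin n → Y)
    (h : 0 < permOutput W x₀ y) :
    ∃ p ∈ jointSet (fun x => W x), fstMarginal p = emp x₀ ∧ sndMarginal p = emp y ∧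
      permOutput W x₀ y ≤ Real.exp (-(n * (condKL (fun x => W x) p + entropy (emp y))) +
        Fintype.card Y * (1 + Real.log (n + 1))) := by
  rw [permOutput_eq] at h ⊢
  have hs : (0 : ℝ) ≤ stabCard y / n.factorial := by positivity
  obtain ⟨p, hp, h1, h2, h3⟩ := exists_sum_wordProb_le hn W x₀ y (pos_of_mul_pos_right h hs)
  refine ⟨p, hp, h1, h2, ?_⟩
  refine (mul_le_mul (stabCard_div_factorial_le hn y) h3
    (Finset.sum_nonneg fun _ _ => wordProb_nonneg _ _ _) (Real.exp_pos _).le).trans_eq ?_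
  rw [← Real.exp_add]
  ring_nf

theorem prodDist_eq_exp {Q : ProbDist Y} {y : Fin n → Y} (h : 0 < prodDist Q n y) :
    prodDist Q n y = Real.exp (-(n * (klReal Q (emp y) + entropy (emp y)))) := by
  rw [prodDist, prod_apply_eq_exp y fun i => (Q.nonneg _).lt_of_ne'
    (Finset.prod_ne_zero_iff.1 h.ne' i (Finset.mem_univ i)), klReal]
  ring_nf

theorem permOutput_absCont {W : X → ProbDist Y} {Q : ProbDist Y} (hWQ : ∀ x, AbsCont (W x) Q)
    (x₀ : Fin n → X) : AbsCont (permOutput W x₀) (prodDist Q n) := by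
  intro y hy
  obtain ⟨i, -, hi⟩ := Finset.prod_eq_zero_iff.1 hy
  refine Finset.sum_eq_zero fun x _ => ?_
  rw [wordProb, Finset.prod_eq_zero (Finset.mem_univ i) (hWQ _ _ hi), mul_zero]

/-- With `D` the coupling's divergence, `D_Q` that of the output type from `Q`, and `H` the output
entropy, each word has exponent `-(1 + s)(D + H) + s (D_Q + H)`, which is `s η - H`. The factors
`exp (-n H)` sum to a polynomial. Of the constant `2 + s`, the part `1 + s` comes from the orbit
sizes and one from counting types. -/
theorem powSum_permOutput_le (hn : 0 < n) {W : X → ProbDist Y} {Q : ProbDist Y}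
    (hWQ : ∀ x, AbsCont (W x) Q) (x₀ : Fin n → X) {s : ℝ} (hs : 0 < s) {g : ℝ}
    (hg : ∀ p ∈ jointSet (fun x => W x), fstMarginal p = emp x₀ →
      (-1 / s - 1) * condKL (fun x => W x) p + klReal Q (sndMarginal p) ≤ g) :
    powSum (1 + s) (permOutput W x₀) (prodDist Q n) ≤
      Real.exp (n * (s * g) + (2 + s) * (Fintype.card Y * (1 + Real.log (n + 1)))) := by
  set κ := Fintype.card Y * (1 + Real.log (n + 1)) with hκ
  have hlog : 0 ≤ Real.log ((n : ℝ) + 1) := Real.log_nonneg (by linarith [n.cast_nonneg (α := ℝ)])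
  have h1 : ∀ y : Fin n → Y, permOutput W x₀ y ^ (1 + s) * prodDist Q n y ^ (1 - (1 + s)) ≤
      Real.exp (-(n * entropy (emp y))) * Real.exp (n * (s * g) + (1 + s) * κ) := by
    intro y
    rcases (permOutput_nonneg W x₀ y).eq_or_lt with h | h
    · rw [← h, Real.zero_rpow (by linarith), zero_mul]
      positivity
    · have hq : 0 < prodDist Q n y := (prodDist_nonneg Q.nonneg y).lt_of_ne fun h0 =>
        h.ne' (permOutput_absCont hWQ x₀ y h0.symm)
      obtain ⟨p, hp, hp1, hp2, hle⟩ := exists_permOutput_le hn W x₀ y h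
      have h2 := Real.rpow_le_rpow h.le hle (by linarith : 0 ≤ 1 + s)
      rw [← Real.exp_mul] at h2
      have h3 := hg p hp hp1
      rw [hp2] at h3
      rw [prodDist_eq_exp hq, ← Real.exp_mul, ← Real.exp_add]
      refine (mul_le_mul_of_nonneg_right h2 (Real.exp_pos _).le).trans ?_
      rw [← Real.exp_add, Real.exp_le_exp]
      have h4 := mul_le_mul_of_nonneg_left h3 (by positivity : 0 ≤ n * s)
      have e : n * s * ((-1 / s - 1) * condKL (fun x => W x) p + klReal Q (emp y)) =
          n * (s * klReal Q (emp y) - (1 + s) * condKL (fun x => W x) p) := by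
        field_simp
        ring
      rw [e] at h4
      rw [← hκ]
      linarith
  refine (Finset.sum_le_sum fun y _ => h1 y).trans ?_
  rw [← Finset.sum_mul]
  refine (mul_le_mul_of_nonneg_right sum_exp_neg_entropy_le (Real.exp_pos _).le).trans ?_
  have h2 : ((n : ℝ) + 1) ^ Fintype.card Y ≤ Real.exp κ := by
    rw [← Real.rpow_natCast, Real.rpow_def_of_pos (by positivity), Real.exp_le_exp, hκ]
    have : (0 : ℝ) ≤ Fintype.card Y := by positivity
    linarith
  refine (mul_le_mul_of_nonneg_right h2 (Real.exp_pos _).le).trans_eq ?_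
  rw [← Real.exp_add]
  ring_nf

theorem sum_wordProb_rpow (α : ℝ) (W : X → ProbDist Y) (Q : ProbDist Y) (x : Fin n → X) :
    ∑ y, wordProb W x y ^ α * prodDist Q n y ^ (1 - α) = ∏ i, powSum α (W (x i)) Q :=
  powSum_prod α (fun i y => (W (x i)).nonneg y) Q.nonneg

/-- Random coding bound for the orders `1 + s`. -/
theorem sum_codebook_powSum_le (hM : 0 < M) (hn : 0 < n) {W : X → ProbDist Y} {Q : ProbDist Y}
    (hWQ : ∀ x, AbsCont (W x) Q) (x₀ : Fin n → X) {s : ℝ} (hs : 0 < s) (hs1 : s ≤ 1) {g : ℝ}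
    (hg : ∀ p ∈ jointSet (fun x => W x), fstMarginal p = emp x₀ →
      (-1 / s - 1) * condKL (fun x => W x) p + klReal Q (sndMarginal p) ≤ g) :
    ∑ c : Fin M → Fin n → X, (∏ m, permDist x₀ (c m)) *
        powSum (1 + s) (outputDist W c) (prodDist Q n) ≤
      Real.exp (n * (∑ x, emp x₀ x * Real.log (powSum (1 + s) (W x) Q)) - s * Real.log M) +
      Real.exp (n * (s * g) + (2 + s) * (Fintype.card Y * (1 + Real.log (n + 1)))) := by
  have hM' : (0 : ℝ) < M := by exact_mod_cast hM
  have h1 : ∑ c : Fin M → Fin n → X, (∏ m, permDist x₀ (c m)) *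
        powSum (1 + s) (outputDist W c) (prodDist Q n) =
      ∑ y : Fin n → Y, (∑ c : Fin M → Fin n → X, (∏ m, permDist x₀ (c m)) *
        outputDist W c y ^ (1 + s)) * prodDist Q n y ^ (1 - (1 + s)) := by
    simp only [powSum, Finset.mul_sum, Finset.sum_mul]
    rw [Finset.sum_comm]
    simp only [mul_assoc]
  have h2 : ∀ y, (∑ c : Fin M → Fin n → X, (∏ m, permDist x₀ (c m)) *
        outputDist W c y ^ (1 + s)) * prodDist Q n y ^ (1 - (1 + s)) ≤
      (M : ℝ) ^ (-s) * ∑ x, permDist x₀ x *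
        (wordProb W x y ^ (1 + s) * prodDist Q n y ^ (1 - (1 + s))) +
      permOutput W x₀ y ^ (1 + s) * prodDist Q n y ^ (1 - (1 + s)) := by
    intro y
    have := sum_prod_mul_rpow_le hM (permDist x₀).nonneg (permDist x₀).sum_eq_one
      (w := fun x => wordProb W x y) (fun x => wordProb_nonneg W x y) hs hs1
    have := mul_le_mul_of_nonneg_right this
      (Real.rpow_nonneg (prodDist_nonneg Q.nonneg y) (1 - (1 + s)))
    refine this.trans_eq ?_
    rw [add_mul, mul_assoc, Finset.sum_mul]
    simp only [mul_assoc]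
    rfl
  rw [h1]
  refine (Finset.sum_le_sum fun y _ => h2 y).trans ?_
  rw [Finset.sum_add_distrib]
  refine add_le_add (le_of_eq ?_) (powSum_permOutput_le hn hWQ x₀ hs hg)
  rw [← Finset.mul_sum, Finset.sum_comm]
  -- For a single codeword the power sum factorizes over positions, so every rearrangement gives the
  -- same value.
  simp only [← Finset.mul_sum, sum_wordProb_rpow]
  rw [sum_permDist_mul]
  have h3 : ∀ σ : Equiv.Perm (Fin n), ∏ i, powSum (1 + s) (W ((x₀ ∘ σ) i)) Q =
      ∏ i, powSum (1 + s) (W (x₀ i)) Q := fun σ =>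
    Equiv.prod_comp σ fun i => powSum (1 + s) (W (x₀ i)) Q
  simp only [h3, Finset.sum_const, Finset.card_univ, Fintype.card_perm, Fintype.card_fin,
    nsmul_eq_mul]
  rw [inv_mul_cancel_left₀ (by positivity), prod_apply_eq_exp x₀
    (φ := fun x => powSum (1 + s) (W x) Q) fun i =>
      powSum_pos (W _).nonneg (W _).sum_eq_one Q.nonneg (hWQ _) _,
    Real.rpow_def_of_pos hM', ← Real.exp_add]
  ring_nf

theorem fstMarginal_emp (z : Fin n → X × Y) : fstMarginal (emp z) = emp (Prod.fst ∘ z) := by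
  classical
  ext x
  rw [fstMarginal_eq_sum_ite]
  exact (emp_comp Prod.fst z x).symm

theorem sndMarginal_emp (z : Fin n → X × Y) : sndMarginal (emp z) = emp (Prod.snd ∘ z) := by
  classical
  ext x
  rw [sndMarginal_eq_sum_ite]
  exact (emp_comp Prod.snd z x).symm

/-- Random coding bound for the orders `1 - s`. -/
theorem neg_log_sum_codebook_powSum_le (hM : 0 < M) (hn : 0 < n) {W : X → ProbDist Y}
    {Q : ProbDist Y} (z : Fin n → X × Y) (hzW : ∀ i, 0 < W (z i).1 (z i).2)
    (hzQ : ∀ i, 0 < Q (z i).2) {s : ℝ} (hs : 0 < s) (hs1 : s < 1) {g : ℝ}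
    (hg : ∀ p ∈ jointSet (fun x => W x), fstMarginal p = fstMarginal (emp z) →
      sndMarginal p = sndMarginal (emp z) → g ≤ condKL (fun x => W x) p) :
    0 < ∑ c : Fin M → Fin n → X, (∏ m, permDist (Prod.fst ∘ z) (c m)) *
        powSum (1 - s) (outputDist W c) (prodDist Q n) ∧
    -(1 / s) * Real.log (∑ c : Fin M → Fin n → X, (∏ m, permDist (Prod.fst ∘ z) (c m)) *
        powSum (1 - s) (outputDist W c) (prodDist Q n)) ≤
      max (n * ((1 / s - 1) * condKL (fun x => W x) (emp z) + condKL (fun _ : X => Q) (emp z)) -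
          Real.log M)
        (n * ((1 / s) * condKL (fun x => W x) (emp z) + klReal Q (sndMarginal (emp z)) - g)) +
      ((1 / s) * (Fintype.card (X × Y) * (1 + Real.log (n + 1))) +
        (Fintype.card Y * (1 + Real.log (n + 1)) + Real.log 2)) := by
  classical
  have hM' : (0 : ℝ) < M := by exact_mod_cast hM
  set x₀ : Fin n → X := Prod.fst ∘ z with hx₀
  set y₀ : Fin n → Y := Prod.snd ∘ z with hy₀
  set E := ∑ c : Fin M → Fin n → X, (∏ m, permDist x₀ (c m)) *
        powSum (1 - s) (outputDist W c) (prodDist Q n) with hE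
  obtain ⟨f, hf⟩ : ∃ f : (Fin n → X) → (Fin n → Y) → ℝ, ∀ x y, f x y = wordProb W x y *
      ((M : ℝ)⁻¹ * wordProb W x y + permOutput W x₀ y) ^ (-s) * prodDist Q n y ^ (1 - (1 - s)) :=
    ⟨_, fun _ _ => rfl⟩
  have hf0 : ∀ x y, 0 ≤ f x y := fun x y => by
    rw [hf]
    exact mul_nonneg (mul_nonneg (wordProb_nonneg W x y) (Real.rpow_nonneg (add_nonneg
      (mul_nonneg (by positivity) (wordProb_nonneg W x y)) (permOutput_nonneg W x₀ y)) _))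
      (Real.rpow_nonneg (prodDist_nonneg Q.nonneg y) _)
  have h1 : ∑ x, permDist x₀ x * ∑ y, f x y ≤ E := by
    have e : E = ∑ y : Fin n → Y, (∑ c : Fin M → Fin n → X, (∏ m, permDist x₀ (c m)) *
        outputDist W c y ^ (1 - s)) * prodDist Q n y ^ (1 - (1 - s)) := by
      rw [hE]
      simp only [powSum, Finset.mul_sum, Finset.sum_mul]
      rw [Finset.sum_comm]
      simp only [mul_assoc]
    rw [e]
    simp only [Finset.mul_sum]
    rw [Finset.sum_comm]
    refine Finset.sum_le_sum fun y _ => ?_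
    have := le_sum_prod_mul_rpow hM (permDist x₀).nonneg (permDist x₀).sum_eq_one
      (w := fun x => wordProb W x y) (fun x => wordProb_nonneg W x y) hs hs1
    have := mul_le_mul_of_nonneg_right this
      (Real.rpow_nonneg (prodDist_nonneg Q.nonneg y) (1 - (1 - s)))
    refine le_trans (le_of_eq ?_) this
    rw [Finset.sum_mul]
    refine Finset.sum_congr rfl fun x _ => ?_
    rw [hf, permOutput]
    ring
  -- All pairs of words of the joint type of `z` contribute equally; of the whole double sum only
  -- these pairs are kept.
  have hfz : ∀ z' ∈ rearrangements z, f (Prod.fst ∘ z') (Prod.snd ∘ z') = f x₀ y₀ := by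
    intro z' hz'
    obtain ⟨σ, rfl⟩ := mem_rearrangements.1 hz'
    have e1 : Prod.fst ∘ z ∘ σ = x₀ ∘ σ := rfl
    have e2 : Prod.snd ∘ z ∘ σ = y₀ ∘ σ := rfl
    have e3 : prodDist Q n (y₀ ∘ σ) = prodDist Q n y₀ := Equiv.prod_comp σ fun i => Q (y₀ i)
    rw [e1, e2, hf, hf, wordProb_comp_perm, permOutput_comp_perm, e3]
  have h2 : (rearrangements z).card * f x₀ y₀ ≤ ∑ x ∈ rearrangements x₀, ∑ y, f x y := by
    rw [← nsmul_eq_mul, ← Finset.sum_eq_card_nsmul hfz,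
      ← Finset.sum_product' (rearrangements x₀) Finset.univ f]
    have hinj : Set.InjOn (fun z' : Fin n → X × Y => (Prod.fst ∘ z', Prod.snd ∘ z'))
        (rearrangements z : Set (Fin n → X × Y)) := by
      intro z₁ _ z₂ _ h
      rw [Prod.mk.injEq] at h
      ext i
      · exact congrFun h.1 i
      · exact congrFun h.2 i
    rw [← Finset.sum_image (f := fun u : (Fin n → X) × (Fin n → Y) => f u.1 u.2) hinj]
    refine Finset.sum_le_sum_of_subset_of_nonneg ?_ fun u _ _ => hf0 _ _
    intro u hu
    obtain ⟨z', hz', rfl⟩ := Finset.mem_image.1 hu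
    obtain ⟨σ, rfl⟩ := mem_rearrangements.1 hz'
    exact Finset.mem_product.2 ⟨mem_rearrangements.2 ⟨σ, rfl⟩, Finset.mem_univ _⟩
  have hfac : (0 : ℝ) < n.factorial := by positivity
  have hsx : (0 : ℝ) < stabCard x₀ := by exact_mod_cast stabCard_pos x₀
  have hsz : (0 : ℝ) < stabCard z := by exact_mod_cast stabCard_pos z
  have hf1 : ∑ x, permDist x₀ x * ∑ y, f x y =
      stabCard x₀ / n.factorial * ∑ x ∈ rearrangements x₀, ∑ y, f x y := by
    rw [sum_permDist_mul x₀ fun x => ∑ y, f x y, sum_perm_eq x₀ fun x => ∑ y, f x y]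
    ring
  have hcard : ((rearrangements z).card : ℝ) = n.factorial / stabCard z := by
    rw [factorial_eq_stabCard_mul_card z, mul_div_cancel_left₀ _ hsz.ne']
  have h3 : stabCard x₀ / n.factorial * (n.factorial / stabCard z * f x₀ y₀) ≤ E := by
    refine le_trans ?_ h1
    rw [hf1, ← hcard]
    exact mul_le_mul_of_nonneg_left h2 (by positivity)
  have hw : 0 < wordProb W x₀ y₀ := Finset.prod_pos fun i _ => hzW i
  have hq : 0 < prodDist Q n y₀ := Finset.prod_pos fun i _ => hzQ i
  have hPb0 := permOutput_nonneg W x₀ y₀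
  have hmix : 0 < (M : ℝ)⁻¹ * wordProb W x₀ y₀ + permOutput W x₀ y₀ := by positivity
  have hfpos : 0 < f x₀ y₀ := by
    rw [hf]
    exact mul_pos (mul_pos hw (Real.rpow_pos_of_pos hmix _)) (Real.rpow_pos_of_pos hq _)
  have hEpos : 0 < E := lt_of_lt_of_le (by positivity) h3
  refine ⟨hEpos, ?_⟩
  set a := n * entropy (fstMarginal (emp z)) with ha
  set b := n * entropy (sndMarginal (emp z)) with hb
  set e := n * entropy (emp z) with he
  set ω := n * ∑ u, emp z u * Real.log (W u.1 u.2) with hω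
  set κ₁ := Fintype.card (X × Y) * (1 + Real.log (n + 1)) with hκ₁
  set κ₂ := Fintype.card Y * (1 + Real.log (n + 1)) with hκ₂
  set d := n * klReal Q (sndMarginal (emp z)) with hd
  have hlogw : Real.log (wordProb W x₀ y₀) = ω := by
    have : wordProb W x₀ y₀ = Real.exp ω := prod_apply_eq_exp z (φ := fun u => W u.1 u.2) hzW
    rw [this, Real.log_exp]
  have hlogq : Real.log (prodDist Q n y₀) = -(d + b) := by
    rw [prodDist_eq_exp hq, Real.log_exp, hd, hb, sndMarginal_emp, ← hy₀]
    ring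
  have hlx : -a ≤ Real.log (stabCard x₀ / n.factorial) := by
    have := factorial_div_stabCard_le hn x₀
    rw [← Real.log_le_iff_le_exp (by positivity)] at this
    rw [← inv_div, Real.log_inv, ha, fstMarginal_emp]
    linarith
  have hlz : e - κ₁ ≤ Real.log (n.factorial / stabCard z) := by
    have := stabCard_div_factorial_le hn z
    rw [← Real.log_le_iff_le_exp (by positivity)] at this
    rw [← inv_div, Real.log_inv]
    linarith
  -- Every coupling with the marginals of `z` costs at least `g`, which bounds the averaged output
  -- mass.
  have hPb : permOutput W x₀ y₀ ≤ Real.exp (-(n * g + b) + κ₂) := by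
    rcases hPb0.eq_or_lt with h | h
    · rw [← h]
      positivity
    · obtain ⟨p, hp, hp1, hp2, hle⟩ := exists_permOutput_le hn W x₀ y₀ h
      refine hle.trans (Real.exp_le_exp.2 ?_)
      have := hg p hp (hp1.trans (fstMarginal_emp z).symm) (hp2.trans (sndMarginal_emp z).symm)
      have := mul_le_mul_of_nonneg_left this (n.cast_nonneg : (0 : ℝ) ≤ n)
      rw [hb, sndMarginal_emp, ← hy₀, ← hκ₂]
      linarith
  -- The larger of the two parts of the conditional mean determines the exponent; this is the origin
  -- of the maximum.
  have hlmix : Real.log ((M : ℝ)⁻¹ * wordProb W x₀ y₀ + permOutput W x₀ y₀) ≤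
      Real.log 2 + max (ω - Real.log M) (-(n * g + b) + κ₂) := by
    rw [Real.log_le_iff_le_exp hmix, Real.exp_add, Real.exp_log two_pos, two_mul]
    refine add_le_add ?_ (hPb.trans (Real.exp_le_exp.2 (le_max_right _ _)))
    refine le_trans (le_of_eq ?_) (Real.exp_le_exp.2 (le_max_left _ _))
    rw [← hlogw, Real.exp_sub, Real.exp_log hw, Real.exp_log hM', inv_mul_eq_div]
  have hlogE := Real.log_le_log (by positivity) h3
  rw [Real.log_mul (by positivity) (by positivity), Real.log_mul (by positivity) hfpos.ne', hf,
    Real.log_mul (mul_pos hw (Real.rpow_pos_of_pos hmix _)).ne' (Real.rpow_pos_of_pos hq _).ne',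
    Real.log_mul hw.ne' (Real.rpow_pos_of_pos hmix _).ne', Real.log_rpow hmix, Real.log_rpow hq,
    hlogw, hlogq] at hlogE
  have hcW : n * condKL (fun x => W x) (emp z) = a - e - ω := by
    rw [condKL]
    ring
  have hcQ : n * condKL (fun _ : X => Q) (emp z) = a - e + (d + b) := by
    rw [condKL, hd, hb, klReal, sum_sndMarginal_mul (emp z) fun y => Real.log (Q y)]
    ring
  have hκ₂0 : 0 ≤ κ₂ := by
    have : 0 ≤ Real.log ((n : ℝ) + 1) := Real.log_nonneg (by linarith [n.cast_nonneg (α := ℝ)])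
    positivity
  have h4 : -(1 / s) * Real.log E ≤ (1 / s) * (a - e - ω) + (1 / s) * κ₁ + (d + b) +
      (Real.log 2 + max (ω - Real.log M) (-(n * g + b) + κ₂)) := by
    have h5 : -Real.log E ≤ (a - e - ω) + κ₁ + s * (d + b) +
        s * (Real.log 2 + max (ω - Real.log M) (-(n * g + b) + κ₂)) := by
      have := mul_le_mul_of_nonneg_left hlmix hs.le
      linarith
    have h6 := mul_le_mul_of_nonneg_left h5 (by positivity : 0 ≤ 1 / s)
    have h7 : 1 / s * s = 1 := by field_simp
    calc _ = 1 / s * -Real.log E := by ring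
      _ ≤ _ := h6
      _ = (1 / s) * (a - e - ω) + (1 / s) * κ₁ + (1 / s * s) * (d + b) +
        (1 / s * s) * (Real.log 2 + max (ω - Real.log M) (-(n * g + b) + κ₂)) := by ring
      _ = _ := by rw [h7]; ring
  refine h4.trans ?_
  have e1 : n * ((1 / s - 1) * condKL (fun x => W x) (emp z) + condKL (fun _ : X => Q) (emp z)) -
      Real.log M = (1 / s) * (a - e - ω) + (d + b) + (ω - Real.log M) := by
    calc _ = (1 / s - 1) * (n * condKL (fun x => W x) (emp z)) +
          n * condKL (fun _ : X => Q) (emp z) - Real.log M := by ring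
      _ = _ := by rw [hcW, hcQ]; ring
  have e2 : n * ((1 / s) * condKL (fun x => W x) (emp z) + klReal Q (sndMarginal (emp z)) - g) =
      (1 / s) * (a - e - ω) + (d + b) + (-(n * g + b)) := by
    calc _ = (1 / s) * (n * condKL (fun x => W x) (emp z)) +
          n * klReal Q (sndMarginal (emp z)) - n * g := by ring
      _ = _ := by rw [hcW, ← hd]; ring
  rw [e1, e2, max_add_add_left]
  have h8 : max (ω - Real.log M) (-(n * g + b) + κ₂) ≤
      max (ω - Real.log M) (-(n * g + b)) + κ₂ :=
    max_le (by linarith [le_max_left (ω - Real.log M) (-(n * g + b))])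
      (by linarith [le_max_right (ω - Real.log M) (-(n * g + b))])
  linarith

end ConstantComposition

/-! ### Approximation by empirical distributions -/

section Approximation

variable {A : Type*} [Fintype A]

theorem exists_word_letterCount {n : ℕ} {k : A → ℕ} (hk : ∑ a, k a = n) :
    ∃ z : Fin n → A, ∀ a, letterCount z a = k a := by
  classical
  have e : Fin n ≃ Σ a, Fin (k a) := Fintype.equivOfCardEq (by simp [hk])
  refine ⟨fun i => (e i).1, fun a => ?_⟩
  have h : (letterCount (fun i => (e i).1) a : ℝ) = k a := by
    rw [letterCount_eq_sum, e.sum_comp fun u => if u.1 = a then (1 : ℝ) else 0,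
      Fintype.sum_sigma, Finset.sum_eq_single a]
    · simp
    · intro b _ hb
      simp [hb]
    · simp
  exact_mod_cast h

/-- Every distribution is a limit of empirical distributions of words over its support. -/
theorem exists_words_tendsto_emp {q : A → ℝ} (hq : q ∈ stdSimplex ℝ A) :
    ∃ z : ∀ n : ℕ, Fin n → A, (∀ n i, 0 < q (z n i)) ∧
      Tendsto (fun n => emp (z n)) atTop (𝓝 q) := by
  classical
  obtain ⟨a₀, ha₀⟩ : ∃ a, 0 < q a := by
    by_contra! h
    have : ∑ i, q i = 0 := Finset.sum_eq_zero fun i _ => le_antisymm (h i) (hq.1 i)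
    linarith [hq.2]
  have hsum : ∀ n : ℕ, ∑ a ∈ Finset.univ.erase a₀, ⌊q a * n⌋₊ ≤ n := by
    intro n
    have h1 : ∑ a ∈ Finset.univ.erase a₀, (⌊q a * n⌋₊ : ℝ) ≤ n := by
      calc _ ≤ ∑ a ∈ Finset.univ.erase a₀, q a * n :=
            Finset.sum_le_sum fun a _ => Nat.floor_le (mul_nonneg (hq.1 a) n.cast_nonneg)
        _ ≤ ∑ a, q a * n :=
            Finset.sum_le_sum_of_subset_of_nonneg (Finset.erase_subset _ _) fun a _ _ =>
              mul_nonneg (hq.1 a) n.cast_nonneg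
        _ = n := by rw [← Finset.sum_mul, hq.2, one_mul]
    exact_mod_cast h1
  -- All counts are rounded down and `a₀` takes the remainder. As `a₀` lies in the support, so does
  -- the whole word.
  let k : ℕ → A → ℕ := fun n a =>
    if a = a₀ then n - ∑ a ∈ Finset.univ.erase a₀, ⌊q a * n⌋₊ else ⌊q a * n⌋₊
  have hk : ∀ n, ∑ a, k n a = n := by
    intro n
    rw [← Finset.add_sum_erase _ _ (Finset.mem_univ a₀)]
    have : ∑ a ∈ Finset.univ.erase a₀, k n a = ∑ a ∈ Finset.univ.erase a₀, ⌊q a * n⌋₊ :=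
      Finset.sum_congr rfl fun a ha => if_neg (Finset.ne_of_mem_erase ha)
    rw [this]
    simp only [k, if_true]
    have := hsum n
    omega
  choose z hz using fun n => exists_word_letterCount (hk n)
  refine ⟨z, fun n i => ?_, ?_⟩
  · have h := letterCount_pos (z n) i
    rw [hz] at h
    by_cases h0 : z n i = a₀
    · rwa [h0]
    · simp only [k, if_neg h0] at h
      refine (hq.1 _).lt_of_ne fun h1 => ?_
      rw [← h1] at h
      simp at h
  · have hne : ∀ a, a ≠ a₀ → Tendsto (fun n => emp (z n) a) atTop (𝓝 (q a)) := by
      intro a ha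
      have := (tendsto_nat_floor_mul_div_atTop (hq.1 a)).comp
        (tendsto_natCast_atTop_atTop (R := ℝ))
      refine this.congr fun n => ?_
      simp only [Function.comp, emp, hz, k, if_neg ha]
    rw [tendsto_pi_nhds]
    intro a
    by_cases ha : a = a₀
    · subst ha
      have h1 : Tendsto (fun n => 1 - ∑ b ∈ Finset.univ.erase a, emp (z n) b) atTop
          (𝓝 (1 - ∑ b ∈ Finset.univ.erase a, q b)) :=
        tendsto_const_nhds.sub (tendsto_finsetSum _ fun b hb => hne b (Finset.ne_of_mem_erase hb))
      have h2 : 1 - ∑ b ∈ Finset.univ.erase a, q b = q a := by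
        rw [← hq.2, ← Finset.add_sum_erase _ _ (Finset.mem_univ a)]
        ring
      rw [h2] at h1
      refine h1.congr' ?_
      filter_upwards [eventually_gt_atTop 0] with n hn
      rw [← sum_emp hn (z n), ← Finset.add_sum_erase _ _ (Finset.mem_univ a)]
      ring
    · exact hne a ha

end Approximation

/-! ### The single-letter expression for the orders `1 + s` -/

section Plus

variable {X Y : Type*} [Fintype X] [Fintype Y] {W : X → ProbDist Y} {Q : ProbDist Y} {s R : ℝ}

theorem EReal.coe_max' (a b : ℝ) : ((max a b : ℝ) : EReal) = max (a : EReal) b :=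
  EReal.coe_strictMono.monotone.map_max

/-- The exponent `η` as a function of the joint distribution. -/
noncomputable def etaReal (s : ℝ) (W : X → ProbDist Y) (Q : ProbDist Y) (p : X × Y → ℝ) : ℝ :=
  (-1 / s - 1) * condKL (fun x => W x) p + klReal Q (sndMarginal p)

theorem continuous_etaReal (s : ℝ) (W : X → ProbDist Y) (Q : ProbDist Y) :
    Continuous (etaReal s W Q) :=
  (continuous_const.mul (continuous_condKL _)).add
    ((continuous_klReal _).comp continuous_sndMarginal)

/-- The channels over which `η` is maximized. -/
def etaSet (s : ℝ) (W : X → ProbDist Y) : Set (X → ProbDist Y) :=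
  {V | (∀ x, AbsCont (V x) (W x)) ∧ (s = 0 → V = W)}

theorem mem_etaSet (s : ℝ) (W : X → ProbDist Y) : W ∈ etaSet s W :=
  ⟨fun _ _ h => h, fun _ => rfl⟩

theorem isCompact_etaSet (s : ℝ) (W : X → ProbDist Y) : IsCompact (etaSet s W) := by
  refine IsClosed.isCompact ?_
  have e : etaSet s W = {V | ∀ x, AbsCont (V x) (W x)} ∩ {V | s = 0 → V = W} := rfl
  rw [e]
  refine IsClosed.inter ?_ ?_
  · simp only [AbsCont, Set.ofPred_forall]
    refine isClosed_iInter fun x => isClosed_iInter fun y => isClosed_iInter fun _ =>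
      isClosed_eq ?_ continuous_const
    exact (continuous_apply y).comp (continuous_subtype_val.comp (continuous_apply x))
  · simp only [Set.ofPred_forall]
    exact isClosed_iInter fun _ => isClosed_eq continuous_id continuous_const

/-- The supremum of `η` over the channels. -/
noncomputable def etaSup (s : ℝ) (W : X → ProbDist Y) (Q : ProbDist Y) (a : ProbDist X) : ℝ :=
  sSup ((fun V => etaReal s W Q (jointDist a V)) '' etaSet s W)

/-- The maximum runs over a compact set of channels that does not depend on `a`. Joint distributions
with first marginal `a` would give a moving constraint set. -/
theorem continuous_etaSup (s : ℝ) (W : X → ProbDist Y) (Q : ProbDist Y) :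
    Continuous (etaSup s W Q) :=
  (isCompact_etaSet s W).continuous_sSup
    (f := fun a V => etaReal s W Q (jointDist a V))
    ((continuous_etaReal s W Q).comp continuous_jointDist)

theorem etaSup_isGreatest (s : ℝ) (W : X → ProbDist Y) (Q : ProbDist Y) (a : ProbDist X) :
    IsGreatest ((fun V => etaReal s W Q (jointDist a V)) '' etaSet s W) (etaSup s W Q a) := by
  refine IsCompact.isGreatest_sSup ?_ ⟨_, W, mem_etaSet s W, rfl⟩
  exact (isCompact_etaSet s W).image ((continuous_etaReal s W Q).comp
    (continuous_jointDist.comp (continuous_const.prodMk continuous_id)))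

theorem etaReal_le_etaSup (a : ProbDist X) {V : X → ProbDist Y} (hV : V ∈ etaSet s W) :
    etaReal s W Q (jointDist a V) ≤ etaSup s W Q a :=
  (etaSup_isGreatest s W Q a).2 ⟨V, hV, rfl⟩

theorem etaReal_le_etaSup_of_mem (hs : s ≠ 0) {p : X × Y → ℝ} (hp : p ∈ jointSet fun x => W x)
    {a : ProbDist X} (ha : fstMarginal p = a) : etaReal s W Q p ≤ etaSup s W Q a := by
  obtain ⟨a', V, rfl, hV⟩ := exists_jointDist_eq W hp.1
  rw [fstMarginal_jointDist] at ha
  have : a' = a := Subtype.ext ha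
  subst this
  exact etaReal_le_etaSup _ ⟨absCont_of_jointDist_mem hp hV, fun h => absurd h hs⟩

/-- The equality case of Gibbs' inequality. It handles `s = 0`, where zero conditional divergence
must force the joint law of `a` and `W`. -/
theorem eq_of_sum_mul_log_eq {A : Type*} [Fintype A] {p r : A → ℝ} (hp : ∀ i, 0 ≤ p i)
    (hr : ∀ i, 0 ≤ r i) (hpr : ∀ i, 0 < p i → 0 < r i) (hs : ∑ i, r i ≤ ∑ i, p i)
    (he : ∑ i, p i * (Real.log (p i) - Real.log (r i)) ≤ 0) : p = r := by
  have key : ∀ i, 0 ≤ p i * (Real.log (p i) - Real.log (r i)) + (r i - p i) ∧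
      (p i * (Real.log (p i) - Real.log (r i)) + (r i - p i) = 0 → p i = r i) := fun i => by
    rcases (hp i).eq_or_lt with h | h
    · rw [← h]
      simp only [zero_mul, sub_zero, zero_add]
      exact ⟨hr i, fun h' => h'.symm⟩
    · have e : p i * (r i / p i - 1) = r i - p i := by field_simp
      have el := Real.log_div (hpr i h).ne' h.ne'
      refine ⟨?_, fun h0 => ?_⟩
      · have h1 := Real.log_le_sub_one_of_pos (div_pos (hpr i h) h)
        have := mul_le_mul_of_nonneg_left h1 h.le
        rw [el] at this
        linarith
      · by_contra hne
        have h1 := Real.log_lt_sub_one_of_pos (div_pos (hpr i h) h) fun h2 =>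
          hne ((div_eq_one_iff_eq h.ne').1 h2).symm
        have := mul_lt_mul_of_pos_left h1 h
        rw [el] at this
        linarith
  have hz : ∑ i, (p i * (Real.log (p i) - Real.log (r i)) + (r i - p i)) = 0 := by
    refine le_antisymm ?_ (Finset.sum_nonneg fun i _ => (key i).1)
    rw [Finset.sum_add_distrib, Finset.sum_sub_distrib]
    linarith
  ext i
  exact (key i).2 ((Finset.sum_eq_zero_iff_of_nonneg fun i _ => (key i).1).1 hz i
    (Finset.mem_univ i))

theorem condKL_jointDist_eq_sum {V W : X → ProbDist Y} {a : ProbDist X}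
    (h : jointDist a V ∈ jointSet fun x => W x) :
    condKL (fun x => W x) (jointDist a V) =
      ∑ z, jointDist a V z * (Real.log (jointDist a V z) - Real.log (jointDist a W z)) := by
  rw [condKL_eq_sum, fstMarginal_jointDist]
  refine Finset.sum_congr rfl fun z _ => ?_
  by_cases hz : jointDist a V z = 0
  · simp [hz]
  · have hW : W z.1 z.2 ≠ 0 := fun h0 => hz (h.2 _ _ h0)
    have : Real.log (jointDist a W z) = Real.log (a z.1) + Real.log (W z.1 z.2) :=
      Real.log_mul (left_ne_zero_of_mul hz) hW
    rw [this]
    ring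

theorem jointDist_pos_of_mem {V W : X → ProbDist Y} {a : ProbDist X}
    (h : jointDist a V ∈ jointSet fun x => W x) {z : X × Y} (hz : 0 < jointDist a V z) :
    0 < jointDist a W z := by
  have hW : W z.1 z.2 ≠ 0 := fun h0 => hz.ne' (h.2 _ _ h0)
  exact mul_pos ((a.nonneg _).lt_of_ne' (left_ne_zero_of_mul hz.ne'))
    (((W _).nonneg _).lt_of_ne' hW)

theorem condKL_jointDist_nonneg {V W : X → ProbDist Y} {a : ProbDist X}
    (h : jointDist a V ∈ jointSet fun x => W x) :
    0 ≤ condKL (fun x => W x) (jointDist a V) := by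
  have := sum_mul_log_le_sum_mul_log_self (jointDist_mem a V).1 (jointDist_mem a W).1
    (fun z hz => jointDist_pos_of_mem h hz) (by rw [(jointDist_mem a V).2, (jointDist_mem a W).2])
  rw [condKL_jointDist_eq_sum h]
  simp only [mul_sub, Finset.sum_sub_distrib]
  linarith

theorem condKL_jointDist_self (W : X → ProbDist Y) (a : ProbDist X) :
    condKL (fun x => W x) (jointDist a W) = 0 := by
  rw [condKL_jointDist_eq_sum (jointDist_mem_of_absCont a fun _ _ h => h)]
  simp

theorem jointSet_subset_of_absCont (hWQ : ∀ x, AbsCont (W x) Q) {p : X × Y → ℝ}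
    (hp : p ∈ jointSet fun x => W x) : p ∈ jointSet fun _ : X => Q :=
  ⟨hp.1, fun x y h => hp.2 x y (hWQ x y h)⟩

theorem eta_le_etaSup (hWQ : ∀ x, AbsCont (W x) Q) (hs : 0 ≤ s) (a : ProbDist X)
    (V : X → ProbDist Y) : eta s W Q a V ≤ (etaSup s W Q a : EReal) := by
  unfold eta
  by_cases hV : jointDist a V ∈ jointSet fun x => W x
  · have hQ := jointSet_subset_of_absCont hWQ hV
    rw [condRelEntropy_eq_coe hV, relEntropy_outMarginal_eq_coe hQ]
    by_cases h0 : s = 0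
    · rw [if_pos h0]
      rcases (condKL_jointDist_nonneg hV).eq_or_lt with h | h
      · have hVW : jointDist a V = jointDist a W := by
          refine eq_of_sum_mul_log_eq (jointDist_mem a V).1 (jointDist_mem a W).1
            (fun z hz => jointDist_pos_of_mem hV hz)
            (by rw [(jointDist_mem a V).2, (jointDist_mem a W).2]) ?_
          rw [← condKL_jointDist_eq_sum hV, ← h]
        have := etaReal_le_etaSup (Q := Q) a (mem_etaSet s W)
        rw [etaReal, condKL_jointDist_self, mul_zero, zero_add] at this
        rw [← h, hVW]
        simpa using this
      · rw [EReal.bot_mul_coe_of_pos h, EReal.bot_add]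
        exact bot_le
    · rw [if_neg h0, ← EReal.coe_mul, ← EReal.coe_add, EReal.coe_le_coe_iff]
      exact etaReal_le_etaSup_of_mem h0 hV (fstMarginal_jointDist a V)
  · rw [condRelEntropy_eq_top hV]
    have : (if s = 0 then ⊥ else ((-1 / s - 1 : ℝ) : EReal)) * ⊤ = ⊥ := by
      split_ifs with h0
      · exact EReal.bot_mul_top
      · refine EReal.coe_mul_top_of_neg ?_
        have : 0 < 1 / s := one_div_pos.2 (hs.lt_of_ne' h0)
        rw [neg_div]
        linarith
    rw [this, EReal.bot_add]
    exact bot_le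

theorem eta_eq_coe (hWQ : ∀ x, AbsCont (W x) Q) (a : ProbDist X)
    {V : X → ProbDist Y} (hV : V ∈ etaSet s W) :
    eta s W Q a V = (etaReal s W Q (jointDist a V) : EReal) := by
  have h := jointDist_mem_of_absCont a hV.1
  rw [eta, condRelEntropy_eq_coe h, relEntropy_outMarginal_eq_coe (jointSet_subset_of_absCont hWQ h),
    etaReal]
  by_cases h0 : s = 0
  · rw [hV.2 h0, condKL_jointDist_self]
    simp
  · rw [if_neg h0, ← EReal.coe_mul, ← EReal.coe_add]

theorem exists_eta_eq (hWQ : ∀ x, AbsCont (W x) Q) (a : ProbDist X) :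
    ∃ V, eta s W Q a V = (etaSup s W Q a : EReal) := by
  obtain ⟨V, hV, h⟩ := (etaSup_isGreatest s W Q a).1
  exact ⟨V, by rw [eta_eq_coe hWQ a hV, ← h]⟩

theorem iSup_eta (hWQ : ∀ x, AbsCont (W x) Q) (hs : 0 ≤ s) (a : ProbDist X) :
    ⨆ V, eta s W Q a V = (etaSup s W Q a : EReal) := by
  obtain ⟨V, hV⟩ := exists_eta_eq hWQ a
  exact le_antisymm (iSup_le fun V => eta_le_etaSup hWQ hs a V) (hV ▸ le_iSup _ V)

open Classical in
/-- The Rényi divergence of order `1 + s` of an output distribution. -/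
noncomputable def rateReal (s : ℝ) (W : X → ProbDist Y) (Q : ProbDist Y) (x : X) : ℝ :=
  if s = 0 then klReal Q (W x) else s⁻¹ * Real.log (powSum (1 + s) (W x) Q)

theorem renyiDiv_eq_rateReal (hWQ : ∀ x, AbsCont (W x) Q) (hs : 0 ≤ s) (x : X) :
    renyiDiv (1 + s) (W x) Q = (rateReal s W Q x : EReal) := by
  unfold rateReal
  split_ifs with h0
  · rw [h0, add_zero, renyiDiv, if_pos rfl, relEntropy_eq_coe (hWQ x)]
  · rw [renyiDiv_eq_coe (by linarith) (by simpa using h0) (W x).nonneg Q.nonneg (Or.inr (hWQ x))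
      (powSum_pos (W x).nonneg (W x).sum_eq_one Q.nonneg (hWQ x) _), add_sub_cancel_left]

/-- The real-valued objective for the orders `1 + s`. -/
noncomputable def plusReal (s : ℝ) (W : X → ProbDist Y) (Q : ProbDist Y) (R : ℝ) (a : ProbDist X) : ℝ :=
  max (∑ x, a x * rateReal s W Q x - R) (etaSup s W Q a)

theorem continuous_sum_mul (φ : X → ℝ) : Continuous fun a : ProbDist X => ∑ x, a x * φ x :=
  continuous_finsetSum _ fun x _ =>
    ((continuous_apply x).comp continuous_subtype_val).mul continuous_const

theorem continuous_plusReal : Continuous (plusReal s W Q R) :=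
  ((continuous_sum_mul _).sub continuous_const).max (continuous_etaSup s W Q)

theorem plusObjective_eq_coe (hWQ : ∀ x, AbsCont (W x) Q) (hs : 0 ≤ s) (a : ProbDist X) :
    plusObjective s W Q R a = (plusReal s W Q R a : EReal) := by
  rw [plusObjective, iSup_eta hWQ hs, plusReal, EReal.coe_max', EReal.coe_sub, EReal.coe_sum']
  simp only [renyiDiv_eq_rateReal hWQ hs, EReal.coe_mul]

theorem exists_plusReal_eq_gammaPlus [Nonempty X] (hWQ : ∀ x, AbsCont (W x) Q) (hs : 0 ≤ s) :
    ∃ a : ProbDist X, gammaPlus s W Q R = (plusReal s W Q R a : EReal) ∧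
      ∀ a', plusReal s W Q R a ≤ plusReal s W Q R a' := by
  obtain ⟨a, -, ha⟩ := isCompact_univ.exists_isMinOn (s := (Set.univ : Set (ProbDist X)))
    Set.univ_nonempty (continuous_plusReal (s := s) (W := W) (Q := Q) (R := R)).continuousOn
  have ha' : ∀ a', plusReal s W Q R a ≤ plusReal s W Q R a' := fun a' => ha (Set.mem_univ a')
  refine ⟨a, le_antisymm ?_ (le_iInf fun a' => ?_), ha'⟩
  · rw [← plusObjective_eq_coe hWQ hs]
    exact iInf_le _ a
  · rw [plusObjective_eq_coe hWQ hs]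
    exact EReal.coe_le_coe_iff.2 (ha' a')

end Plus

/-! ### The single-letter expressions for the orders `1 - s` -/

section Minus

variable {X Y : Type*} [Fintype X] [Fintype Y] {W : X → ProbDist Y} {Q : ProbDist Y} {s R : ℝ}

/-- The joint distributions with finite divergences from `W` and `Q`. -/
def finiteSet (W : X → ProbDist Y) (Q : ProbDist Y) : Set (X × Y → ℝ) :=
  (jointSet fun x => W x) ∩ jointSet fun _ => Q

theorem isCompact_finiteSet (W : X → ProbDist Y) (Q : ProbDist Y) : IsCompact (finiteSet W Q) :=
  (isCompact_jointSet _).inter_right (isCompact_jointSet _).isClosed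

/-- The joint distributions in the support of `W` with the marginals of `p`. -/
def couplings (W : X → ProbDist Y) (p : X × Y → ℝ) : Set (X × Y → ℝ) :=
  {p' | p' ∈ jointSet (fun x => W x) ∧ fstMarginal p' = fstMarginal p ∧
    sndMarginal p' = sndMarginal p}

theorem isCompact_couplings (W : X → ProbDist Y) (p : X × Y → ℝ) : IsCompact (couplings W p) :=
  (isCompact_jointSet fun x => W x).inter_right
    (t := {p' | fstMarginal p' = fstMarginal p ∧ sndMarginal p' = sndMarginal p})
    ((isClosed_eq continuous_fstMarginal continuous_const).inter
      (isClosed_eq continuous_sndMarginal continuous_const))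

/-- The least conditional divergence for given marginals. -/
noncomputable def minCondKL (W : X → ProbDist Y) (p : X × Y → ℝ) : ℝ :=
  sInf (condKL (fun x => W x) '' couplings W p)

theorem minCondKL_isLeast {p : X × Y → ℝ} (hp : p ∈ jointSet fun x => W x) :
    IsLeast (condKL (fun x => W x) '' couplings W p) (minCondKL W p) :=
  ((isCompact_couplings W p).image (continuous_condKL _)).isLeast_sInf ⟨_, p, ⟨hp, rfl, rfl⟩, rfl⟩

theorem fstMarginal_combo (p q r : X × Y → ℝ) (t : ℝ) (x : X) :
    fstMarginal (fun z => p z + t * (q z - r z)) x =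
      fstMarginal p x + t * (fstMarginal q x - fstMarginal r x) := by
  simp only [fstMarginal]
  rw [Finset.sum_add_distrib, ← Finset.mul_sum, Finset.sum_sub_distrib]

theorem sndMarginal_combo (p q r : X × Y → ℝ) (t : ℝ) (y : Y) :
    sndMarginal (fun z => p z + t * (q z - r z)) y =
      sndMarginal p y + t * (sndMarginal q y - sndMarginal r y) := by
  simp only [sndMarginal]
  rw [Finset.sum_add_distrib, ← Finset.mul_sum, Finset.sum_sub_distrib]

/-- Upper semicontinuity of the least conditional divergence. -/
theorem eventually_minCondKL_lt {p : X × Y → ℝ} (hp : p ∈ jointSet fun x => W x) {c : ℝ}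
    (hc : minCondKL W p < c) :
    ∀ᶠ p' in 𝓝[jointSet fun x => W x] p, minCondKL W p' < c := by
  classical
  obtain ⟨q, ⟨hq, hq1, hq2⟩, hqe⟩ := (minCondKL_isLeast hp).1
  obtain ⟨z₀, hz₀⟩ : ∃ z, 0 < p z := by
    by_contra! h
    have : ∑ i, p i = 0 := Finset.sum_eq_zero fun i _ => le_antisymm (h i) (hp.1.1 i)
    linarith [hp.1.2]
  let S : Finset (X × Y) := Finset.univ.filter fun z => 0 < p z
  have hS : S.Nonempty := ⟨z₀, Finset.mem_filter.2 ⟨Finset.mem_univ _, hz₀⟩⟩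
  -- To reach `p'`, the optimal coupling `q` of `p` is transported as `p' + t (q - p)`. Equal
  -- marginals of `p` and `q` preserve those of `p'`; the cap `t p ≤ p'` on the support of `p`
  -- preserves nonnegativity, and `t = 1` at `p`.
  let t : (X × Y → ℝ) → ℝ := fun p' => min 1 (S.inf' hS fun z => p' z / p z)
  have htc : Continuous t := continuous_const.min
    (Continuous.finset_inf'_apply hS fun z _ => (continuous_apply z).div_const _)
  have ht1 : t p = 1 := by
    refine le_antisymm (min_le_left _ _) (le_min le_rfl (Finset.le_inf' _ _ fun z hz => ?_))
    rw [div_self (Finset.mem_filter.1 hz).2.ne']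
  let F : (X × Y → ℝ) → X × Y → ℝ := fun p' z => p' z + t p' * (q z - p z)
  have hFc : Continuous F := continuous_pi fun z =>
    (continuous_apply z).add (htc.mul continuous_const)
  have hFp : F p = q := by
    ext z
    simp only [F, ht1]
    ring
  have hlt : condKL (fun x => W x) (F p) < c := by rw [hFp, hqe]; exact hc
  have hev : ∀ᶠ p' in 𝓝[jointSet fun x => W x] p, condKL (fun x => W x) (F p') < c :=
    (((continuous_condKL _).comp hFc).tendsto p).eventually_lt_const hlt |>.filter_mono
      nhdsWithin_le_nhds
  filter_upwards [hev, self_mem_nhdsWithin] with p' h hp'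
  refine lt_of_le_of_lt ((minCondKL_isLeast hp').2 ⟨F p', ⟨⟨⟨fun z => ?_, ?_⟩, fun x y hxy => ?_⟩,
    ?_, ?_⟩, rfl⟩) h
  · have ht0 : 0 ≤ t p' := le_min zero_le_one (Finset.le_inf' _ _ fun z _ =>
      div_nonneg (hp'.1.1 z) (hp.1.1 z))
    have hle : t p' * p z ≤ p' z := by
      rcases (hp.1.1 z).eq_or_lt with h0 | h0
      · rw [← h0, mul_zero]
        exact hp'.1.1 z
      · rw [← le_div_iff₀ h0]
        exact (min_le_right _ _).trans
          (Finset.inf'_le _ (Finset.mem_filter.2 ⟨Finset.mem_univ z, h0⟩))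
    have := mul_nonneg ht0 (hq.1.1 z)
    simp only [F]
    linarith
  · simp only [F]
    rw [Finset.sum_add_distrib, ← Finset.mul_sum, Finset.sum_sub_distrib, hp'.1.2, hq.1.2, hp.1.2]
    ring
  · simp only [F]
    rw [hp'.2 x y hxy, hq.2 x y hxy, hp.2 x y hxy]
    ring
  · ext x
    rw [fstMarginal_combo, hq1]
    ring
  · ext y
    rw [sndMarginal_combo, hq2]
    ring

/-- Lower semicontinuity of the least conditional divergence. -/
theorem eventually_lt_condKL {p : X × Y → ℝ} (hp : p ∈ jointSet fun x => W x) {c : ℝ}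
    (hc : c < minCondKL W p) :
    ∀ᶠ p' in 𝓝 p, ∀ q ∈ couplings W p', c < condKL (fun x => W x) q := by
  let m : (X × Y → ℝ) → (X → ℝ) × (Y → ℝ) := fun q => (fstMarginal q, sndMarginal q)
  have hm : Continuous m := continuous_fstMarginal.prodMk continuous_sndMarginal
  -- The marginal pairs of joint laws with divergence at most `c` form a compact set. It misses the
  -- marginals of `p`, hence those of all nearby laws.
  let C : Set (X × Y → ℝ) := (jointSet fun x => W x) ∩ {q | condKL (fun x => W x) q ≤ c}
  have hC : IsCompact C := (isCompact_jointSet _).inter_right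
    (isClosed_le (continuous_condKL _) continuous_const)
  have hnot : m p ∉ m '' C := by
    rintro ⟨q, ⟨hq, hqc⟩, hqm⟩
    rw [Prod.mk.injEq] at hqm
    have := (minCondKL_isLeast hp).2 ⟨q, ⟨hq, hqm.1, hqm.2⟩, rfl⟩
    exact absurd (hc.trans_le (this.trans hqc)) (lt_irrefl _)
  have hev : ∀ᶠ p' in 𝓝 p, m p' ∉ m '' C :=
    hm.continuousAt.eventually ((hC.image hm).isClosed.isOpen_compl.mem_nhds hnot)
  filter_upwards [hev] with p' hp' q hq
  by_contra! h
  exact hp' ⟨q, ⟨hq.1, h⟩, Prod.ext hq.2.1 hq.2.2⟩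

/-- The real-valued rate term. -/
noncomputable def rateTermReal (s : ℝ) (W : X → ProbDist Y) (Q : ProbDist Y) (R : ℝ)
    (p : X × Y → ℝ) : ℝ :=
  (1 / s - 1) * condKL (fun x => W x) p + condKL (fun _ : X => Q) p - R

/-- The real-valued objective of the lower bound. -/
noncomputable def lbReal (s : ℝ) (W : X → ProbDist Y) (Q : ProbDist Y) (R : ℝ) (p : X × Y → ℝ) : ℝ :=
  max (rateTermReal s W Q R p) ((1 / s - 1) * condKL (fun x => W x) p + klReal Q (sndMarginal p))

/-- The real-valued objective of the upper bound. -/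
noncomputable def ubReal (s : ℝ) (W : X → ProbDist Y) (Q : ProbDist Y) (R : ℝ) (p : X × Y → ℝ) : ℝ :=
  max (rateTermReal s W Q R p)
    ((1 / s) * condKL (fun x => W x) p + klReal Q (sndMarginal p) - minCondKL W p)

theorem continuous_rateTermReal : Continuous (rateTermReal s W Q R) :=
  ((continuous_const.mul (continuous_condKL _)).add (continuous_condKL _)).sub continuous_const

theorem continuous_lbReal : Continuous (lbReal s W Q R) :=
  continuous_rateTermReal.max ((continuous_const.mul (continuous_condKL _)).add
    ((continuous_klReal _).comp continuous_sndMarginal))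

/-- The inner minimum enters with a minus sign, so its upper semicontinuity is the property that is
used; this suffices for a minimizer on a compact set. -/
theorem lowerSemicontinuousOn_ubReal : LowerSemicontinuousOn (ubReal s W Q R) (finiteSet W Q) := by
  intro p hp c hc
  rw [ubReal, gt_iff_lt, lt_max_iff] at hc
  rcases hc with hc | hc
  · filter_upwards [(continuous_rateTermReal.tendsto p).eventually_const_lt hc |>.filter_mono
      nhdsWithin_le_nhds] with p' hp'
    exact lt_max_of_lt_left hp'
  · set h : (X × Y → ℝ) → ℝ := fun p =>
      (1 / s) * condKL (fun x => W x) p + klReal Q (sndMarginal p) with hh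
    have hcont : Continuous h := (continuous_const.mul (continuous_condKL _)).add
      ((continuous_klReal _).comp continuous_sndMarginal)
    have hc' : c < h p - minCondKL W p := hc
    obtain ⟨e, he, he'⟩ : ∃ e : ℝ, 0 < e ∧ c + 2 * e < h p - minCondKL W p + e :=
      ⟨(h p - minCondKL W p - c) / 2, by linarith, by linarith⟩
    have h1 : ∀ᶠ p' in 𝓝[finiteSet W Q] p, h p - e / 2 < h p' :=
      (hcont.tendsto p).eventually_const_lt (by linarith) |>.filter_mono nhdsWithin_le_nhds
    have h2 := (eventually_minCondKL_lt hp.1 (by linarith : minCondKL W p <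
      minCondKL W p + e / 2)).filter_mono (nhdsWithin_mono p (Set.inter_subset_left :
        finiteSet W Q ⊆ _))
    filter_upwards [h1, h2] with p' h3 h4
    refine lt_max_of_lt_right ?_
    change c < h p' - minCondKL W p'
    linarith

theorem one_div_sub_one_pos (hs : 0 < s) (hs1 : s < 1) : 0 < 1 / s - 1 := by
  rw [sub_pos, lt_div_iff₀ hs]
  linarith

theorem condRelEntropy_ne_bot (V W : X → ProbDist Y) (a : ProbDist X) :
    condRelEntropy V W a ≠ ⊥ := by
  by_cases h : jointDist a V ∈ jointSet fun x => W x
  · rw [condRelEntropy_eq_coe h]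
    exact EReal.coe_ne_bot _
  · rw [condRelEntropy_eq_top h]
    simp

theorem rateTerm_eq_coe {a : ProbDist X} {V : X → ProbDist Y} (h : jointDist a V ∈ finiteSet W Q) :
    rateTerm s W Q R a V = (rateTermReal s W Q R (jointDist a V) : EReal) := by
  rw [rateTerm, condRelEntropy_eq_coe h.1, condRelEntropy_eq_coe (W := fun _ => Q) h.2,
    rateTermReal, ← EReal.coe_mul, ← EReal.coe_add, ← EReal.coe_sub]

/-- The restriction `s < 1` makes the coefficient `1 / s - 1` positive; at `s = 1` an infinite
divergence from `W` would be erased by `0 * ⊤ = 0`. -/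
theorem rateTerm_eq_top (hs : 0 < s) (hs1 : s < 1) {a : ProbDist X} {V : X → ProbDist Y}
    (h : jointDist a V ∉ finiteSet W Q) : rateTerm s W Q R a V = ⊤ := by
  have hpos := one_div_sub_one_pos hs hs1
  have hsum : ((1 / s - 1 : ℝ) : EReal) * condRelEntropy V W a +
      condRelEntropy V (fun _ => Q) a = ⊤ := by
    by_cases hW : jointDist a V ∈ jointSet fun x => W x
    · have hQ : jointDist a V ∉ jointSet fun _ => Q := fun hQ => h ⟨hW, hQ⟩
      rw [condRelEntropy_eq_coe hW, condRelEntropy_eq_top (W := fun _ => Q) hQ, ← EReal.coe_mul]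
      exact EReal.coe_add_top _
    · rw [condRelEntropy_eq_top hW, EReal.coe_mul_top_of_pos hpos]
      exact EReal.top_add_of_ne_bot (condRelEntropy_ne_bot _ _ _)
  rw [rateTerm, hsum]
  exact EReal.top_sub_coe _

theorem lbObjective_eq_coe {a : ProbDist X} {V : X → ProbDist Y}
    (h : jointDist a V ∈ finiteSet W Q) :
    lbObjective s W Q R a V = (lbReal s W Q R (jointDist a V) : EReal) := by
  rw [lbObjective, rateTerm_eq_coe h, condRelEntropy_eq_coe h.1, relEntropy_outMarginal_eq_coe h.2,
    lbReal, EReal.coe_max', ← EReal.coe_mul, ← EReal.coe_add]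

theorem lbObjective_eq_top (hs : 0 < s) (hs1 : s < 1) {a : ProbDist X} {V : X → ProbDist Y}
    (h : jointDist a V ∉ finiteSet W Q) : lbObjective s W Q R a V = ⊤ := by
  rw [lbObjective, rateTerm_eq_top hs hs1 h]
  exact max_eq_left le_top

theorem coe_minCondKL_le {a : ProbDist X} {V V' : X → ProbDist Y}
    (h : jointDist a V ∈ jointSet fun x => W x) (hV : outMarginal V' a = outMarginal V a) :
    (minCondKL W (jointDist a V) : EReal) ≤ condRelEntropy V' W a := by
  by_cases h' : jointDist a V' ∈ jointSet fun x => W x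
  · rw [condRelEntropy_eq_coe h', EReal.coe_le_coe_iff]
    refine (minCondKL_isLeast h).2 ⟨_, ⟨h', ?_, ?_⟩, rfl⟩
    · rw [fstMarginal_jointDist, fstMarginal_jointDist]
    · rw [sndMarginal_jointDist, sndMarginal_jointDist, hV]
  · rw [condRelEntropy_eq_top h']
    exact le_top

theorem exists_condRelEntropy_eq_minCondKL {a : ProbDist X} {V : X → ProbDist Y}
    (h : jointDist a V ∈ jointSet fun x => W x) :
    ∃ V' : X → ProbDist Y, outMarginal V' a = outMarginal V a ∧
      condRelEntropy V' W a = (minCondKL W (jointDist a V) : EReal) := by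
  obtain ⟨q, ⟨hq, hq1, hq2⟩, hqe⟩ := (minCondKL_isLeast h).1
  obtain ⟨a', V', rfl, -⟩ := exists_jointDist_eq W hq.1
  rw [fstMarginal_jointDist, fstMarginal_jointDist] at hq1
  have : a' = a := Subtype.ext hq1
  subst this
  rw [sndMarginal_jointDist, sndMarginal_jointDist] at hq2
  exact ⟨V', hq2, by rw [condRelEntropy_eq_coe hq, hqe]⟩

theorem minCondRelEntropy_eq_coe {a : ProbDist X} {V : X → ProbDist Y}
    (h : jointDist a V ∈ jointSet fun x => W x) :
    minCondRelEntropy W a V = (minCondKL W (jointDist a V) : EReal) := by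
  refine le_antisymm ?_ (le_iInf₂ fun V' hV' => coe_minCondKL_le h hV')
  obtain ⟨V', h1, h2⟩ := exists_condRelEntropy_eq_minCondKL h
  exact h2 ▸ iInf₂_le V' h1

/-- If no competitor has finite divergence, the infimum is `⊤` and `V` itself attains it. -/
theorem exists_condRelEntropy_eq_minCondRelEntropy (W : X → ProbDist Y) (a : ProbDist X)
    (V : X → ProbDist Y) : ∃ V' : X → ProbDist Y,
      outMarginal V' a = outMarginal V a ∧ condRelEntropy V' W a = minCondRelEntropy W a V := by
  by_cases h : ∃ V₁ : X → ProbDist Y, outMarginal V₁ a = outMarginal V a ∧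
      jointDist a V₁ ∈ jointSet fun x => W x
  · obtain ⟨V₁, h1, h2⟩ := h
    obtain ⟨V', h3, h4⟩ := exists_condRelEntropy_eq_minCondKL h2
    refine ⟨V', h3.trans h1, ?_⟩
    rw [h4, ← minCondRelEntropy_eq_coe h2, minCondRelEntropy, minCondRelEntropy, h1]
  · push Not at h
    refine ⟨V, rfl, ?_⟩
    rw [condRelEntropy_eq_top (h V rfl)]
    refine (top_le_iff.1 (le_iInf₂ fun V' hV' => ?_)).symm
    rw [condRelEntropy_eq_top (h V' hV')]

theorem ubObjective_eq_coe {a : ProbDist X} {V : X → ProbDist Y}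
    (h : jointDist a V ∈ finiteSet W Q) :
    ubObjective s W Q R a V = (ubReal s W Q R (jointDist a V) : EReal) := by
  rw [ubObjective, rateTerm_eq_coe h, condRelEntropy_eq_coe h.1, relEntropy_outMarginal_eq_coe h.2,
    minCondRelEntropy_eq_coe h.1, ubReal, EReal.coe_max', ← EReal.coe_mul, ← EReal.coe_add,
    ← EReal.coe_sub]

theorem ubObjective_eq_top (hs : 0 < s) (hs1 : s < 1) {a : ProbDist X} {V : X → ProbDist Y}
    (h : jointDist a V ∉ finiteSet W Q) : ubObjective s W Q R a V = ⊤ := by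
  rw [ubObjective, rateTerm_eq_top hs hs1 h]
  exact max_eq_left le_top

/-- A function on pairs `(a, V)` that is finite exactly on `finiteSet` attains its infimum. -/
theorem exists_eq_iInf_of_finiteSet [Nonempty X] {f : ProbDist X → (X → ProbDist Y) → EReal}
    {φ : (X × Y → ℝ) → ℝ} (hφ : LowerSemicontinuousOn φ (finiteSet W Q))
    (hf : ∀ a V, jointDist a V ∈ finiteSet W Q → f a V = (φ (jointDist a V) : EReal))
    (hf' : ∀ a V, jointDist a V ∉ finiteSet W Q → f a V = ⊤) :
    (∃ a V, f a V = ⨅ (a) (V), f a V) ∧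
      ((finiteSet W Q = ∅ ∧ ⨅ (a) (V), f a V = ⊤) ∨
        ∃ p ∈ finiteSet W Q, ⨅ (a) (V), f a V = (φ p : EReal) ∧ ∀ p' ∈ finiteSet W Q, φ p ≤ φ p') := by
  rcases (finiteSet W Q).eq_empty_or_nonempty with h | h
  · have htop : ∀ a V, f a V = ⊤ := fun a V => hf' a V (by simp [h])
    have : ⨅ (a) (V), f a V = ⊤ := by simp [htop]
    exact ⟨⟨Classical.arbitrary _, W, by rw [this, htop]⟩, Or.inl ⟨h, this⟩⟩
  · obtain ⟨p, hp, hmin⟩ := hφ.exists_isMinOn h (isCompact_finiteSet W Q)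
    obtain ⟨a, V, rfl, -⟩ := exists_jointDist_eq W hp.1.1
    have hmin' : ∀ p' ∈ finiteSet W Q, φ (jointDist a V) ≤ φ p' := fun p' hp' => hmin hp'
    have e : ⨅ (a) (V), f a V = (φ (jointDist a V) : EReal) := by
      refine le_antisymm ?_ (le_iInf₂ fun a' V' => ?_)
      · rw [← hf a V hp]
        exact iInf_le_of_le a (iInf_le _ V)
      · by_cases h' : jointDist a' V' ∈ finiteSet W Q
        · rw [hf a' V' h']
          exact EReal.coe_le_coe_iff.2 (hmin' _ h')
        · rw [hf' a' V' h']
          exact le_top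
    exact ⟨⟨a, V, by rw [e, hf a V hp]⟩, Or.inr ⟨_, hp, e, hmin'⟩⟩

theorem gammaLB_attained [Nonempty X] (hs : 0 < s) (hs1 : s < 1) :
    (∃ a V, lbObjective s W Q R a V = gammaLB s W Q R) ∧
      ((finiteSet W Q = ∅ ∧ gammaLB s W Q R = ⊤) ∨
        ∃ p ∈ finiteSet W Q, gammaLB s W Q R = (lbReal s W Q R p : EReal) ∧
          ∀ p' ∈ finiteSet W Q, lbReal s W Q R p ≤ lbReal s W Q R p') :=
  exists_eq_iInf_of_finiteSet (continuous_lbReal.lowerSemicontinuous.lowerSemicontinuousOn _)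
    (fun _ _ h => lbObjective_eq_coe h) fun _ _ h => lbObjective_eq_top hs hs1 h

theorem gammaUB_attained [Nonempty X] (hs : 0 < s) (hs1 : s < 1) :
    (∃ a V, ubObjective s W Q R a V = gammaUB s W Q R) ∧
      ((finiteSet W Q = ∅ ∧ gammaUB s W Q R = ⊤) ∨
        ∃ p ∈ finiteSet W Q, gammaUB s W Q R = (ubReal s W Q R p : EReal) ∧
          ∀ p' ∈ finiteSet W Q, ubReal s W Q R p ≤ ubReal s W Q R p') :=
  exists_eq_iInf_of_finiteSet lowerSemicontinuousOn_ubReal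
    (fun _ _ h => ubObjective_eq_coe h) fun _ _ h => ubObjective_eq_top hs hs1 h

end Minus

/-! ### Limits in the extended reals -/

section Limits

theorem coe_le_one_div_mul {n : ℕ} (hn : 0 < n) {x : ℝ} {D : EReal} (h : ((n * x : ℝ) : EReal) ≤ D) :
    (x : EReal) ≤ ((1 / n : ℝ) : EReal) * D := by
  have e : (x : EReal) = ((1 / n : ℝ) : EReal) * ((n * x : ℝ) : EReal) := by
    rw [← EReal.coe_mul]
    congr 1
    field_simp
  rw [e]
  have h0 : (0 : EReal) ≤ ((1 / n : ℝ) : EReal) := EReal.coe_nonneg.2 (by positivity)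
  gcongr

theorem one_div_mul_le_coe {n : ℕ} (hn : 0 < n) {x : ℝ} {D : EReal} (h : D ≤ ((n * x : ℝ) : EReal)) :
    ((1 / n : ℝ) : EReal) * D ≤ (x : EReal) := by
  have e : (x : EReal) = ((1 / n : ℝ) : EReal) * ((n * x : ℝ) : EReal) := by
    rw [← EReal.coe_mul]
    congr 1
    field_simp
  rw [e]
  have h0 : (0 : EReal) ≤ ((1 / n : ℝ) : EReal) := EReal.coe_nonneg.2 (by positivity)
  gcongr

theorem one_div_mul_mono {n : ℕ} {D D' : EReal} (h : D ≤ D') :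
    ((1 / n : ℝ) : EReal) * D ≤ ((1 / n : ℝ) : EReal) * D' := by
  have h0 : (0 : EReal) ≤ ((1 / n : ℝ) : EReal) := EReal.coe_nonneg.2 (by positivity)
  gcongr

theorem tendsto_coe_sub {γ : ℝ} {δ : ℕ → ℝ} (hδ : Tendsto δ atTop (𝓝 0)) :
    Tendsto (fun n => ((γ - δ n : ℝ) : EReal)) atTop (𝓝 (γ : EReal)) := by
  refine EReal.tendsto_coe.2 ?_
  simpa using (tendsto_const_nhds (x := γ)).sub hδ

theorem tendsto_of_eventually_bounds {γ : ℝ} {δ : ℕ → ℝ} (hδ : Tendsto δ atTop (𝓝 0))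
    {F : ℕ → EReal} (hl : ∀ᶠ n in atTop, ((γ - δ n : ℝ) : EReal) ≤ F n)
    (hu : ∀ v : ℝ, γ < v → ∀ᶠ n in atTop, F n ≤ (v : EReal)) : Tendsto F atTop (𝓝 (γ : EReal)) := by
  refine tendsto_order.2 ⟨fun b hb => ?_, fun b hb => ?_⟩
  · filter_upwards [(tendsto_coe_sub hδ).eventually_const_lt hb, hl] with n h1 h2
    exact h1.trans_le h2
  · obtain ⟨v, h1, h2⟩ := EReal.lt_iff_exists_real_btwn.1 hb
    filter_upwards [hu v (EReal.coe_lt_coe_iff.1 h1)] with n hn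
    exact hn.trans_lt h2

theorem tendsto_log_div_atTop : Tendsto (fun n : ℕ => (1 + Real.log (n + 1)) / n) atTop (𝓝 0) := by
  have h1 : Tendsto (fun n : ℕ => Real.log (n + 1) / (n + 1)) atTop (𝓝 0) := by
    have := Real.isLittleO_log_id_atTop.tendsto_div_nhds_zero
    exact this.comp (tendsto_natCast_atTop_atTop.atTop_add tendsto_const_nhds)
  have h2 : Tendsto (fun n : ℕ => (1 : ℝ) / n) atTop (𝓝 0) := tendsto_one_div_atTop_nhds_zero_nat
  have h3 : Tendsto (fun n : ℕ => (1 : ℝ) / n + Real.log (n + 1) / (n + 1) * (1 + 1 / n)) atTop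
      (𝓝 (0 + 0 * (1 + 0))) := h2.add (h1.mul (tendsto_const_nhds.add h2))
  simp only [zero_mul, add_zero] at h3
  refine h3.congr' ?_
  filter_upwards [eventually_gt_atTop 0] with n hn
  field_simp

theorem tendsto_error (a b : ℝ) :
    Tendsto (fun n : ℕ => (a + b * (1 + Real.log (n + 1))) / n) atTop (𝓝 0) := by
  have h2 : Tendsto (fun n : ℕ => (1 : ℝ) / n) atTop (𝓝 0) := tendsto_one_div_atTop_nhds_zero_nat
  have h := (h2.const_mul a).add (tendsto_log_div_atTop.const_mul b)
  simp only [mul_zero, add_zero] at h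
  refine h.congr fun n => ?_
  ring

theorem log_exp_add_exp_le (a b : ℝ) : Real.log (Real.exp a + Real.exp b) ≤ Real.log 2 + max a b := by
  rw [Real.log_le_iff_le_exp (by positivity), Real.exp_add, Real.exp_log two_pos, two_mul]
  exact add_le_add (Real.exp_le_exp.2 (le_max_left _ _)) (Real.exp_le_exp.2 (le_max_right _ _))

end Limits

/-! ### The orders `1 + s` -/

section Plus

variable {X Y : Type*} [Fintype X] [Fintype Y] {W : X → ProbDist Y} {Q : ProbDist Y} {s R : ℝ}
  {M n : ℕ}

theorem log_le_of_rate (hn : 0 < n) : Real.log M ≤ n * (R + |Real.log M / n - R|) := by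
  have h1 := le_abs_self (Real.log M / n - R)
  have hn' : (0 : ℝ) < n := by exact_mod_cast hn
  have h2 : Real.log M / n ≤ R + |Real.log M / n - R| := by linarith
  rw [div_le_iff₀ hn'] at h2
  linarith

theorem le_log_of_rate (hn : 0 < n) : n * (R - |Real.log M / n - R|) ≤ Real.log M := by
  have h1 := neg_abs_le (Real.log M / n - R)
  have hn' : (0 : ℝ) < n := by exact_mod_cast hn
  have h2 : R - |Real.log M / n - R| ≤ Real.log M / n := by linarith
  rw [le_div_iff₀ hn'] at h2
  linarith

/-- The hypothesis is applied at the codebook's own letter distribution; whichever term of the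
maximum dominates there selects the converse bound. -/
theorem codebook_lower_bound_of_pos (hWQ : ∀ x, AbsCont (W x) Q) (hs : 0 < s) (hM : 0 < M)
    (hn : 0 < n) {γ : ℝ} (hγ : ∀ a, γ ≤ plusReal s W Q R a) (c : Fin M → Fin n → X) :
    s * (n * (γ - |Real.log M / n - R|)) ≤
      Real.log (powSum (1 + s) (outputDist W c) (prodDist Q n)) := by
  have hn' : (0 : ℝ) < n := by exact_mod_cast hn
  rcases le_max_iff.1 (hγ (codeType hM hn c)) with h | h
  · have h1 := rate_le_log_powSum hM hn hWQ c hs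
    have h2 : ∑ x, codeType hM hn c x * Real.log (powSum (1 + s) (W x) Q) =
        s * ∑ x, codeType hM hn c x * rateReal s W Q x := by
      rw [Finset.mul_sum]
      refine Finset.sum_congr rfl fun x _ => ?_
      rw [rateReal, if_neg hs.ne']
      field_simp
    rw [h2] at h1
    refine le_trans ?_ h1
    have h3 := log_le_of_rate (M := M) (R := R) hn
    have h4 := mul_le_mul_of_nonneg_left h hn'.le
    have h5 : n * (γ - |Real.log M / n - R|) ≤
        n * ∑ x, codeType hM hn c x * rateReal s W Q x - Real.log M := by linarith
    have h6 := mul_le_mul_of_nonneg_left h5 hs.le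
    linarith
  · obtain ⟨V, hV, hVe⟩ := (etaSup_isGreatest s W Q (codeType hM hn c)).1
    have h1 := eta_le_log_powSum hM hn hWQ c hs hV.1
    refine le_trans ?_ h1
    have h2 : s * klReal Q (sndMarginal (jointDist (codeType hM hn c) V)) -
        (1 + s) * condKL (fun x => W x) (jointDist (codeType hM hn c) V) =
        s * etaSup s W Q (codeType hM hn c) := by
      rw [← hVe]
      simp only [etaReal]
      field_simp
      ring
    rw [h2]
    have h3 : γ - |Real.log M / n - R| ≤ etaSup s W Q (codeType hM hn c) := by
      linarith [abs_nonneg (Real.log M / n - R)]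
    have h4 := mul_le_mul_of_nonneg_left h3 (mul_nonneg hs.le hn'.le)
    linarith

theorem codebook_lower_bound_zero (hWQ : ∀ x, AbsCont (W x) Q) (hM : 0 < M)
    (hn : 0 < n) {γ : ℝ} (hγ : ∀ a, γ ≤ plusReal 0 W Q R a) (c : Fin M → Fin n → X) :
    n * (γ - |Real.log M / n - R|) ≤
      ∑ y, outputDist W c y * (Real.log (outputDist W c y) - Real.log (prodDist Q n y)) := by
  have hn' : (0 : ℝ) < n := by exact_mod_cast hn
  rcases le_max_iff.1 (hγ (codeType hM hn c)) with h | h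
  · have h1 := rate_le_relEntropy hM hn hWQ c
    simp only [rateReal, if_true] at h
    refine le_trans ?_ h1
    have h3 := log_le_of_rate (M := M) (R := R) hn
    have h4 := mul_le_mul_of_nonneg_left h hn'.le
    linarith
  · obtain ⟨V, hV, hVe⟩ := (etaSup_isGreatest 0 W Q (codeType hM hn c)).1
    -- At `s = 0` the only test channel is `W`.
    have hVW := hV.2 rfl
    subst hVW
    refine le_trans ?_ (natCast_mul_klReal_outputDist_le hM hn c hWQ)
    simp only [etaReal, condKL_jointDist_self, mul_zero, zero_add] at hVe
    rw [hVe]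
    refine mul_le_mul_of_nonneg_left ?_ hn'.le
    linarith [abs_nonneg (Real.log M / n - R)]

theorem sum_mul_log_div_eq {A : Type*} [Fintype A] {P Q : A → ℝ} (h : AbsCont P Q) :
    ∑ y, P y * Real.log (P y / Q y) = ∑ y, P y * (Real.log (P y) - Real.log (Q y)) := by
  refine Finset.sum_congr rfl fun y _ => ?_
  by_cases hy : P y = 0
  · simp [hy]
  · rw [Real.log_div hy (mt (h y) hy)]

theorem powSum_outputDist_pos (hWQ : ∀ x, AbsCont (W x) Q) (hM : 0 < M) (α : ℝ)
    (c : Fin M → Fin n → X) : 0 < powSum α (outputDist W c) (prodDist Q n) :=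
  powSum_pos (outputDist_nonneg W c) (sum_outputDist W hM c) (prodDist_nonneg Q.nonneg)
    (absCont_outputDist hWQ c) α

theorem sum_mul_pos {U : Type*} [Fintype U] {pU t : U → ℝ} (hU : ∀ u, 0 ≤ pU u)
    (hU1 : ∑ u, pU u = 1) (ht : ∀ u, 0 < t u) : 0 < ∑ u, pU u * t u := by
  obtain ⟨j, hj⟩ : ∃ j, 0 < pU j := by
    by_contra! h
    have : ∑ i, pU i = 0 := Finset.sum_eq_zero fun i _ => le_antisymm (h i) (hU i)
    linarith
  exact Finset.sum_pos' (fun u _ => mul_nonneg (hU u) (ht u).le)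
    ⟨j, Finset.mem_univ j, mul_pos hj (ht j)⟩

theorem le_sum_mul_of_forall_le {U : Type*} [Fintype U] {pU t : U → ℝ} (hU : ∀ u, 0 ≤ pU u)
    (hU1 : ∑ u, pU u = 1) {b : ℝ} (h : ∀ u, b ≤ t u) : b ≤ ∑ u, pU u * t u := by
  rw [← one_mul b, ← hU1, Finset.sum_mul]
  exact Finset.sum_le_sum fun u _ => mul_le_mul_of_nonneg_left (h u) (hU u)

theorem sum_mul_le_of_forall_le {U : Type*} [Fintype U] {pU t : U → ℝ} (hU : ∀ u, 0 ≤ pU u)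
    (hU1 : ∑ u, pU u = 1) {b : ℝ} (h : ∀ u, t u ≤ b) : ∑ u, pU u * t u ≤ b := by
  rw [← one_mul b, ← hU1, Finset.sum_mul]
  exact Finset.sum_le_sum fun u _ => mul_le_mul_of_nonneg_left (h u) (hU u)

/-- Every random code obeys the lower bound for the orders `1 + s`. -/
theorem le_codeDiv_plus (hWQ : ∀ x, AbsCont (W x) Q) (hs : 0 ≤ s) (hM : 0 < M)
    (hn : 0 < n) {γ : ℝ} (hγ : ∀ a, γ ≤ plusReal s W Q R a) {U : Type*} [Fintype U] {pU : U → ℝ}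
    (hU : ∀ u, 0 ≤ pU u) (hU1 : ∑ u, pU u = 1) (f : U → Fin M → Fin n → X) :
    ((n * (γ - |Real.log M / n - R|) : ℝ) : EReal) ≤ codeDiv (1 + s) W Q pU f := by
  rcases hs.eq_or_lt with h | h
  · subst h
    rw [add_zero, codeDiv_one_eq_coe hWQ, EReal.coe_le_coe_iff]
    refine le_sum_mul_of_forall_le hU hU1 fun u => ?_
    rw [sum_mul_log_div_eq (absCont_outputDist hWQ _)]
    exact codebook_lower_bound_zero hWQ hM hn hγ _
  · have hpos := sum_mul_pos hU hU1 (t := fun u => powSum (1 + s) (outputDist W (f u)) (prodDist Q n))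
      fun u => powSum_outputDist_pos hWQ hM _ _
    rw [codeDiv_eq_coe (by linarith) (by linarith) (Or.inr hWQ) hU f hpos, EReal.coe_le_coe_iff,
      add_sub_cancel_left, le_inv_mul_iff₀ h, Real.le_log_iff_exp_le hpos]
    refine le_sum_mul_of_forall_le hU hU1 fun u => ?_
    rw [← Real.le_log_iff_exp_le (powSum_outputDist_pos hWQ hM _ _)]
    exact codebook_lower_bound_of_pos hWQ h hM hn hγ _

theorem le_resolvability_of_le_codeDiv {α : ℝ} {D : EReal} (h : ∀ (k : ℕ) (pU : ProbDist (Fin k))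
    (f : Fin k → Fin M → Fin n → X), D ≤ codeDiv α W Q pU f) : D ≤ resolvability α W Q M n :=
  le_iInf fun k => le_iInf fun pU => le_iInf fun f => h k pU f

/-- The empirical distribution as a probability distribution. -/
noncomputable def empDist {A : Type*} [Fintype A] {n : ℕ} (hn : 0 < n) (z : Fin n → A) : ProbDist A :=
  ⟨emp z, emp_nonneg z, sum_emp hn z⟩

/-- The error term of the random coding bounds. -/
noncomputable def codingError (a b : ℝ) (n : ℕ) : ℝ := (a + b * (1 + Real.log (n + 1))) / n

/-- The logarithm of the random coding bound: a sum of two exponentials costs `log 2` over the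
larger, and the polynomial factor joins it in `codingError`. -/
theorem conventionalDiv_le_of_pos (hWQ : ∀ x, AbsCont (W x) Q) (hs : 0 < s) (hs1 : s ≤ 1)
    (hM : 0 < M) (hn : 0 < n) (x₀ : Fin n → X) :
    conventionalDiv (1 + s) W Q M n (permDist x₀) ≤
      ((n * (plusReal s W Q R (empDist hn x₀) + |Real.log M / n - R| +
        codingError (s⁻¹ * Real.log 2) (s⁻¹ * (2 + s) * Fintype.card Y) n) : ℝ) : EReal) := by
  have hn' : (0 : ℝ) < n := by exact_mod_cast hn
  have hb := sum_codebook_powSum_le hM hn hWQ x₀ hs hs1 (g := etaSup s W Q (empDist hn x₀))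
    fun p hp h => etaReal_le_etaSup_of_mem hs.ne' hp (a := empDist hn x₀) h
  have hU : ∀ c : Fin M → Fin n → X, 0 ≤ ∏ m, permDist x₀ (c m) := fun c =>
    Finset.prod_nonneg fun m _ => (permDist x₀).nonneg _
  have hpos := sum_mul_pos hU (sum_prod_codebook (permDist x₀))
    (t := fun c => powSum (1 + s) (outputDist W c) (prodDist Q n))
      fun u => powSum_outputDist_pos hWQ hM _ _
  have hlog := (Real.log_le_log hpos hb).trans (log_exp_add_exp_le _ _)
  rw [conventionalDiv, codeDiv_eq_coe (by linarith) (by linarith) (Or.inr hWQ) hU id hpos,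
    EReal.coe_le_coe_iff, add_sub_cancel_left, inv_mul_le_iff₀ hs]
  refine hlog.trans ?_
  set κ := 1 + Real.log ((n : ℝ) + 1) with hκ
  have hκ0 : 0 ≤ κ := by
    have : 0 ≤ Real.log ((n : ℝ) + 1) := Real.log_nonneg (by linarith)
    positivity
  have e1 : n * codingError (s⁻¹ * Real.log 2) (s⁻¹ * (2 + s) * Fintype.card Y) n =
      s⁻¹ * Real.log 2 + s⁻¹ * (2 + s) * Fintype.card Y * κ := by
    rw [codingError, mul_div_cancel₀ _ hn'.ne']
  have e2 : s * (n * (plusReal s W Q R (empDist hn x₀) + |Real.log M / n - R| +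
      codingError (s⁻¹ * Real.log 2) (s⁻¹ * (2 + s) * Fintype.card Y) n)) =
      Real.log 2 + (s * (n * (plusReal s W Q R (empDist hn x₀) + |Real.log M / n - R|)) +
        (2 + s) * (Fintype.card Y * κ)) := by
    rw [mul_add (n : ℝ), e1]
    field_simp
    ring
  rw [e2]
  have hδ := abs_nonneg (Real.log M / n - R)
  have hκ1 : 0 ≤ (2 + s) * (Fintype.card Y * κ) := by positivity
  refine add_le_add le_rfl (max_le ?_ ?_)
  · have h2 : ∑ x, emp x₀ x * Real.log (powSum (1 + s) (W x) Q) =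
        s * ∑ x, empDist hn x₀ x * rateReal s W Q x := by
      rw [Finset.mul_sum]
      refine Finset.sum_congr rfl fun x _ => ?_
      rw [rateReal, if_neg hs.ne']
      change _ = s * (emp x₀ x * _)
      field_simp
    have h3 := le_log_of_rate (M := M) (R := R) hn
    have h4 : ∑ x, empDist hn x₀ x * rateReal s W Q x - R ≤ plusReal s W Q R (empDist hn x₀) :=
      le_max_left _ _
    have h5 := mul_le_mul_of_nonneg_left h4 hn'.le
    have h6 : n * ∑ x, empDist hn x₀ x * rateReal s W Q x - Real.log M ≤
        n * (plusReal s W Q R (empDist hn x₀) + |Real.log M / n - R|) := by linarith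
    have h7 := mul_le_mul_of_nonneg_left h6 hs.le
    rw [h2]
    linarith
  · have h4 : etaSup s W Q (empDist hn x₀) ≤ plusReal s W Q R (empDist hn x₀) + |Real.log M / n - R| :=
      (le_max_right _ _).trans (le_add_of_nonneg_right hδ)
    have h5 := mul_le_mul_of_nonneg_left h4 (mul_nonneg hs.le hn'.le)
    linarith

/-- A type is a probability distribution only for positive `n`, hence the quantifier over `hn`. -/
theorem tendsto_empDist {a : ProbDist X} {z : ∀ n : ℕ, Fin n → X}
    (hz : Tendsto (fun n => emp (z n)) atTop (𝓝 (a : X → ℝ))) {φ : ProbDist X → ℝ}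
    (hφ : Continuous φ) {v : ℝ} (hv : φ a < v) :
    ∀ᶠ n in atTop, ∀ hn : 0 < n, φ (empDist hn (z n)) < v := by
  have h1 : ∀ᶠ b in 𝓝 a, φ b < v := (hφ.tendsto a).eventually_lt_const hv
  rw [nhds_subtype_eq_comap, eventually_comap] at h1
  filter_upwards [hz.eventually h1] with n h hn
  exact h (empDist hn (z n)) rfl

theorem eventually_conventionalDiv_le_of_pos (hWQ : ∀ x, AbsCont (W x) Q) (hs : 0 < s) (hs1 : s ≤ 1)
    {M : ℕ → ℕ} (hM : ∀ n, 0 < M n)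
    (hMR : Tendsto (fun n : ℕ => |Real.log (M n) / n - R|) atTop (𝓝 0)) {a : ProbDist X}
    {z : ∀ n : ℕ, Fin n → X} (hz : Tendsto (fun n => emp (z n)) atTop (𝓝 (a : X → ℝ)))
    {v : ℝ} (hv : plusReal s W Q R a < v) :
    ∀ᶠ n in atTop,
      conventionalDiv (1 + s) W Q (M n) n (permDist (z n)) ≤ ((n * v : ℝ) : EReal) := by
  obtain ⟨v', h1, h2⟩ := exists_between hv
  have h3 : Tendsto (fun n : ℕ => |Real.log (M n) / n - R| +
      codingError (s⁻¹ * Real.log 2) (s⁻¹ * (2 + s) * Fintype.card Y) n) atTop (𝓝 (0 + 0)) :=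
    hMR.add (tendsto_error _ _)
  rw [add_zero] at h3
  filter_upwards [tendsto_empDist hz continuous_plusReal h1,
    h3.eventually_lt_const (sub_pos.2 h2), eventually_gt_atTop 0] with n h4 h5 hn
  refine (conventionalDiv_le_of_pos (R := R) hWQ hs hs1 (hM n) hn (z n)).trans
    (EReal.coe_le_coe_iff.2 (mul_le_mul_of_nonneg_left ?_ n.cast_nonneg))
  have := h4 hn
  linarith

/-- Monotonicity in the order for each codebook, followed by concavity of the logarithm over
codebooks. -/
theorem conventionalDiv_one_le (hWQ : ∀ x, AbsCont (W x) Q) (hs : 0 < s) (hM : 0 < M)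
    (pX : ProbDist (Fin n → X)) :
    conventionalDiv 1 W Q M n pX ≤ conventionalDiv (1 + s) W Q M n pX := by
  have hU : ∀ c : Fin M → Fin n → X, 0 ≤ ∏ m, pX (c m) := fun c =>
    Finset.prod_nonneg fun m _ => pX.nonneg _
  have hpos := sum_mul_pos hU (sum_prod_codebook pX)
    (t := fun c => powSum (1 + s) (outputDist W c) (prodDist Q n))
      fun u => powSum_outputDist_pos hWQ hM _ _
  rw [conventionalDiv, conventionalDiv, codeDiv_one_eq_coe hWQ,
    codeDiv_eq_coe (by linarith) (by linarith) (Or.inr hWQ) hU id hpos, EReal.coe_le_coe_iff,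
    add_sub_cancel_left, le_inv_mul_iff₀ hs]
  refine le_trans ?_ (sum_mul_log_le_log_sum hU (sum_prod_codebook pX)
    fun c _ => powSum_outputDist_pos hWQ hM (1 + s) c)
  rw [Finset.mul_sum]
  refine Finset.sum_le_sum fun c _ => ?_
  rw [mul_left_comm]
  refine mul_le_mul_of_nonneg_left ?_ (hU c)
  rw [sum_mul_log_div_eq (absCont_outputDist hWQ _)]
  exact mul_relEntropy_le_log_powSum (outputDist_nonneg W c) (sum_outputDist W hM c)
    (prodDist_nonneg Q.nonneg) (absCont_outputDist hWQ c)

/-- The Rényi divergences converge to the relative entropy. -/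
theorem tendsto_log_powSum {A : Type*} [Fintype A] {P Q : A → ℝ} (hP : ∀ y, 0 ≤ P y)
    (hP1 : ∑ y, P y = 1) (hQ : ∀ y, 0 ≤ Q y) (h : AbsCont P Q) :
    Tendsto (fun s => s⁻¹ * Real.log (powSum (1 + s) P Q)) (𝓝[>] 0) (𝓝 (klReal Q P)) := by
  obtain ⟨l, hl⟩ : ∃ l : A → ℝ, ∀ y, l y = Real.log (P y) - Real.log (Q y) := ⟨_, fun _ => rfl⟩
  -- `powSum (1 + s)` is the moment generating function of the log-likelihood ratio, and its
  -- logarithmic derivative at zero is the relative entropy.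
  have hd : HasDerivAt (fun s : ℝ => ∑ y, P y * Real.exp (s * l y)) (∑ y, P y * l y) 0 := by
    refine HasDerivAt.fun_sum fun y _ => ?_
    have h1 : HasDerivAt (fun s : ℝ => s * l y) (l y) 0 := hasDerivAt_mul_const (l y)
    have := (h1.exp).const_mul (P y)
    simpa using this
  have h1 : ∑ y, P y * Real.exp (0 * l y) = 1 := by simpa using hP1
  have hlog := hd.log (by rw [h1]; exact one_ne_zero)
  rw [h1, div_one, hasDerivAt_iff_tendsto_slope_zero] at hlog
  simp only [zero_add, h1, Real.log_one, sub_zero, smul_eq_mul] at hlog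
  have hkl : ∑ y, P y * l y = klReal Q P := by
    rw [klReal_eq_sum]
    simp only [hl]
  rw [hkl] at hlog
  refine (hlog.mono_left (nhdsWithin_mono 0 fun x hx => ne_of_gt hx)).congr' ?_
  filter_upwards [self_mem_nhdsWithin] with s hs
  have hs0 : (0 : ℝ) < s := hs
  congr 2
  refine Finset.sum_congr rfl fun y _ => ?_
  rcases (hP y).eq_or_lt with h0 | h0
  · rw [← h0, Real.zero_rpow (by linarith)]
    simp
  · have hq : 0 < Q y := (hQ y).lt_of_ne fun h1 => h0.ne' (h y h1.symm)
    rw [Real.rpow_add h0, Real.rpow_one, Real.rpow_def_of_pos h0, Real.rpow_def_of_pos hq, mul_assoc,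
      ← Real.exp_add, hl]
    ring_nf

theorem outMarginal_nonneg (V : X → ProbDist Y) (a : ProbDist X) (y : Y) : 0 ≤ outMarginal V a y :=
  Finset.sum_nonneg fun x _ => mul_nonneg ((V x).nonneg y) (a.nonneg x)

theorem sum_outMarginal (V : X → ProbDist Y) (a : ProbDist X) : ∑ y, outMarginal V a y = 1 := by
  rw [← sndMarginal_jointDist]
  have := sum_sndMarginal_mul (jointDist a V) fun _ => 1
  simpa [(jointDist_mem a V).2] using this

theorem absCont_outMarginal_of_absCont {V W : X → ProbDist Y} (h : ∀ x, AbsCont (V x) (W x))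
    (a : ProbDist X) : AbsCont (outMarginal V a) (outMarginal W a) := by
  intro y hy
  refine Finset.sum_eq_zero fun x hx => ?_
  have := (Finset.sum_eq_zero_iff_of_nonneg fun x _ =>
    mul_nonneg ((W x).nonneg y) (a.nonneg x)).1 hy x hx
  rcases mul_eq_zero.1 this with h0 | h0
  · rw [h x y h0, zero_mul]
  · rw [h0, mul_zero]

/-- Data processing for the output distributions. -/
theorem sum_outMarginal_log_le {V W : X → ProbDist Y} (h : ∀ x, AbsCont (V x) (W x))
    (a : ProbDist X) :
    ∑ y, outMarginal V a y * (Real.log (outMarginal V a y) - Real.log (outMarginal W a y)) ≤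
      condKL (fun x => W x) (jointDist a V) := by
  have hm := jointDist_mem_of_absCont a h
  rw [condKL_jointDist_eq_sum hm, Fintype.sum_prod_type_right]
  refine Finset.sum_le_sum fun y _ => ?_
  have e : ∀ V : X → ProbDist Y, outMarginal V a y = ∑ x, jointDist a V (x, y) := fun V => by
    rw [← sndMarginal_jointDist]
    rfl
  rw [e, e]
  exact log_sum_inequality (fun x => (jointDist_mem a V).1 _) (fun x => (jointDist_mem a W).1 _)
    fun x hx => jointDist_pos_of_mem hm hx

/-- An upper bound uniform in the test channel, by the variational formula and data processing. As
`s → 0` it tends to the divergence of the output law from `Q`. -/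
theorem etaSup_le_log_powSum (hWQ : ∀ x, AbsCont (W x) Q) (hs : 0 < s) (a : ProbDist X) :
    etaSup s W Q a ≤ s⁻¹ * Real.log (powSum (1 + s) (outMarginal W a) Q) := by
  obtain ⟨V, hV, hVe⟩ := (etaSup_isGreatest s W Q a).1
  have hVW := absCont_outMarginal_of_absCont hV.1 a
  have hWQ' : AbsCont (outMarginal W a) Q :=
    absCont_outMarginal (jointDist_mem_of_absCont (W := fun _ => Q) a hWQ)
  have h1 := variational_le_log_powSum (s := s) (outMarginal_nonneg V a) (sum_outMarginal V a)
    (outMarginal_nonneg W a) Q.nonneg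
    (fun y hy => (outMarginal_nonneg W a y).lt_of_ne fun h0 => hy.ne' (hVW y h0.symm))
    (fun y hy => (Q.nonneg y).lt_of_ne fun h0 => hy.ne' (hVW y (hWQ' y h0.symm)))
  rw [← klReal_eq_sum] at h1
  have h2 := mul_le_mul_of_nonneg_left (sum_outMarginal_log_le hV.1 a) (by linarith : 0 ≤ 1 + s)
  rw [le_inv_mul_iff₀ hs, ← hVe]
  simp only [etaReal, sndMarginal_jointDist]
  refine le_trans (le_of_eq ?_) ((sub_le_sub_left h2 _).trans h1)
  field_simp
  ring

/-- The tangent argument needs `s > 0`. This semicontinuity at zero, together with monotonicity in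
the order, carries the coding bound over to relative entropy. -/
theorem eventually_plusReal_lt (hWQ : ∀ x, AbsCont (W x) Q) (a : ProbDist X) {v : ℝ}
    (hv : plusReal 0 W Q R a < v) : ∀ᶠ s in 𝓝[>] 0, plusReal s W Q R a < v := by
  obtain ⟨h1, h2⟩ := max_lt_iff.1 hv
  have hrate : Tendsto (fun s => ∑ x, a x * rateReal s W Q x - R) (𝓝[>] 0)
      (𝓝 (∑ x, a x * rateReal 0 W Q x - R)) := by
    refine Tendsto.sub_const (tendsto_finsetSum _ fun x _ => Tendsto.const_mul _ ?_) _
    simp only [rateReal, if_true]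
    refine (tendsto_log_powSum (W x).nonneg (W x).sum_eq_one Q.nonneg (hWQ x)).congr' ?_
    filter_upwards [self_mem_nhdsWithin] with s hs
    rw [if_neg (ne_of_gt hs)]
  have hWQ' : AbsCont (outMarginal W a) Q :=
    absCont_outMarginal (jointDist_mem_of_absCont (W := fun _ => Q) a hWQ)
  have hkl : klReal Q (outMarginal W a) < v := by
    have := etaReal_le_etaSup (Q := Q) a (mem_etaSet 0 W)
    rw [etaReal, condKL_jointDist_self, mul_zero, zero_add, sndMarginal_jointDist] at this
    exact this.trans_lt h2
  filter_upwards [hrate.eventually_lt_const h1, self_mem_nhdsWithin,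
    (tendsto_log_powSum (outMarginal_nonneg W a) (sum_outMarginal W a) Q.nonneg hWQ').eventually_lt_const
      hkl] with s h3 hs h4
  exact max_lt h3 ((etaSup_le_log_powSum hWQ hs a).trans_lt h4)

theorem eventually_conventionalDiv_le (hWQ : ∀ x, AbsCont (W x) Q) (hs : 0 ≤ s) (hs1 : s ≤ 1)
    {M : ℕ → ℕ} (hM : ∀ n, 0 < M n)
    (hMR : Tendsto (fun n : ℕ => |Real.log (M n) / n - R|) atTop (𝓝 0)) {a : ProbDist X}
    {z : ∀ n : ℕ, Fin n → X} (hz : Tendsto (fun n => emp (z n)) atTop (𝓝 (a : X → ℝ)))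
    {v : ℝ} (hv : plusReal s W Q R a < v) :
    ∀ᶠ n in atTop,
      conventionalDiv (1 + s) W Q (M n) n (permDist (z n)) ≤ ((n * v : ℝ) : EReal) := by
  rcases hs.eq_or_lt with h | h
  · subst h
    obtain ⟨t, ht, ht0, ht1⟩ : ∃ t, plusReal t W Q R a < v ∧ 0 < t ∧ t < 1 := by
      refine ((eventually_plusReal_lt hWQ a hv).and ?_).exists
      exact Ioo_mem_nhdsGT one_pos
    filter_upwards [eventually_conventionalDiv_le_of_pos hWQ ht0 ht1.le hM hMR hz ht] with n hn
    rw [add_zero]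
    exact (conventionalDiv_one_le hWQ ht0 (hM n) _).trans hn
  · exact eventually_conventionalDiv_le_of_pos hWQ h hs1 hM hMR hz hv

/-- Upper and lower bounds for the orders `1 + s`. -/
theorem tendsto_resolvability_plus [Nonempty X] (hWQ : ∀ x, AbsCont (W x) Q) (hs : 0 ≤ s)
    (hs1 : s ≤ 1) {M : ℕ → ℕ} (hM : ∀ n, 0 < M n)
    (hMR : Tendsto (fun n : ℕ => |Real.log (M n) / n - R|) atTop (𝓝 0)) :
    (∃ a : ProbDist X, plusObjective s W Q R a = gammaPlus s W Q R) ∧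
      Tendsto (fun n : ℕ => ((1 / n : ℝ) : EReal) * resolvability (1 + s) W Q (M n) n)
        atTop (𝓝 (gammaPlus s W Q R)) ∧
      ∃ pX : ∀ n : ℕ, ProbDist (Fin n → X),
        Tendsto (fun n : ℕ => ((1 / n : ℝ) : EReal) * conventionalDiv (1 + s) W Q (M n) n (pX n))
          atTop (𝓝 (gammaPlus s W Q R)) := by
  obtain ⟨a, ha, hmin⟩ := exists_plusReal_eq_gammaPlus (R := R) hWQ hs
  obtain ⟨z, -, hz⟩ := exists_words_tendsto_emp a.2
  have hlow : ∀ᶠ n : ℕ in atTop, ((plusReal s W Q R a - |Real.log (M n) / n - R| : ℝ) : EReal) ≤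
      ((1 / n : ℝ) : EReal) * resolvability (1 + s) W Q (M n) n := by
    filter_upwards [eventually_gt_atTop 0] with n hn
    exact coe_le_one_div_mul hn (le_resolvability_of_le_codeDiv fun k pU f =>
      le_codeDiv_plus hWQ hs (hM n) hn hmin pU.nonneg pU.sum_eq_one f)
  have hle : ∀ n : ℕ, ((1 / n : ℝ) : EReal) * resolvability (1 + s) W Q (M n) n ≤
      ((1 / n : ℝ) : EReal) * conventionalDiv (1 + s) W Q (M n) n (permDist (z n)) := fun n =>
    one_div_mul_mono (resolvability_le_conventionalDiv _ _ _ _ _ _)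
  have hup : ∀ v : ℝ, plusReal s W Q R a < v → ∀ᶠ n : ℕ in atTop,
      ((1 / n : ℝ) : EReal) * conventionalDiv (1 + s) W Q (M n) n (permDist (z n)) ≤ (v : EReal) := by
    intro v hv
    filter_upwards [eventually_conventionalDiv_le hWQ hs hs1 hM hMR hz hv,
      eventually_gt_atTop 0] with n h1 hn
    exact one_div_mul_le_coe hn h1
  refine ⟨⟨a, by rw [plusObjective_eq_coe hWQ hs, ha]⟩, ?_, fun n => permDist (z n), ?_⟩
  · rw [ha]
    exact tendsto_of_eventually_bounds hMR hlow fun v hv =>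
      (hup v hv).mono fun n hn => (hle n).trans hn
  · rw [ha]
    exact tendsto_of_eventually_bounds hMR (hlow.mono fun n hn => hn.trans (hle n)) hup

end Plus

/-! ### The orders `1 - s` -/

section Minus

variable {X Y : Type*} [Fintype X] [Fintype Y] {W : X → ProbDist Y} {Q : ProbDist Y} {s R : ℝ}
  {M n : ℕ}

theorem lbReal_bound (hs : 0 < s) (hs1 : s < 1) (hM : 0 < M) (hn : 0 < n) {γ : ℝ}
    (hγ : ∀ p ∈ finiteSet W Q, γ ≤ lbReal s W Q R p) (c : Fin M → Fin n → X)
    (hS : 0 < powSum (1 - s) (outputDist W c) (prodDist Q n)) :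
    n * (γ - |Real.log M / n - R|) ≤
      -(1 / s) * Real.log (powSum (1 - s) (outputDist W c) (prodDist Q n)) := by
  have hn' : (0 : ℝ) < n := by exact_mod_cast hn
  obtain ⟨p, hpW, hpQ, h1, h2⟩ := exists_jointDist_le_neg_log_powSum hM hn c hs hs1 hS
  rcases le_max_iff.1 (hγ p ⟨hpW, hpQ⟩) with h | h
  · refine le_trans ?_ h1
    have h3 := log_le_of_rate (M := M) (R := R) hn
    have h4 := mul_le_mul_of_nonneg_left h hn'.le
    simp only [rateTermReal] at h4
    linarith
  · refine le_trans (mul_le_mul_of_nonneg_left ?_ hn'.le) h2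
    linarith [abs_nonneg (Real.log M / n - R)]

/-- Every random code obeys the lower bound for the orders `1 - s`. -/
theorem le_codeDiv_minus (hs : 0 < s) (hs1 : s < 1) (hM : 0 < M) (hn : 0 < n) {γ : ℝ}
    (hγ : ∀ p ∈ finiteSet W Q, γ ≤ lbReal s W Q R p) {U : Type*} [Fintype U] {pU : U → ℝ}
    (hU : ∀ u, 0 ≤ pU u) (hU1 : ∑ u, pU u = 1) (f : U → Fin M → Fin n → X) :
    ((n * (γ - |Real.log M / n - R|) : ℝ) : EReal) ≤ codeDiv (1 - s) W Q pU f := by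
  have hS0 : ∀ u, 0 ≤ powSum (1 - s) (outputDist W (f u)) (prodDist Q n) := fun u =>
    powSum_nonneg (outputDist_nonneg _ _) (prodDist_nonneg Q.nonneg)
  rcases (Finset.sum_nonneg fun u _ => mul_nonneg (hU u) (hS0 u) :
    0 ≤ ∑ u, pU u * powSum (1 - s) (outputDist W (f u)) (prodDist Q n)).eq_or_lt with h | h
  · rw [codeDiv_eq_top (by linarith) (by linarith) hU f h.symm]
    exact le_top
  · rw [codeDiv_eq_coe (by linarith) (by linarith) (Or.inl (by linarith)) hU f h,
      EReal.coe_le_coe_iff]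
    have e : (1 - s - 1)⁻¹ = -(1 / s) := by
      rw [sub_sub_cancel_left, inv_neg, one_div]
    rw [e]
    -- The prefactor of the logarithm is negative, so the bound is averaged as an upper bound on
    -- power sums. Codebooks whose power sum is zero satisfy it trivially.
    have hle : ∀ u, powSum (1 - s) (outputDist W (f u)) (prodDist Q n) ≤
        Real.exp (-(s * (n * (γ - |Real.log M / n - R|)))) := by
      intro u
      rcases (hS0 u).eq_or_lt with h0 | h0
      · rw [← h0]
        positivity
      · rw [← Real.log_le_iff_le_exp h0]
        have h1 := mul_le_mul_of_nonneg_left (lbReal_bound hs hs1 hM hn hγ (f u) h0) hs.le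
        have h2 : s * (-(1 / s) * Real.log (powSum (1 - s) (outputDist W (f u)) (prodDist Q n))) =
            -Real.log (powSum (1 - s) (outputDist W (f u)) (prodDist Q n)) := by
          field_simp
        linarith
    have hsum : ∑ u, pU u * powSum (1 - s) (outputDist W (f u)) (prodDist Q n) ≤
        Real.exp (-(s * (n * (γ - |Real.log M / n - R|)))) :=
      sum_mul_le_of_forall_le hU hU1 hle
    rw [← Real.log_le_iff_le_exp h] at hsum
    have h1 := mul_le_mul_of_nonneg_left hsum (by positivity : 0 ≤ 1 / s)
    have h2 : 1 / s * -(s * (n * (γ - |Real.log M / n - R|))) =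
        -(n * (γ - |Real.log M / n - R|)) := by
      field_simp
    linarith

theorem gammaLB_le_liminf [Nonempty X] (hs : 0 < s) (hs1 : s < 1) {M : ℕ → ℕ} (hM : ∀ n, 0 < M n)
    (hMR : Tendsto (fun n : ℕ => |Real.log (M n) / n - R|) atTop (𝓝 0)) :
    gammaLB s W Q R ≤
      liminf (fun n : ℕ => ((1 / n : ℝ) : EReal) * resolvability (1 - s) W Q (M n) n) atTop := by
  have key : ∀ γ : ℝ, (∀ p ∈ finiteSet W Q, γ ≤ lbReal s W Q R p) → (γ : EReal) ≤
      liminf (fun n : ℕ => ((1 / n : ℝ) : EReal) * resolvability (1 - s) W Q (M n) n) atTop := by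
    intro γ hγ
    rw [← (tendsto_coe_sub hMR).liminf_eq]
    refine liminf_le_liminf ?_
    filter_upwards [eventually_gt_atTop 0] with n hn
    exact coe_le_one_div_mul hn (le_resolvability_of_le_codeDiv fun k pU f =>
      le_codeDiv_minus hs hs1 (hM n) hn hγ pU.nonneg pU.sum_eq_one f)
  rcases (gammaLB_attained (W := W) (Q := Q) (R := R) hs hs1).2 with ⟨h, -⟩ | ⟨p, -, h, hmin⟩
  -- With no joint law of finite divergence the hypothesis of `key` is vacuous, so every real number
  -- is a lower bound.
  · refine le_top.trans_eq ((EReal.eq_top_iff_forall_lt _).2 fun y => ?_).symm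
    refine lt_of_lt_of_le (EReal.coe_lt_coe_iff.2 (lt_add_one y)) (key (y + 1) ?_)
    simp [h]
  · rw [h]
    exact key _ hmin

theorem eventually_conventionalDiv_minus_le (hs : 0 < s) (hs1 : s < 1) {M : ℕ → ℕ}
    (hM : ∀ n, 0 < M n) (hMR : Tendsto (fun n : ℕ => |Real.log (M n) / n - R|) atTop (𝓝 0))
    {p : X × Y → ℝ} (hp : p ∈ finiteSet W Q) {z : ∀ n : ℕ, Fin n → X × Y}
    (hzp : ∀ n i, 0 < p (z n i)) (hz : Tendsto (fun n => emp (z n)) atTop (𝓝 p))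
    {v : ℝ} (hv : ubReal s W Q R p < v) :
    ∀ᶠ n in atTop, conventionalDiv (1 - s) W Q (M n) n (permDist (Prod.fst ∘ z n)) ≤
      ((n * v : ℝ) : EReal) := by
  set e := (v - ubReal s W Q R p) / 2 with he
  have he0 : 0 < e := by rw [he]; linarith
  -- Half of the gap is given up so that `g` stays below the least divergence of all couplings at
  -- types near `p`, while the objective with `g` in place of the minimum is still below `v`.
  set g := minCondKL W p - e with hg
  let h : (X × Y → ℝ) → ℝ := fun p => max (rateTermReal s W Q R p)
    ((1 / s) * condKL (fun x => W x) p + klReal Q (sndMarginal p) - g)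
  have hcont : Continuous h := continuous_rateTermReal.max
    (((continuous_const.mul (continuous_condKL _)).add
      ((continuous_klReal _).comp continuous_sndMarginal)).sub continuous_const)
  have hp' : h p < v := by
    obtain ⟨h1, h2⟩ := max_le_iff.1 (le_refl (ubReal s W Q R p))
    refine max_lt (by linarith) ?_
    rw [hg]
    linarith
  obtain ⟨v', hv1, hv2⟩ := exists_between hp'
  have h3 : Tendsto (fun n : ℕ => |Real.log (M n) / n - R| +
      codingError (Real.log 2) ((1 / s) * Fintype.card (X × Y) + Fintype.card Y) n) atTop
        (𝓝 (0 + 0)) := hMR.add (tendsto_error _ _)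
  rw [add_zero] at h3
  filter_upwards [hz.eventually (eventually_lt_condKL hp.1 (by linarith : g < minCondKL W p)),
    (hcont.tendsto p).comp hz |>.eventually_lt_const hv1,
    h3.eventually_lt_const (sub_pos.2 hv2), eventually_gt_atTop 0] with n h4 h5 h6 hn
  have hn' : (0 : ℝ) < n := by exact_mod_cast hn
  have hzW : ∀ i, 0 < W (z n i).1 (z n i).2 := fun i => ((W _).nonneg _).lt_of_ne fun h0 =>
    (hzp n i).ne' (hp.1.2 _ _ h0.symm)
  have hzQ : ∀ i, 0 < Q (z n i).2 := fun i => (Q.nonneg _).lt_of_ne fun h0 =>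
    (hzp n i).ne' (hp.2.2 (z n i).1 _ h0.symm)
  obtain ⟨hpos, hle⟩ := neg_log_sum_codebook_powSum_le (hM n) hn (z n) hzW hzQ hs hs1 (g := g)
    fun q hq h1 h2 => (h4 q ⟨hq, h1, h2⟩).le
  have hU : ∀ c : Fin (M n) → Fin n → X, 0 ≤ ∏ m, permDist (Prod.fst ∘ z n) (c m) := fun c =>
    Finset.prod_nonneg fun m _ => (permDist _).nonneg _
  have e1 : (1 - s - 1)⁻¹ = -(1 / s) := by
    rw [sub_sub_cancel_left, inv_neg, one_div]
  rw [conventionalDiv, codeDiv_eq_coe (by linarith) (by linarith) (Or.inl (by linarith)) hU id hpos,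
    EReal.coe_le_coe_iff, e1]
  refine hle.trans ?_
  have e2 : n * codingError (Real.log 2) ((1 / s) * Fintype.card (X × Y) + Fintype.card Y) n =
      (1 / s) * (Fintype.card (X × Y) * (1 + Real.log (n + 1))) +
        (Fintype.card Y * (1 + Real.log (n + 1)) + Real.log 2) := by
    rw [codingError, mul_div_cancel₀ _ hn'.ne']
    ring
  rw [← e2]
  have h5' : h (emp (z n)) < v' := h5
  obtain ⟨h7, h8⟩ := max_lt_iff.1 h5'
  have h9 := le_log_of_rate (M := M n) (R := R) hn
  have h10 := mul_le_mul_of_nonneg_left h7.le hn'.le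
  have h11 := mul_le_mul_of_nonneg_left h8.le hn'.le
  have h12 := mul_le_mul_of_nonneg_left h6.le hn'.le
  have h13 : 0 ≤ n * |Real.log (M n) / n - R| := mul_nonneg hn'.le (abs_nonneg _)
  have h14 : max (n * ((1 / s - 1) * condKL (fun x => W x) (emp (z n)) +
        condKL (fun _ : X => Q) (emp (z n))) - Real.log (M n))
      (n * ((1 / s) * condKL (fun x => W x) (emp (z n)) + klReal Q (sndMarginal (emp (z n))) - g)) ≤
      n * (v' + |Real.log (M n) / n - R|) := by
    refine max_le ?_ ?_
    · simp only [rateTermReal] at h10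
      linarith
    · linarith
  linarith

theorem exists_limsup_conventionalDiv_le [Nonempty X] (hs : 0 < s) (hs1 : s < 1) {M : ℕ → ℕ}
    (hM : ∀ n, 0 < M n) (hMR : Tendsto (fun n : ℕ => |Real.log (M n) / n - R|) atTop (𝓝 0)) :
    ∃ pX : ∀ n : ℕ, ProbDist (Fin n → X),
      limsup (fun n : ℕ => ((1 / n : ℝ) : EReal) * conventionalDiv (1 - s) W Q (M n) n (pX n))
        atTop ≤ gammaUB s W Q R := by
  rcases (gammaUB_attained (W := W) (Q := Q) (R := R) hs hs1).2 with ⟨-, h⟩ | ⟨p, hp, h, -⟩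
  · exact ⟨fun n => Classical.arbitrary _, by rw [h]; exact le_top⟩
  · obtain ⟨z, hzp, hz⟩ := exists_words_tendsto_emp hp.1.1
    refine ⟨fun n => permDist (Prod.fst ∘ z n), ?_⟩
    rw [h]
    refine le_of_forall_gt_imp_ge_of_dense fun b hb => ?_
    obtain ⟨v, h1, h2⟩ := EReal.lt_iff_exists_real_btwn.1 hb
    refine (limsup_le_of_le (h := ?_)).trans h2.le
    filter_upwards [eventually_conventionalDiv_minus_le hs hs1 hM hMR hp hzp hz
      (EReal.coe_lt_coe_iff.1 h1), eventually_gt_atTop 0] with n h3 hn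
    exact one_div_mul_le_coe hn h3

end Minus

/-! ### The order `0` -/

section Zero

variable {A : Type*} [Fintype A] {P Q : A → ℝ}

theorem renyiDiv_zero_eq (P Q : A → ℝ) : renyiDiv 0 P Q =
    ((-1 : ℝ) : EReal) * ENNReal.log (∑ x with 0 < P x, ENNReal.ofReal (Q x)) := by
  have e : ∑ x with 0 < P x, ENNReal.ofReal (P x) ^ (0 : ℝ) * ENNReal.ofReal (Q x) ^ (1 - (0 : ℝ)) =
      ∑ x with 0 < P x, ENNReal.ofReal (Q x) :=
    Finset.sum_congr rfl fun x _ => by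
      rw [ENNReal.rpow_zero, sub_zero, ENNReal.rpow_one, one_mul]
  have hc : ((0 : ℝ) - 1)⁻¹ = -1 := by norm_num
  rw [renyiDiv, if_neg zero_ne_one, e, hc]

theorem renyiDiv_zero_nonneg (hQ : ∀ x, 0 ≤ Q x) (hQ1 : ∑ x, Q x = 1) : 0 ≤ renyiDiv 0 P Q := by
  rw [renyiDiv_zero_eq, EReal.coe_neg, EReal.coe_one, neg_one_mul, EReal.neg_nonneg,
    ENNReal.log_le_zero_iff]
  calc _ ≤ ∑ x, ENNReal.ofReal (Q x) :=
        Finset.sum_le_sum_of_subset (Finset.filter_subset _ _)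
    _ = 1 := by rw [← ENNReal.ofReal_sum_of_nonneg fun x _ => hQ x, hQ1, ENNReal.ofReal_one]

theorem renyiDiv_zero_eq_zero (hP : ∀ x, 0 ≤ P x) (hQ : ∀ x, 0 ≤ Q x) (hQ1 : ∑ x, Q x = 1)
    (h : AbsCont Q P) : renyiDiv 0 P Q = 0 := by
  have e : ∑ x with 0 < P x, ENNReal.ofReal (Q x) = 1 := by
    rw [← ENNReal.ofReal_one, ← hQ1, ENNReal.ofReal_sum_of_nonneg fun x _ => hQ x]
    refine Finset.sum_filter_of_ne fun x _ hx => (hP x).lt_of_ne fun h0 => hx ?_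
    rw [h x h0.symm, ENNReal.ofReal_zero]
  rw [renyiDiv_zero_eq, e, ENNReal.log_one, mul_zero]

variable {X Y : Type*} [Fintype X] [Fintype Y] {W : X → ProbDist Y} {Q : ProbDist Y}

/-- Sending `x₀` constantly gives positive probability to every output word in the support of `Q^n`,
so the divergence is zero at each `n`; it is never negative because the reference mass of a set is
at most one. -/
theorem resolvability_zero_eq_zero {M : ℕ} (hM : 0 < M) (n : ℕ) {x₀ : X} (h : AbsCont Q (W x₀)) :
    resolvability 0 W Q M n = 0 := by
  have hprod : ∀ {k : ℕ} (pU : ProbDist (Fin k)),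
      ∑ z : (Fin n → Y) × Fin k, prodDist Q n z.1 * pU z.2 = 1 := fun pU => by
    rw [Fintype.sum_prod_type]
    simp only [← Finset.mul_sum, pU.sum_eq_one, mul_one]
    exact sum_prodDist Q.sum_eq_one
  refine le_antisymm ?_ (le_resolvability_of_le_codeDiv fun k pU f => renyiDiv_zero_nonneg
    (fun z => mul_nonneg (prodDist_nonneg Q.nonneg _) (pU.nonneg _)) (hprod pU))
  let pU : ProbDist (Fin 1) := ⟨fun _ => 1, fun _ => zero_le_one, by simp⟩
  refine iInf_le_of_le 1 (iInf_le_of_le pU (iInf_le_of_le (fun _ _ _ => x₀) (le_of_eq ?_)))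
  refine renyiDiv_zero_eq_zero (fun z => mul_nonneg (pU.nonneg _) (outputDist_nonneg W _ _))
    (fun z => mul_nonneg (prodDist_nonneg Q.nonneg _) (pU.nonneg _)) (hprod pU) ?_
  intro z hz
  have h1 : (1 : ℝ) * outputDist W (fun _ _ => x₀ : Fin M → Fin n → X) z.1 = 0 := hz
  rw [one_mul] at h1
  have hle := le_outputDist W (fun _ _ => x₀ : Fin M → Fin n → X) ⟨0, hM⟩ z.1
  rw [h1] at hle
  have hM' : (0 : ℝ) < (M : ℝ)⁻¹ := by positivity
  have h2 : ∏ i, W x₀ (z.1 i) = 0 := le_antisymm (nonpos_of_mul_nonpos_right hle hM')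
    (Finset.prod_nonneg fun i _ => (W _).nonneg _)
  obtain ⟨i, -, hi⟩ := Finset.prod_eq_zero_iff.1 h2
  have h3 : prodDist Q n z.1 = 0 := Finset.prod_eq_zero (Finset.mem_univ i) (h _ hi)
  simp only [h3, zero_mul]

end Zero

/-! ### The resolvability theorem. -/

theorem theorem2 {X Y : Type*} [Fintype X] [Nonempty X] [Fintype Y]
    (W : X → ProbDist Y) (Q : ProbDist Y) (R : ℝ) (hR : 0 < R)
    (M : ℕ → ℕ) (hM : ∀ n, 0 < M n)
    (hMR : Tendsto (fun n : ℕ => Real.log (M n) / n) atTop (𝓝 R)) :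
    -- orders `1 + s`, `s ∈ [0, 1]`: exact limit, reached by conventional random codes
    ((∀ x, AbsCont (W x) Q) → ∀ s ∈ Set.Icc (0 : ℝ) 1,
      (∀ a : ProbDist X, ∃ V : X → ProbDist Y, eta s W Q a V = ⨆ V', eta s W Q a V') ∧
      (∃ a : ProbDist X, plusObjective s W Q R a = gammaPlus s W Q R) ∧
      Tendsto (fun n : ℕ => ((1 / n : ℝ) : EReal) * resolvability (1 + s) W Q (M n) n)
        atTop (𝓝 (gammaPlus s W Q R)) ∧
      ∃ pX : ∀ n : ℕ, ProbDist (Fin n → X),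
        Tendsto (fun n : ℕ => ((1 / n : ℝ) : EReal) * conventionalDiv (1 + s) W Q (M n) n (pX n))
          atTop (𝓝 (gammaPlus s W Q R))) ∧
    -- orders `1 - s`, `s ∈ (0, 1)`: lower and upper bounds, no absolute continuity needed
    (∀ s ∈ Set.Ioo (0 : ℝ) 1,
      (∃ (a : ProbDist X) (V : X → ProbDist Y), lbObjective s W Q R a V = gammaLB s W Q R) ∧
      (∀ (a : ProbDist X) (V : X → ProbDist Y), ∃ V' : X → ProbDist Y,
        outMarginal V' a = outMarginal V a ∧ condRelEntropy V' W a = minCondRelEntropy W a V) ∧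
      (∃ (a : ProbDist X) (V : X → ProbDist Y), ubObjective s W Q R a V = gammaUB s W Q R) ∧
      gammaLB s W Q R ≤
        liminf (fun n : ℕ => ((1 / n : ℝ) : EReal) * resolvability (1 - s) W Q (M n) n) atTop ∧
      liminf (fun n : ℕ => ((1 / n : ℝ) : EReal) * resolvability (1 - s) W Q (M n) n) atTop ≤
        limsup (fun n : ℕ => ((1 / n : ℝ) : EReal) * resolvability (1 - s) W Q (M n) n) atTop ∧
      limsup (fun n : ℕ => ((1 / n : ℝ) : EReal) * resolvability (1 - s) W Q (M n) n) atTop ≤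
        gammaUB s W Q R ∧
      ∃ pX : ∀ n : ℕ, ProbDist (Fin n → X),
        limsup (fun n : ℕ => ((1 / n : ℝ) : EReal) * conventionalDiv (1 - s) W Q (M n) n (pX n))
          atTop ≤ gammaUB s W Q R) ∧
    -- order `0`, for a channel with an input letter that reaches the whole support of `Q`
    ((∃ x₀ : X, AbsCont Q (W x₀)) →
      Tendsto (fun n : ℕ => ((1 / n : ℝ) : EReal) * resolvability 0 W Q (M n) n) atTop (𝓝 0)) := by
  have hδ : Tendsto (fun n : ℕ => |Real.log (M n) / n - R|) atTop (𝓝 0) := by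
    have := (hMR.sub_const R).abs
    simpa using this
  refine ⟨fun hWQ s hs => ⟨fun a => ?_, tendsto_resolvability_plus hWQ hs.1 hs.2 hM hδ⟩,
    fun s hs => ?_, ?_⟩
  · rw [iSup_eta hWQ hs.1]
    exact exists_eta_eq hWQ a
  · obtain ⟨pX, hpX⟩ := exists_limsup_conventionalDiv_le (W := W) (Q := Q) hs.1 hs.2 hM hδ
    refine ⟨(gammaLB_attained hs.1 hs.2).1, exists_condRelEntropy_eq_minCondRelEntropy W,
      (gammaUB_attained hs.1 hs.2).1, gammaLB_le_liminf hs.1 hs.2 hM hδ, liminf_le_limsup,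
      le_trans (limsup_le_limsup ?_) hpX, pX, hpX⟩
    exact Eventually.of_forall fun n =>
      one_div_mul_mono (resolvability_le_conventionalDiv _ _ _ _ _ _)
  · rintro ⟨x₀, hx₀⟩
    simp only [resolvability_zero_eq_zero (hM _) _ hx₀, mul_zero]
    exact tendsto_const_nhds
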